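/- Let $n\in\mathbb N=\{1,2,\dots\}$, $p\in[1,\infty)$, $\gamma\in\mathbb R\setminus\{0\}$ and $q\in(0,\infty)$. Let $\dot W^{1,p}(\mathbb R^n)$ be the set of all locally integrable functions $f$ on $\mathbb R^n$ that have a weak gradient $\nabla f$ with $\|\nabla f\|_{L^p}:=\|\,|\nabla f|\,\|_{L^p(\mathbb R^n)}<\infty$. For $\lambda\in(0,\infty)$ put $$E_{\lambda,\frac{\gamma}{q}}[f]:=\Big\{(x,y)\in\mathbb R^n\times\mathbb R^n:\ x\ne y,\ \frac{|f(x)-f(y)|}{|x-y|^{1+\frac{\gamma}{q}}}>\lambda\Big\},$$ $$\Phi_\lambda(f):=\lambda\,\Big\|\Big[\int_{\mathbb R^n}\mathbf 1_{E_{\lambda,\frac{\gamma}{q}}[f]}(\cdot,y)\,|\cdot-y|^{\gamma-n}\,dy\Big]^{\frac1q}\Big\|_{L^p(\mathbb R^n)}\in[0,\infty],$$ and let $\kappa(q,n):=\int_{\mathbb S^{n-1}}|e\cdot\omega|^q\,d\omega$, where $e$ is any unit vector in $\mathbb R^n$ and $d\omega$ is surface measure (counting measure if $n=1$). Assume that one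 of the following holds: (a) $p\in(n,\infty)$; (b) $p\in[1,n]$, $\gamma\in(0,\infty)$, and $n(\frac1p-\frac1q)<1$; (c) $p\in(1,n]$, $\gamma\in(-\infty,0)$, and $q\in(0,p]$; (d) $p=q=n=1$ and $\gamma\in(-\infty,-1)$. Then the following hold. (i) There are positive constants $c$ and $C$ such that, for all real-valued or complex-valued $f\in\dot W^{1,p}(\mathbb R^n)$, $$c\,\|\nabla f\|_{L^p}\le\sup_{\lambda\in(0,\infty)}\Phi_\lambda(f)\le C\,\|\nabla f\|_{L^p}.$$ (ii) If $\gamma\in(0,\infty)$, then, for all real-valued $f\in\dot W^{1,p}(\mathbb R^n)$, $$\lim_{\lambda\to\infty}\Phi_\lambda(f)=\Big[\frac{\kappa(q,n)}{\gamma}\Big]^{\frac1q}\|\nabla f\|_{L^p}.$$ (iii) If $\gamma\in(-\infty,0)$ and, in addition, either $n\ge2$ and $q\in(0,\frac{n-\gamma}{n}p)$, or $n=1$, $q\in(0,-p\gamma)$ and $\gamma\in(-\infty,-1)$, then, for all real-valued $f\in\dot W^{1,p}(\mathbb R^n)$, $$\lim_{\lambda\to0^+}\Phi_\lambda(f)=\Big[-\frac{\kappa(q,n)}{\gamma}\Big]^{\frac1q}\|\nabla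 f\|_{L^p}.$$ -/

import Mathlib

open MeasureTheory Filter Topology
open scoped ENNReal ContDiff

namespace BVY

/-- Euclidean space `ℝⁿ`. -/
abbrev E (n : ℕ) : Type := EuclideanSpace ℝ (Fin n)

/-- `g = (g₁, …, gₙ)` is a weak gradient of `f` on `ℝⁿ`: `g` is locally integrable and
`∫ f ∂ⱼφ = - ∫ gⱼ φ` for every index `j` and every test function `φ`, that is, every smooth
function `φ` with compact support. -/
def IsWeakGradient {n : ℕ} {𝕜 : Type*} [RCLike 𝕜]
    (f : E n → 𝕜) (g : E n → EuclideanSpace 𝕜 (Fin n)) : Prop :=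
  LocallyIntegrable g volume ∧
    ∀ (j : Fin n) (φ : E n → ℝ), ContDiff ℝ ∞ φ → HasCompactSupport φ →
      ∫ x, (fderiv ℝ φ x (EuclideanSpace.single j 1)) • f x = - ∫ x, φ x • g x j

/-- Two weak gradients of the same function agree almost everywhere. -/
theorem IsWeakGradient.ae_eq {n : ℕ} {𝕜 : Type*} [RCLike 𝕜] {f : E n → 𝕜}
    {g h : E n → EuclideanSpace 𝕜 (Fin n)}
    (hg : IsWeakGradient f g) (hh : IsWeakGradient f h) : g =ᵐ[volume] h := by
  have loc : ∀ {u : E n → EuclideanSpace 𝕜 (Fin n)}, LocallyIntegrable u volume →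
      ∀ j, LocallyIntegrable (fun x => u x j) volume := by
    intro u hu j x
    obtain ⟨s, hs, hi⟩ := hu x
    exact ⟨s, hs, (EuclideanSpace.proj (𝕜 := 𝕜) j).integrable_comp hi⟩
  have key : ∀ j, ∀ᵐ x ∂(volume : Measure (E n)), g x j = h x j := fun j =>
    ae_eq_of_integral_contDiff_smul_eq (loc hg.1 j) (loc hh.1 j) fun φ hφ hc =>
      neg_injective ((hg.2 j φ hφ hc).symm.trans (hh.2 j φ hφ hc))
  filter_upwards [ae_all_iff.2 key] with x hx
  ext j
  exact hx j

open Classical in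
/-- The weak gradient `∇f` of `f`, unique up to null sets (and `0` if `f` has none). -/
noncomputable def weakGradient {n : ℕ} {𝕜 : Type*} [RCLike 𝕜]
    (f : E n → 𝕜) : E n → EuclideanSpace 𝕜 (Fin n) :=
  if h : ∃ g, IsWeakGradient f g then h.choose else 0

/-- The homogeneous Sobolev semi-norm `‖ |∇f| ‖_{L^p(ℝⁿ)}`. -/
noncomputable def gradNorm {n : ℕ} {𝕜 : Type*} [RCLike 𝕜] (p : ℝ) (f : E n → 𝕜) : ℝ≥0∞ :=
  eLpNorm (weakGradient f) (ENNReal.ofReal p) volume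

/-- Membership in the homogeneous Sobolev space `Ẇ^{1,p}(ℝⁿ)`: `f` is locally integrable, has a
weak gradient, and `‖ |∇f| ‖_{L^p(ℝⁿ)} < ∞`. -/
def MemHomSobolev {n : ℕ} {𝕜 : Type*} [RCLike 𝕜] (p : ℝ) (f : E n → 𝕜) : Prop :=
  LocallyIntegrable f volume ∧ (∃ g, IsWeakGradient f g) ∧ gradNorm p f < ⊤

/-- `E_{t,b}[f] = {(x, y) : x ≠ y, |f(x) - f(y)| / |x - y|^{1 + b} > t}`. -/
def levelSet {n : ℕ} {𝕜 : Type*} [RCLike 𝕜] (f : E n → 𝕜) (t b : ℝ) : Set (E n × E n) :=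
  {z | z.1 ≠ z.2 ∧ ‖f z.1 - f z.2‖ / ‖z.1 - z.2‖ ^ (1 + b) > t}

/-- The functional
`t ‖ [∫ 𝟏_{E_{t,γ/q}[f]}(·, y) |· - y|^{γ - n} dy]^{1/q} ‖_{L^p(ℝⁿ)}`, with values in `[0, ∞]`. -/
noncomputable def levelNorm {n : ℕ} {𝕜 : Type*} [RCLike 𝕜]
    (p γ q : ℝ) (f : E n → 𝕜) (t : ℝ) : ℝ≥0∞ :=
  ENNReal.ofReal t *
    eLpNorm (fun x : E n =>
      (∫⁻ y, (levelSet f t (γ / q)).indicator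
        (fun z => ENNReal.ofReal (‖z.1 - z.2‖ ^ (γ - n))) (x, y)) ^ (1 / q))
      (ENNReal.ofReal p) volume

/-- `κ(q, n) = ∫_{𝕊ⁿ⁻¹} |e · ω|^q dω`, with respect to surface measure (counting measure on
`{-1, 1}` if `n = 1`), where `e` is a unit vector; the value does not depend on `e`. -/
noncomputable def kappa (q : ℝ) (n : ℕ) (e : E n) : ℝ :=
  ∫ w : Metric.sphere (0 : E n) 1, |inner ℝ e (w : E n)| ^ q ∂(volume : Measure (E n)).toSphere

end BVY

/-! Fix a weak gradient g of f. Everything except the last case below rests on one bound, valid for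
almost every x (`exists_levelInt_le_tailInt`): the inner integral at level t is at most C ∫₀^∞
R^(γ-1) min(1, (T(R) / (t R^(γ/q)))^r) dR, where T(R) is a damped supremum of L^s averages of |g|
over balls about x of radius at most 4R, and 1 ≤ s ≤ r, n(1/s - 1/r) < 1. The reason: |f(x) - f(y)|
is controlled by R times truncated Riesz potentials of |g| at x and y (`enorm_sub_le_potential`),
these potentials obey a Sobolev-Poincaré inequality (`exists_lintegral_potential_rpow_le`), and
Chebyshev's inequality in L^r is applied on each shell |x - y| ~ R.

Upper bound. With r > q and T bounded by a constant K, scaling gives C (K/t)^q. If p > 1, choose s <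
p and let K come from the maximal function of |g|^s: this yields a majorant independent of t,
integrable by the Hardy-Littlewood theorem (`exists_levelFun_rpow_le_maxFun`). If p = 1 and γ > 0,
take s = 1 and replace the maximal theorem by a Vitali covering estimate for the largest radius at
which an average of |g| exceeds τ R^(γ/q) (`exists_lintegral_iSup_rpow_le`). If p = q = n = 1 and γ
< -1, the fundamental theorem of calculus bounds |f(x) - f(y)| by the integral of |g| over B(x, 2|x
- y|), and a Vitali selection that prefers small balls handles the smallest crossing radius
(`exists_lintegral_crossSup_le`).

Limits. Near almost every x, f is a linear function with gradient g(x) plus a remainder whose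
gradient tends to 0 in L^s mean at x. The natural length at level t is t^(-q/γ), which tends to 0 in
both limits; after rescaling by it the remainder disappears, while the linear part is computed
exactly in polar coordinates (`levelInt_linMap`). Integration over x uses dominated convergence up
to an arbitrarily small error (`tendsto_lintegral_of_dominated_add`). For p > 1 the maximal function
dominates; for p = 1, |g| is split into a bounded part with bounded support and a part of small L¹
norm, to which the uniform bound applies.

Lower bound. The supremum over levels is at least the limit, and the spherical integral in the limit
controls |g(x)|^q from above, for real and complex gradients alike (`exists_enorm_rpow_le_dirInt`).
-/

namespace BVY

set_option linter.unusedSectionVars false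

/-! ### Averages over balls -/

/-- The average of a nonnegative function over the ball of radius `R` around `x`. -/
noncomputable def ballAvg {n : ℕ} (G : E n → ℝ≥0∞) (x : E n) (R : ℝ) : ℝ≥0∞ :=
  (∫⁻ y in Metric.ball x R, G y) / volume (Metric.ball x R)

section Averages

variable {n : ℕ} [NeZero n]

theorem volume_ball_eq (x : E n) {R : ℝ} (hR : 0 ≤ R) :
    volume (Metric.ball x R) = ENNReal.ofReal (R ^ n) * volume (Metric.ball (0 : E n) 1) := by
  simpa using Measure.addHaar_ball (volume : Measure (E n)) x hR

theorem volume_ball_pos (x : E n) {R : ℝ} (hR : 0 < R) : volume (Metric.ball x R) ≠ 0 :=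
  (Metric.measure_ball_pos _ _ hR).ne'

theorem volume_ball_ne_top (x : E n) (R : ℝ) : volume (Metric.ball x R) ≠ ⊤ :=
  measure_ball_lt_top.ne

theorem volume_ball_scale (x y : E n) {c R : ℝ} (hc : 0 ≤ c) (hR : 0 ≤ R) :
    volume (Metric.ball x (c * R)) = ENNReal.ofReal (c ^ n) * volume (Metric.ball y R) := by
  rw [volume_ball_eq x (mul_nonneg hc hR), volume_ball_eq y hR, mul_pow,
    ENNReal.ofReal_mul (by positivity), mul_assoc]

theorem lintegral_ball_eq_ballAvg (G : E n → ℝ≥0∞) (x : E n) {R : ℝ} (hR : 0 < R) :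
    ∫⁻ y in Metric.ball x R, G y = ballAvg G x R * volume (Metric.ball x R) := by
  rw [ballAvg, ENNReal.div_mul_cancel (volume_ball_pos x hR) (volume_ball_ne_top x R)]

theorem ballAvg_mono {G H : E n → ℝ≥0∞} (h : ∀ y, G y ≤ H y) (x : E n) (R : ℝ) :
    ballAvg G x R ≤ ballAvg H x R :=
  ENNReal.div_le_div_right (lintegral_mono h) _

theorem ballAvg_le_of_subset (G : E n → ℝ≥0∞) {x y : E n} {r c : ℝ} (hr : 0 < r) (hc : 0 < c)
    (h : Metric.ball x r ⊆ Metric.ball y (c * r)) :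
    ballAvg G x r ≤ ENNReal.ofReal (c ^ n) * ballAvg G y (c * r) := by
  have hv := volume_ball_scale y x hc.le hr.le
  rw [ballAvg, ballAvg, hv]
  have h1 : ENNReal.ofReal (c ^ n) ≠ 0 := by simpa using pow_pos hc n
  rw [ENNReal.div_eq_inv_mul, ENNReal.div_eq_inv_mul,
    ENNReal.mul_inv (Or.inl h1) (Or.inl ENNReal.ofReal_ne_top), ← mul_assoc, ← mul_assoc,
    ENNReal.mul_inv_cancel h1 ENNReal.ofReal_ne_top, one_mul]
  gcongr

end Averages

/-! ### Mollification of weakly differentiable functions -/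

section Mollification

variable {n : ℕ} [NeZero n] {𝕜 : Type*} [RCLike 𝕜]

/-- A bump function at scale `r`. -/
noncomputable def bump (n : ℕ) (r : Set.Ioi (0 : ℝ)) : ContDiffBump (0 : E n) where
  rIn := r / 2
  rOut := r
  rIn_pos := half_pos r.2
  rIn_lt_rOut := half_lt_self r.2

/-- Mollification of `f` at scale `r`. -/
noncomputable def mollify (r : Set.Ioi (0 : ℝ)) (f : E n → 𝕜) : E n → 𝕜 :=
  convolution ((bump n r).normed volume) f (ContinuousLinearMap.lsmul ℝ ℝ) volume

theorem mollify_eq_flip (r : Set.Ioi (0 : ℝ)) (f : E n → 𝕜) :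
    mollify r f = convolution f ((bump n r).normed volume)
      (ContinuousLinearMap.lsmul ℝ ℝ).flip volume :=
  (convolution_flip _).symm

theorem bump_normed_le (r : Set.Ioi (0 : ℝ)) (x z : E n) :
    ‖(bump n r).normed volume z‖ₑ ≤ 2 ^ n / volume (Metric.ball x (r : ℝ)) := by
  have h := (bump n r).normed_le_div_measure_closedBall_rOut volume 2
    (by simp only [bump]; linarith) z
  have h0 := (bump n r).nonneg_normed (μ := volume) z
  rw [Real.enorm_eq_ofReal h0]
  refine (ENNReal.ofReal_le_ofReal h).trans ?_
  have hr : (0 : ℝ) < r := r.2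
  have e1 : volume (Metric.closedBall (0 : E n) (bump n r).rOut) = volume (Metric.ball x (r:ℝ)) := by
    rw [Measure.addHaar_closedBall_eq_addHaar_ball, volume_ball_eq _ hr.le]
    exact volume_ball_eq _ hr.le
  rw [measureReal_def, e1, ENNReal.ofReal_div_of_pos
    (ENNReal.toReal_pos (volume_ball_pos x hr) (volume_ball_ne_top x _)),
    ENNReal.ofReal_toReal (volume_ball_ne_top x _), ENNReal.ofReal_pow (by norm_num)]
  simp

theorem hasFDerivAt_mollify (r : Set.Ioi (0 : ℝ)) {f : E n → 𝕜} (hf : LocallyIntegrable f volume)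
    (x : E n) : ∃ D : E n →L[ℝ] 𝕜, HasFDerivAt (mollify r f) D x ∧
      ∀ v, D v = ∫ t, (fderiv ℝ ((bump n r).normed volume) (x - t) v) • f t := by
  have hc : HasCompactSupport ((bump n r).normed volume) := (bump n r).hasCompactSupport_normed
  have hd : ContDiff ℝ 1 ((bump n r).normed volume) := (bump n r).contDiff_normed
  refine ⟨_, by
    rw [mollify_eq_flip]; exact hc.hasFDerivAt_convolution_right _ hf hd x, fun v => ?_⟩
  rw [convolution_precompR_apply _ hf (hc.fderiv ℝ) (hd.continuous_fderiv one_ne_zero)]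
  rfl

/-- The function t ↦ φ(x - t) is used as a test function; the sign from its chain rule cancels the
sign in the definition of a weak gradient. -/
theorem mollify_fderiv_single (r : Set.Ioi (0 : ℝ)) {f : E n → 𝕜}
    {g : E n → EuclideanSpace 𝕜 (Fin n)} (hg : IsWeakGradient f g) (x : E n) (j : Fin n) :
    ∫ t, (fderiv ℝ ((bump n r).normed volume) (x - t) (EuclideanSpace.single j 1)) • f t =
      ∫ t, (bump n r).normed volume (x - t) • g t j := by
  set φ := (bump n r).normed volume with hφ
  have hd : ContDiff ℝ ∞ φ := (bump n r).contDiff_normed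
  have hc : HasCompactSupport φ := (bump n r).hasCompactSupport_normed
  have h := hg.2 j (fun t => φ (x - t)) (hd.comp (contDiff_const.sub contDiff_id))
    (hc.comp_homeomorph (Homeomorph.subLeft x))
  have h2 : ∀ t, fderiv ℝ (fun t => φ (x - t)) t (EuclideanSpace.single j 1) =
      - fderiv ℝ φ (x - t) (EuclideanSpace.single j 1) := by
    intro t
    have h3 : HasFDerivAt (fun t => φ (x - t))
        ((fderiv ℝ φ (x - t)).comp (-ContinuousLinearMap.id ℝ (E n))) t :=
      HasFDerivAt.comp (g := φ) (f := fun t => x - t) t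
        ((hd.differentiable (by simp)) (x - t)).hasFDerivAt ((hasFDerivAt_id t).const_sub x)
    rw [h3.fderiv]; simp
  simp only [h2, neg_smul, integral_neg] at h
  exact neg_injective h

theorem enorm_mollify_fderiv_le (r : Set.Ioi (0 : ℝ)) {f : E n → 𝕜}
    (hf : LocallyIntegrable f volume)
    {g : E n → EuclideanSpace 𝕜 (Fin n)} (hg : IsWeakGradient f g) (x : E n) :
    ∃ D : E n →L[ℝ] 𝕜, HasFDerivAt (mollify r f) D x ∧ ∀ v, ‖D v‖ₑ ≤
      n * ‖v‖ₑ * ∫⁻ t, ‖(bump n r).normed volume (x - t)‖ₑ * ‖g t‖ₑ := by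
  obtain ⟨D, hD, hDv⟩ := hasFDerivAt_mollify r hf x
  refine ⟨D, hD, fun v => ?_⟩
  have hj : ∀ j, ‖D (EuclideanSpace.single j 1)‖ₑ ≤
      ∫⁻ t, ‖(bump n r).normed volume (x - t)‖ₑ * ‖g t‖ₑ := by
    intro j
    rw [hDv, mollify_fderiv_single r hg]
    refine (enorm_integral_le_lintegral_enorm _).trans (lintegral_mono fun t => ?_)
    rw [enorm_smul]
    gcongr
    exact enorm_le_iff_norm_le.2 (PiLp.norm_apply_le _ _)
  have hv : v = ∑ j, v j • (EuclideanSpace.single j (1:ℝ) : E n) := by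
    simpa using ((EuclideanSpace.basisFun (Fin n) ℝ).sum_repr v).symm
  conv_lhs => rw [hv, map_sum]
  refine (enorm_sum_le _ _).trans ?_
  calc ∑ j, ‖D (v j • (EuclideanSpace.single j (1:ℝ) : E n))‖ₑ
      ≤ ∑ j : Fin n, ‖v‖ₑ * ∫⁻ t, ‖(bump n r).normed volume (x - t)‖ₑ * ‖g t‖ₑ := by
        refine Finset.sum_le_sum fun j _ => ?_
        rw [map_smul, enorm_smul]
        gcongr
        · exact enorm_le_iff_norm_le.2 (PiLp.norm_apply_le _ _)
        · exact hj j
    _ = _ := by simp [mul_assoc]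

theorem lintegral_bump_mul_le (r : Set.Ioi (0 : ℝ)) (G : E n → ℝ≥0∞) (x : E n) :
    ∫⁻ t, ‖(bump n r).normed volume (x - t)‖ₑ * G t ≤ 2 ^ n * ballAvg G x r := by
  have hsupp : ∀ t, ‖(bump n r).normed volume (x - t)‖ₑ * G t ≤
      (Metric.ball x (r:ℝ)).indicator (fun t => 2 ^ n / volume (Metric.ball x (r : ℝ)) * G t) t := by
    intro t
    by_cases ht : t ∈ Metric.ball x (r:ℝ)
    · rw [Set.indicator_of_mem ht]
      gcongr
      exact bump_normed_le r x _
    · have : (bump n r).normed volume (x - t) = 0 := by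
        by_contra h
        have h' : x - t ∈ Function.support ((bump n r).normed volume) := h
        rw [ContDiffBump.support_normed_eq, mem_ball_zero_iff, ← dist_eq_norm, dist_comm] at h'
        exact ht h'
      simp [this]
  refine (lintegral_mono hsupp).trans ?_
  rw [lintegral_indicator Metric.isOpen_ball.measurableSet,
    lintegral_const_mul' _ _ (ENNReal.div_ne_top (by simp) (volume_ball_pos x r.2)), ballAvg,
    ENNReal.div_eq_inv_mul, ENNReal.div_eq_inv_mul]
  rw [mul_comm _ ((2:ℝ≥0∞)^n), mul_assoc]

theorem ballAvg_ne_top {g : E n → EuclideanSpace 𝕜 (Fin n)} (hg : LocallyIntegrable g volume)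
    (x : E n) {R : ℝ} (hR : 0 < R) : ballAvg (fun y => ‖g y‖ₑ) x R ≠ ⊤ := by
  refine ENNReal.div_ne_top ?_ (volume_ball_pos x hR)
  have : IntegrableOn g (Metric.ball x R) volume :=
    (hg.integrableOn_isCompact (isCompact_closedBall x R)).mono_set Metric.ball_subset_closedBall
  exact this.2.ne

/-- Mean value inequality on the closed ball of radius R. The derivative at z costs 2^n times an
average over B(z, r), and passing to B(x, 2R) costs another 4^n because 2R ≤ 4r; hence 8^n. The
factor n comes from summing over coordinate directions. The window r ≤ R ≤ 2r allows use at two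
consecutive dyadic scales. -/
theorem enorm_mollify_sub_le {f : E n → 𝕜} (hf : LocallyIntegrable f volume)
    {g : E n → EuclideanSpace 𝕜 (Fin n)} (hg : IsWeakGradient f g) {r : Set.Ioi (0 : ℝ)} {R : ℝ}
    (h1 : r ≤ R) (h2 : R ≤ 2 * r) {x y : E n} (hxy : dist y x ≤ R) :
    ‖mollify r f y - mollify r f x‖ₑ ≤
      n * 8 ^ n * (ENNReal.ofReal R * ballAvg (fun y => ‖g y‖ₑ) x (2 * R)) := by
  have hr : (0:ℝ) < r := r.2
  have hR : 0 < R := hr.trans_le h1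
  choose D hD hDb using fun z => enorm_mollify_fderiv_le r hf hg z
  set B : ℝ≥0∞ := n * 8 ^ n * ballAvg (fun y => ‖g y‖ₑ) x (2 * R) with hB
  have hBtop : B ≠ ⊤ := ENNReal.mul_ne_top (by finiteness) (ballAvg_ne_top hg.1 x (by positivity))
  have hbound : ∀ z ∈ Metric.closedBall x R, ∀ v, ‖D z v‖ₑ ≤ B * ‖v‖ₑ := by
    intro z hz v
    refine (hDb z v).trans ?_
    have e3 : ballAvg (fun y => ‖g y‖ₑ) z r ≤
        ENNReal.ofReal ((2 * R / r) ^ n) * ballAvg (fun y => ‖g y‖ₑ) x (2 * R) := by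
      have := ballAvg_le_of_subset (fun y => ‖g y‖ₑ) (x := z) (y := x) hr
        (c := 2 * R / r) (by positivity) ?_
      · rwa [div_mul_cancel₀ _ hr.ne'] at this
      · rw [div_mul_cancel₀ _ hr.ne']
        refine Metric.ball_subset_ball' ?_
        rw [Metric.mem_closedBall] at hz
        linarith
    have e4 : ENNReal.ofReal ((2 * R / r) ^ n) ≤ 4 ^ n := by
      rw [ENNReal.ofReal_pow (by positivity)]
      gcongr
      rw [← ENNReal.ofReal_ofNat 4]
      apply ENNReal.ofReal_le_ofReal
      rw [div_le_iff₀ hr]; linarith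
    calc n * ‖v‖ₑ * ∫⁻ t, ‖(bump n r).normed volume (z - t)‖ₑ * ‖g t‖ₑ
        ≤ n * ‖v‖ₑ * (2 ^ n * (4 ^ n * ballAvg (fun y => ‖g y‖ₑ) x (2 * R))) := by
          gcongr
          exact (lintegral_bump_mul_le r _ z).trans (by gcongr; exact e3.trans (by gcongr))
      _ = B * ‖v‖ₑ := by
          rw [hB, show (8:ℝ≥0∞) = 2 * 4 by norm_num, mul_pow]; ring
  have hmv := (convex_closedBall x R).norm_image_sub_le_of_norm_hasFDerivWithin_le (𝕜 := ℝ)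
    (f := mollify r f) (f' := D) (C := B.toReal)
    (fun z _ => (hD z).hasFDerivWithinAt) (fun z hz => by
      refine ContinuousLinearMap.opNorm_le_bound _ ENNReal.toReal_nonneg fun v => ?_
      have := ENNReal.toReal_mono (by finiteness) (hbound z hz v)
      simpa [ENNReal.toReal_mul] using this)
    (Metric.mem_closedBall_self hR.le) (Metric.mem_closedBall.2 hxy)
  have h5 : ‖mollify r f y - mollify r f x‖ₑ ≤ B * ENNReal.ofReal R := by
    rw [← ofReal_norm, ← ENNReal.ofReal_toReal hBtop,
      ← ENNReal.ofReal_mul ENNReal.toReal_nonneg]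
    apply ENNReal.ofReal_le_ofReal
    refine hmv.trans ?_
    gcongr
    rwa [← dist_eq_norm]
  refine h5.trans (le_of_eq ?_)
  rw [hB]; ring

/-- Convolution is associative and commutative. This makes the double mollification a common
reference point for comparing two scales. -/
theorem mollify_comm (r s : Set.Ioi (0 : ℝ)) {f : E n → 𝕜} (hf : LocallyIntegrable f volume) :
    mollify r (mollify s f) = mollify s (mollify r f) := by
  have key : ∀ r s : Set.Ioi (0 : ℝ), mollify r (mollify s f) =
      convolution (convolution ((bump n r).normed volume) ((bump n s).normed volume)
        (ContinuousLinearMap.lsmul ℝ ℝ) volume) f (ContinuousLinearMap.lsmul ℝ ℝ) volume := by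
    intro r s
    ext x
    have hf' : LocallyIntegrable (fun y => ‖f y‖) volume := fun z => (hf z).norm
    have hcr : HasCompactSupport ((bump n r).normed volume) := (bump n r).hasCompactSupport_normed
    have hcs : HasCompactSupport ((bump n s).normed volume) := (bump n s).hasCompactSupport_normed
    have hr : Continuous ((bump n r).normed volume) := (bump n r).continuous_normed
    have hs : Continuous ((bump n s).normed volume) := (bump n s).continuous_normed
    symm
    refine convolution_assoc (𝕜 := ℝ) (ContinuousLinearMap.lsmul ℝ ℝ) (ContinuousLinearMap.lsmul ℝ ℝ)
      (ContinuousLinearMap.lsmul ℝ ℝ) (ContinuousLinearMap.lsmul ℝ ℝ) ?_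
      hr.aestronglyMeasurable hs.aestronglyMeasurable hf.aestronglyMeasurable ?_ ?_ ?_
    · intro a b c
      simp [mul_smul, smul_comm a b c]
    · exact ae_of_all _ fun y => hcr.convolutionExists_left _ hr (hs.locallyIntegrable) y
    · exact ae_of_all _ fun y => (hcs.norm).convolutionExists_left _ hs.norm hf' y
    · refine (hcr.norm).convolutionExists_left _ hr.norm ?_ x
      exact ((hcs.norm).continuous_convolution_left _ hs.norm hf').locallyIntegrable
  rw [key, key]
  congr 1
  rw [← convolution_flip]
  congr 1
  ext; simp

theorem enorm_mollify_sub_self_le {u : E n → 𝕜} (r : Set.Ioi (0 : ℝ)) {x : E n} {C : ℝ≥0∞}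
    (hu : Continuous u) (hC : C ≠ ⊤) (h : ∀ y, dist y x ≤ r → ‖u y - u x‖ₑ ≤ C) :
    ‖mollify r u x - u x‖ₑ ≤ C := by
  have := ContDiffBump.dist_normed_convolution_le (φ := bump n r) (μ := volume) (g := u) (x₀ := x)
    (ε := C.toReal) hu.aestronglyMeasurable (fun y hy => by
      have h1 := ENNReal.toReal_mono hC (h y (le_of_lt hy))
      rw [dist_eq_norm]; simpa using h1)
  rw [← ofReal_norm]
  refine le_trans ?_ (ENNReal.ofReal_toReal hC).le
  apply ENNReal.ofReal_le_ofReal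
  rw [dist_eq_norm] at this
  exact this

theorem continuous_mollify (r : Set.Ioi (0 : ℝ)) {f : E n → 𝕜}
    (hf : LocallyIntegrable f volume) : Continuous (mollify r f) :=
  (bump n r).hasCompactSupport_normed.continuous_convolution_left _
    (bump n r).continuous_normed hf

/-- The double mollification at scales r and r/2 is a local average of either single mollification,
so it lies within the oscillation bound of both. No Poincaré inequality for f itself is needed. -/
theorem enorm_mollify_half_sub_le {f : E n → 𝕜} (hf : LocallyIntegrable f volume)
    {g : E n → EuclideanSpace 𝕜 (Fin n)} (hg : IsWeakGradient f g) {r r' : Set.Ioi (0 : ℝ)}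
    (h : (r' : ℝ) = r / 2) (x : E n) :
    ‖mollify r f x - mollify r' f x‖ₑ ≤
      2 * (n * 8 ^ n) * (ENNReal.ofReal r * ballAvg (fun y => ‖g y‖ₑ) x (2 * r)) := by
  have hr : (0:ℝ) < r := r.2
  set C : ℝ≥0∞ := n * 8 ^ n * (ENNReal.ofReal r * ballAvg (fun y => ‖g y‖ₑ) x (2 * r)) with hCdef
  have hC : C ≠ ⊤ := ENNReal.mul_ne_top (by finiteness)
    (ENNReal.mul_ne_top (by finiteness) (ballAvg_ne_top hg.1 x (by linarith)))
  have h1 : ‖mollify r' (mollify r f) x - mollify r f x‖ₑ ≤ C :=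
    enorm_mollify_sub_self_le r' (continuous_mollify r hf) hC fun y hy =>
      enorm_mollify_sub_le hf hg le_rfl (by linarith) (by linarith)
  have h2 : ‖mollify r (mollify r' f) x - mollify r' f x‖ₑ ≤ C :=
    enorm_mollify_sub_self_le r (continuous_mollify r' hf) hC fun y hy =>
      enorm_mollify_sub_le hf hg (by linarith) (by linarith) hy
  rw [mollify_comm r r' hf] at h2
  have e : mollify r f x - mollify r' f x = (mollify r' (mollify r f) x - mollify r' f x) -
    (mollify r' (mollify r f) x - mollify r f x) := by ring
  rw [e]
  refine (enorm_sub_le).trans ((add_le_add h2 h1).trans (le_of_eq ?_))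
  rw [hCdef]; ring

/-- Points where the mollifications of `f` converge to `f`. -/
def GoodPoint (f : E n → 𝕜) (x : E n) : Prop :=
  Tendsto (fun r : Set.Ioi (0 : ℝ) => mollify r f x) (comap Subtype.val (𝓝 0)) (𝓝 (f x))

theorem ae_goodPoint {f : E n → 𝕜} (hf : LocallyIntegrable f volume) :
    ∀ᵐ x, GoodPoint f x :=
  ContDiffBump.ae_convolution_tendsto_right_of_locallyIntegrable (φ := bump n) (K := 2)
    tendsto_comap (Eventually.of_forall fun r => by simp only [bump]; linarith) hf

theorem goodPoint_of_continuous {f : E n → 𝕜} (hf : Continuous f) (x : E n) : GoodPoint f x :=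
  ContDiffBump.convolution_tendsto_right_of_continuous (φ := bump n) tendsto_comap hf x

theorem GoodPoint.sub {f h : E n → 𝕜} (hf : LocallyIntegrable f volume)
    (hh : LocallyIntegrable h volume) {x : E n} (hfx : GoodPoint f x) (hhx : GoodPoint h x) :
    GoodPoint (fun y => f y - h y) x := by
  have e : ∀ r : Set.Ioi (0:ℝ), mollify r (fun y => f y - h y) x = mollify r f x - mollify r h x := by
    intro r
    have ex : ∀ {u : E n → 𝕜}, LocallyIntegrable u volume →
        ConvolutionExistsAt ((bump n r).normed volume) u x (ContinuousLinearMap.lsmul ℝ ℝ) volume :=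
      fun hu => (bump n r).hasCompactSupport_normed.convolutionExists_left _
        (bump n r).continuous_normed hu x
    have := integral_sub (ex hf) (ex hh)
    simp only [mollify, convolution]
    rw [← this]
    congr 1 with t
    simp [smul_sub]
  unfold GoodPoint
  simp only [e]
  exact Tendsto.sub hfx hhx

/-- A truncated Riesz potential, normalised to be comparable with an average of `G`. -/
noncomputable def potential (G : E n → ℝ≥0∞) (x : E n) (R : ℝ) : ℝ≥0∞ :=
  ∑' i : ℕ, (2⁻¹ : ℝ≥0∞) ^ i * ballAvg G x (2 * ((2⁻¹ : ℝ) ^ i * R))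

/-- Telescoping over the scales 2⁻ⁱ r, whose mollifications converge to f(x) at a good point; the
successive differences add up to the potential. -/
theorem enorm_mollify_sub_goodPoint_le {f : E n → 𝕜} (hf : LocallyIntegrable f volume)
    {g : E n → EuclideanSpace 𝕜 (Fin n)} (hg : IsWeakGradient f g) (r : Set.Ioi (0 : ℝ))
    {x : E n} (hx : GoodPoint f x) :
    ‖mollify r f x - f x‖ₑ ≤
      2 * (n * 8 ^ n) * (ENNReal.ofReal r * potential (fun y => ‖g y‖ₑ) x r) := by
  have hr : (0:ℝ) < r := r.2
  let ρ : ℕ → Set.Ioi (0:ℝ) := fun i => ⟨(2⁻¹:ℝ) ^ i * r, Set.mem_Ioi.2 (by positivity)⟩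
  have hρ : Tendsto ρ atTop (comap Subtype.val (𝓝 0)) := by
    rw [tendsto_comap_iff]
    have := (tendsto_pow_atTop_nhds_zero_of_lt_one (r := (2⁻¹:ℝ)) (by norm_num)
      (by norm_num)).mul_const (r:ℝ)
    rw [zero_mul] at this
    exact this
  have h := edist_le_tsum_of_edist_le_of_tendsto₀ (f := fun i => mollify (ρ i) f x)
    (fun i => 2 * (n * 8 ^ n) * (ENNReal.ofReal r * ((2⁻¹ : ℝ≥0∞) ^ i *
      ballAvg (fun y => ‖g y‖ₑ) x (2 * ((2⁻¹ : ℝ) ^ i * r))))) (fun i => by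
        rw [edist_eq_enorm_sub]
        refine (enorm_mollify_half_sub_le hf hg (r := ρ i) (r' := ρ i.succ)
          (by simp only [ρ, pow_succ]; ring) x).trans (le_of_eq ?_)
        simp only [ρ]
        rw [ENNReal.ofReal_mul (by positivity), ENNReal.ofReal_pow (by norm_num),
          ENNReal.ofReal_inv_of_pos (by norm_num), ENNReal.ofReal_ofNat]
        ring)
    (hx.comp hρ)
  have e0 : ρ 0 = r := by simp [ρ]
  rw [edist_eq_enorm_sub] at h
  simp only [e0] at h
  rw [ENNReal.tsum_mul_left, ENNReal.tsum_mul_left] at h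
  exact h

theorem ballAvg_le_potential (G : E n → ℝ≥0∞) (x : E n) (R : ℝ) :
    ballAvg G x (2 * R) ≤ potential G x R := by
  refine le_trans ?_ (ENNReal.le_tsum 0)
  simp

/-- The pointwise difference estimate for weakly differentiable functions. -/
theorem enorm_sub_le_potential {f : E n → 𝕜} (hf : LocallyIntegrable f volume)
    {g : E n → EuclideanSpace 𝕜 (Fin n)} (hg : IsWeakGradient f g) {R : ℝ} (hR : 0 < R)
    {x y : E n} (hx : GoodPoint f x) (hy : GoodPoint f y) (hxy : dist y x ≤ R) :
    ‖f x - f y‖ₑ ≤ 3 * (n * 8 ^ n) * (ENNReal.ofReal R *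
      (potential (fun y => ‖g y‖ₑ) x R + potential (fun y => ‖g y‖ₑ) y R)) := by
  let r : Set.Ioi (0:ℝ) := ⟨R, hR⟩
  have h1 := enorm_mollify_sub_goodPoint_le hf hg r hx
  have h2 := enorm_mollify_sub_goodPoint_le hf hg r hy
  have h3 := enorm_mollify_sub_le hf hg (r := r) le_rfl
    (by change R ≤ 2 * R; linarith) hxy
  have h4 := ballAvg_le_potential (fun y => ‖g y‖ₑ) x R
  have e : f x - f y = (mollify r f y - f y) - (mollify r f x - f x)
    - (mollify r f y - mollify r f x) := by ring
  rw [e]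
  refine enorm_sub_le.trans ((add_le_add_left enorm_sub_le _).trans ?_)
  calc _ ≤ 2 * (n * 8 ^ n) * (ENNReal.ofReal R * potential (fun y => ‖g y‖ₑ) y R) +
        2 * (n * 8 ^ n) * (ENNReal.ofReal R * potential (fun y => ‖g y‖ₑ) x R) +
        n * 8 ^ n * (ENNReal.ofReal R * potential (fun y => ‖g y‖ₑ) x R) := by
        refine add_le_add (add_le_add h2 h1) (h3.trans (by gcongr))
    _ = 2 * (n * 8 ^ n) * (ENNReal.ofReal R * potential (fun y => ‖g y‖ₑ) y R) +
        3 * (n * 8 ^ n) * (ENNReal.ofReal R * potential (fun y => ‖g y‖ₑ) x R) := by ring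
    _ ≤ 3 * (n * 8 ^ n) * (ENNReal.ofReal R * potential (fun y => ‖g y‖ₑ) y R) +
        3 * (n * 8 ^ n) * (ENNReal.ofReal R * potential (fun y => ‖g y‖ₑ) x R) := by
        gcongr; norm_num
    _ = _ := by ring

end Mollification

/-! ### Integral estimates for the truncated potential. -/

theorem tsum_mul_rpow_le {ι : Type*} (w b : ι → ℝ≥0∞) {r : ℝ} (hr : 0 < r) :
    (∑' i, w i * b i) ^ r ≤ (∑' i, w i) ^ r * ∑' i, b i ^ r := by
  -- Bounding each term by the ℓ^r norm replaces Hölder's inequality; it needs no conjugate exponent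
  -- and so covers r < 1 too.
  have hb : ∀ i, b i ≤ (∑' i, b i ^ r) ^ r⁻¹ := fun i =>
    (ENNReal.le_rpow_inv_iff hr).2 (ENNReal.le_tsum i)
  calc (∑' i, w i * b i) ^ r ≤ ((∑' i, w i) * (∑' i, b i ^ r) ^ r⁻¹) ^ r := by
        rw [← ENNReal.tsum_mul_right]
        gcongr
        exact hb _
    _ = _ := by rw [ENNReal.mul_rpow_of_nonneg _ _ hr.le, ENNReal.rpow_inv_rpow hr.ne']

theorem tsum_two_rpow_ne_top {a : ℝ} (ha : a < 0) : ∑' i : ℕ, ((2 : ℝ≥0∞) ^ a) ^ i ≠ ⊤ := by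
  rw [ENNReal.tsum_geometric]
  refine ENNReal.inv_ne_top.2 (tsub_pos_of_lt ?_).ne'
  exact ENNReal.rpow_lt_one_of_one_lt_of_neg (by norm_num) ha

theorem two_rpow_mul (a b : ℝ) : (2 : ℝ≥0∞) ^ a * 2 ^ b = 2 ^ (a + b) :=
  (ENNReal.rpow_add _ _ (by norm_num) (by norm_num)).symm

section

variable {n : ℕ} [NeZero n]

theorem measurableSet_ball_rel :
    MeasurableSet {z : (E n × ℝ) × E n | z.2 ∈ Metric.ball z.1.1 z.1.2} := by
  have : IsOpen {z : (E n × ℝ) × E n | z.2 ∈ Metric.ball z.1.1 z.1.2} :=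
    isOpen_lt (f := fun z : (E n × ℝ) × E n => dist z.2 z.1.1) (g := fun z => z.1.2)
      (by fun_prop) (by fun_prop)
  exact this.measurableSet

theorem measurable_lintegral_ball {G : E n → ℝ≥0∞} (hG : Measurable G) :
    Measurable fun z : E n × ℝ => ∫⁻ y in Metric.ball z.1 z.2, G y := by
  have h : Measurable fun z : E n × ℝ => ∫⁻ y,
      {z : (E n × ℝ) × E n | z.2 ∈ Metric.ball z.1.1 z.1.2}.indicator (fun z => G z.2) (z, y) :=
    ((hG.comp measurable_snd).indicator measurableSet_ball_rel).lintegral_prod_right'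
  convert h using 2 with z
  rw [← lintegral_indicator Metric.isOpen_ball.measurableSet]
  rfl

theorem measurable_ballAvg {G : E n → ℝ≥0∞} (hG : Measurable G) :
    Measurable fun z : E n × ℝ => ballAvg G z.1 z.2 := by
  have h := measurable_lintegral_ball (n := n) (G := fun _ => 1) measurable_const
  simp only [setLIntegral_one] at h
  exact (measurable_lintegral_ball hG).div h

theorem measurable_ballAvg_left {G : E n → ℝ≥0∞} (hG : Measurable G) (R : ℝ) :
    Measurable fun y : E n => ballAvg G y R :=
  Measurable.of_uncurry_right (f := ballAvg G) (measurable_ballAvg hG)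

theorem ballAvg_const {c : ℝ≥0∞} (x : E n) {R : ℝ} (hR : 0 < R) :
    ballAvg (fun _ : E n => c) x R = c := by
  rw [ballAvg, setLIntegral_const,
    ENNReal.mul_div_cancel_right (volume_ball_pos x hR) (volume_ball_ne_top x R)]

theorem ballAvg_add {G H : E n → ℝ≥0∞} (hG : Measurable G) (x : E n) (R : ℝ) :
    ballAvg (fun y => G y + H y) x R = ballAvg G x R + ballAvg H x R := by
  rw [ballAvg, lintegral_add_left hG, ENNReal.add_div]; rfl

/-- Jensen's inequality, in the form of monotonicity of L^p norms for the normalised restriction to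
the ball. -/
theorem ballAvg_rpow_le {G : E n → ℝ≥0∞} (hG : Measurable G) {s : ℝ} (hs : 1 ≤ s) (x : E n)
    {R : ℝ} (hR : 0 < R) : ballAvg G x R ^ s ≤ ballAvg (fun y => G y ^ s) x R := by
  set v := volume (Metric.ball x R)
  have hv0 : v ≠ 0 := volume_ball_pos x hR
  have hvt : v ≠ ⊤ := volume_ball_ne_top x R
  let μ : Measure (E n) := v⁻¹ • volume.restrict (Metric.ball x R)
  have hμ : IsProbabilityMeasure μ := ⟨by
    simp only [μ, Measure.smul_apply, Measure.restrict_apply_univ, smul_eq_mul]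
    exact ENNReal.inv_mul_cancel hv0 hvt⟩
  have e : ∀ H : E n → ℝ≥0∞, ballAvg H x R = ∫⁻ y, H y ∂μ := by
    intro H
    rw [lintegral_smul_measure, smul_eq_mul, ballAvg, ENNReal.div_eq_inv_mul]
  have h := eLpNorm'_le_eLpNorm'_of_exponent_le one_pos hs μ (f := G) hG.aestronglyMeasurable
  rw [e, e]
  simp only [eLpNorm', enorm_eq_self, ENNReal.rpow_one, div_one] at h
  rwa [one_div, ENNReal.le_rpow_inv_iff (by linarith)] at h

theorem lintegral_ballAvg_le {J : E n → ℝ≥0∞} (hJ : Measurable J) (x : E n) (R : ℝ) {ρ : ℝ}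
    (hρ : 0 < ρ) :
    ∫⁻ y in Metric.ball x R, ballAvg J y ρ ≤ ∫⁻ y in Metric.ball x (R + ρ), J y := by
  have hv : ∀ y : E n, volume (Metric.ball y ρ) = volume (Metric.ball x ρ) := fun y => by
    rw [volume_ball_eq y hρ.le, volume_ball_eq x hρ.le]
  simp only [ballAvg, hv, div_eq_mul_inv]
  rw [lintegral_mul_const' _ _ (ENNReal.inv_ne_top.2 (volume_ball_pos x hρ)), ← div_eq_mul_inv]
  refine ENNReal.div_le_of_le_mul ?_
  let A : Set (E n × E n) := {z | z.2 ∈ Metric.ball z.1 ρ}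
  have hA : MeasurableSet A :=
    (isOpen_lt (continuous_snd.dist continuous_fst) continuous_const).measurableSet
  have h1 : ∀ y, ∫⁻ z in Metric.ball y ρ, J z = ∫⁻ z, A.indicator (fun w => J w.2) (y, z) := by
    intro y
    rw [← lintegral_indicator Metric.isOpen_ball.measurableSet]
    rfl
  simp only [h1]
  have hsw := lintegral_lintegral_swap (μ := volume.restrict (Metric.ball x R)) (ν := volume)
    (f := fun y z => A.indicator (fun w => J w.2) (y, z))
    ((hJ.comp measurable_snd).indicator hA).aemeasurable
  rw [hsw,
    ← lintegral_mul_const _ hJ, ← lintegral_indicator Metric.isOpen_ball.measurableSet]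
  refine lintegral_mono fun z => ?_
  have h2 : ∀ y, A.indicator (fun w => J w.2) (y, z) ≤
      (Metric.ball z ρ).indicator (fun _ => J z) y := by
    intro y
    by_cases hy : y ∈ Metric.ball z ρ
    · rw [Set.indicator_of_mem hy]
      exact Set.indicator_le_self' (fun _ _ => zero_le) _
    · rw [Set.indicator_of_notMem]
      · exact zero_le
      · intro h; exact hy (Metric.mem_ball_comm.1 h)
  by_cases hz : z ∈ Metric.ball x (R + ρ)
  · rw [Set.indicator_of_mem hz]
    calc ∫⁻ y in Metric.ball x R, A.indicator (fun w => J w.2) (y, z)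
        ≤ ∫⁻ y, (Metric.ball z ρ).indicator (fun _ => J z) y :=
          (setLIntegral_le_lintegral _ _).trans (lintegral_mono h2)
      _ = J z * volume (Metric.ball x ρ) := by
          rw [lintegral_indicator Metric.isOpen_ball.measurableSet, setLIntegral_const, hv]
  · rw [Set.indicator_of_notMem hz]
    refine le_of_eq (setLIntegral_eq_zero Metric.isOpen_ball.measurableSet fun y hy => ?_)
    refine Set.indicator_of_notMem (fun h => hz ?_) _
    have h' : dist z y < ρ := h
    have hy' : dist y x < R := hy
    exact Metric.mem_ball.2 ((dist_triangle z y x).trans_lt (by linarith))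

/-- Split the power r as s + s(r/s - 1). The first factor is turned into an average of G^s by Jensen
and integrated by Tonelli. The second is estimated uniformly by the average over the large ball, and
the volume ratio (4R/ρ)^n enters only to the power r/s - 1. -/
theorem lintegral_ballAvg_rpow_le {G : E n → ℝ≥0∞} (hG : Measurable G) {s r : ℝ} (hs : 1 ≤ s)
    (hsr : s ≤ r) (x : E n) {R ρ : ℝ} (hρ : 0 < ρ) (hρR : ρ ≤ 2 * R) :
    ∫⁻ y in Metric.ball x R, ballAvg G y ρ ^ r ≤
      ENNReal.ofReal ((4 * R / ρ) ^ n) ^ (r / s - 1) *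
        ballAvg (fun y => G y ^ s) x (4 * R) ^ (r / s) * volume (Metric.ball x (4 * R)) := by
  have hR : 0 < R := by linarith
  have hs0 : 0 < s := by linarith
  have hrs : 0 ≤ r / s - 1 := by
    rw [sub_nonneg, le_div_iff₀ hs0]; linarith
  set J : E n → ℝ≥0∞ := fun y => G y ^ s with hJ
  have hJm : Measurable J := hG.pow_const s
  set K : ℝ≥0∞ := (ENNReal.ofReal ((4 * R / ρ) ^ n) * ballAvg J x (4 * R)) ^ (r / s - 1) with hK
  have h1 : ∀ y ∈ Metric.ball x R, ballAvg G y ρ ^ r ≤ K * ballAvg J y ρ := by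
    intro y hy
    have h2 : ballAvg J y ρ ≤ ENNReal.ofReal ((4 * R / ρ) ^ n) * ballAvg J x (4 * R) := by
      have := ballAvg_le_of_subset J (x := y) (y := x) hρ (c := 4 * R / ρ) (by positivity) ?_
      · rwa [div_mul_cancel₀ _ hρ.ne'] at this
      · rw [div_mul_cancel₀ _ hρ.ne']
        refine Metric.ball_subset_ball' ?_
        rw [Metric.mem_ball] at hy
        linarith
    calc ballAvg G y ρ ^ r = (ballAvg G y ρ ^ s) ^ ((r / s - 1) + 1) := by
          rw [← ENNReal.rpow_mul]; congr 1; field_simp; ring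
      _ ≤ ballAvg J y ρ ^ ((r / s - 1) + 1) :=
          ENNReal.rpow_le_rpow (ballAvg_rpow_le hG hs y hρ) (by linarith)
      _ = ballAvg J y ρ ^ (r / s - 1) * ballAvg J y ρ := by
          rw [ENNReal.rpow_add_of_nonneg _ _ hrs zero_le_one, ENNReal.rpow_one]
      _ ≤ K * ballAvg J y ρ := by
          gcongr
          exact ENNReal.rpow_le_rpow h2 hrs
  have h3 : ∫⁻ y in Metric.ball x R, ballAvg G y ρ ^ r ≤
      K * ∫⁻ y in Metric.ball x R, ballAvg J y ρ := by
    rw [← lintegral_const_mul _ (measurable_ballAvg_left hJm ρ)]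
    exact setLIntegral_mono' Metric.isOpen_ball.measurableSet h1
  have h4 : ∫⁻ y in Metric.ball x R, ballAvg J y ρ ≤
      ballAvg J x (4 * R) * volume (Metric.ball x (4 * R)) := by
    rw [← lintegral_ball_eq_ballAvg J x (by positivity)]
    exact (lintegral_ballAvg_le hJm x R hρ).trans
          (lintegral_mono_set (Metric.ball_subset_ball (by linarith)))
  refine (h3.trans (mul_le_mul_right h4 K)).trans (le_of_eq ?_)
  have h5 : ballAvg J x (4 * R) ^ (r / s) =
      ballAvg J x (4 * R) ^ (r / s - 1) * ballAvg J x (4 * R) := by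
    nth_rewrite 3 [← ENNReal.rpow_one (ballAvg J x (4 * R))]
    rw [← ENNReal.rpow_add_of_nonneg _ _ hrs zero_le_one, sub_add_cancel]
  rw [hK, h5, ENNReal.mul_rpow_of_nonneg _ _ hrs]
  ring

/-- The Sobolev-Poincaré step: the i-th average in the potential has L^r norm growing like 2^(i n
(1/s - 1/r)), which the weight 2⁻ⁱ beats under the subcritical hypothesis. -/
theorem exists_lintegral_potential_rpow_le (n : ℕ) [NeZero n] {s r : ℝ} (hs : 1 ≤ s) (hsr : s ≤ r)
    (hn : n * (1 / s - 1 / r) < 1) : ∃ C : ℝ≥0∞, C ≠ ⊤ ∧ ∀ G : E n → ℝ≥0∞, Measurable G →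
      ∀ (x : E n) (R : ℝ), 0 < R → ∫⁻ y in Metric.ball x R, potential G y R ^ r ≤
        C * volume (Metric.ball x R) * ballAvg (fun y => G y ^ s) x (4 * R) ^ (r / s) := by
  have hr : 0 < r := by linarith
  have hs0 : 0 < s := by linarith
  -- The weight 2⁻ⁱ is split as 2^(-(1-θ)i) · 2^(-θi): the first factor is summable since θ < 1, the
  -- second absorbs the growth in i since θ > n(1/s - 1/r).
  obtain ⟨θ, hθ1, hθ2⟩ := exists_between hn
  have hθr : n * (r / s - 1) - θ * r < 0 := by
    have : n * (1 / s - 1 / r) * r < θ * r := by gcongr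
    have e : n * (1 / s - 1 / r) * r = n * (r / s - 1) := by field_simp
    linarith
  have hrs : 0 ≤ r / s - 1 := by
    rw [sub_nonneg, le_div_iff₀ hs0]; linarith
  set A : ℝ≥0∞ := (∑' i : ℕ, ((2 : ℝ≥0∞) ^ (-(1 - θ))) ^ i) ^ r
  set B : ℝ≥0∞ := ∑' i : ℕ, ((2 : ℝ≥0∞) ^ (n * (r / s - 1) - θ * r)) ^ i
  have hA : A ≠ ⊤ := ENNReal.rpow_ne_top_of_nonneg hr.le (tsum_two_rpow_ne_top (by linarith))
  have hB : B ≠ ⊤ := tsum_two_rpow_ne_top hθr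
  refine ⟨A * (2 ^ (n * (r / s - 1)) * 4 ^ n * B), ENNReal.mul_ne_top hA
    (ENNReal.mul_ne_top (by finiteness) hB), fun G hG x R hR => ?_⟩
  set J := ballAvg (fun y => G y ^ s) x (4 * R) ^ (r / s)
  have hm : ∀ i : ℕ, Measurable fun y => ballAvg G y (2 * ((2⁻¹ : ℝ) ^ i * R)) := fun i =>
    measurable_ballAvg_left hG _
  have h1 : ∀ y, potential G y R ^ r ≤
      A * ∑' i : ℕ, (((2 : ℝ≥0∞) ^ (-θ)) ^ i * ballAvg G y (2 * ((2⁻¹ : ℝ) ^ i * R))) ^ r := by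
    intro y
    refine le_trans (le_of_eq ?_) (tsum_mul_rpow_le _ _ hr)
    unfold potential
    congr 2 with i
    have e : (2⁻¹ : ℝ≥0∞) ^ i = ((2 : ℝ≥0∞) ^ (-(1 - θ))) ^ i * ((2 : ℝ≥0∞) ^ (-θ)) ^ i := by
      rw [← mul_pow, two_rpow_mul, show -(1 - θ) + -θ = -1 by ring, ENNReal.rpow_neg_one]
    rw [e, mul_assoc]
  have h2 : ∀ i : ℕ, ∫⁻ y in Metric.ball x R,
      (((2 : ℝ≥0∞) ^ (-θ)) ^ i * ballAvg G y (2 * ((2⁻¹ : ℝ) ^ i * R))) ^ r ≤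
      (2 ^ (n * (r / s - 1)) * 4 ^ n * volume (Metric.ball x R) * J) *
        ((2 : ℝ≥0∞) ^ (n * (r / s - 1) - θ * r)) ^ i := by
    intro i
    have hi : (2⁻¹ : ℝ) ^ i ≤ 1 := pow_le_one₀ (by norm_num) (by norm_num)
    simp only [ENNReal.mul_rpow_of_nonneg _ _ hr.le]
    rw [lintegral_const_mul _ ((hm i).pow_const r)]
    refine (mul_le_mul_right (lintegral_ballAvg_rpow_le hG hs hsr x (R := R)
      (ρ := 2 * ((2⁻¹ : ℝ) ^ i * R)) (by positivity) ?_) _).trans (le_of_eq ?_)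
    · nlinarith
    · have e1 : (4 * R / (2 * ((2⁻¹ : ℝ) ^ i * R))) = 2 ^ (i + 1) := by
        rw [inv_pow, pow_succ]; field_simp; norm_num
      have e2 : ENNReal.ofReal (((2:ℝ) ^ (i + 1)) ^ n) = (2:ℝ≥0∞) ^ (((i:ℝ) + 1) * n) := by
        rw [ENNReal.ofReal_pow (by positivity), ENNReal.ofReal_pow (by norm_num),
          ENNReal.ofReal_ofNat, ENNReal.rpow_mul, ENNReal.rpow_natCast]
        congr 1
        exact_mod_cast (ENNReal.rpow_natCast 2 (i+1)).symm
      rw [e1, e2, volume_ball_scale x x (by norm_num : (0:ℝ) ≤ 4) hR.le,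
        ENNReal.ofReal_pow (by norm_num), ENNReal.ofReal_ofNat, ← ENNReal.rpow_natCast (2 ^ (-θ)),
        ← ENNReal.rpow_natCast (2 ^ (n * (r / s - 1) - θ * r)), ← ENNReal.rpow_mul,
        ← ENNReal.rpow_mul, ← ENNReal.rpow_mul, ← ENNReal.rpow_mul]
      have e3 : (2:ℝ≥0∞) ^ (-θ * i * r) * 2 ^ (((i:ℝ) + 1) * n * (r / s - 1)) =
          2 ^ (n * (r / s - 1)) * 2 ^ ((n * (r / s - 1) - θ * r) * i) := by
        rw [two_rpow_mul, two_rpow_mul]; congr 1; ring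
      rw [show ballAvg (fun y => G y ^ s) x (4 * R) ^ (r / s) = J from rfl]
      calc _ = ((2:ℝ≥0∞) ^ (-θ * i * r) * 2 ^ (((i:ℝ) + 1) * n * (r / s - 1))) *
            (J * (4 ^ n * volume (Metric.ball x R))) := by ring_nf
        _ = _ := by rw [e3]; ring
  calc ∫⁻ y in Metric.ball x R, potential G y R ^ r
      ≤ ∫⁻ y in Metric.ball x R, A *
        ∑' i : ℕ, (((2 : ℝ≥0∞) ^ (-θ)) ^ i * ballAvg G y (2 * ((2⁻¹ : ℝ) ^ i * R))) ^ r :=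
        lintegral_mono h1
    _ = A * ∑' i : ℕ, ∫⁻ y in Metric.ball x R,
          (((2 : ℝ≥0∞) ^ (-θ)) ^ i * ballAvg G y (2 * ((2⁻¹ : ℝ) ^ i * R))) ^ r := by
        rw [lintegral_const_mul' _ _ hA,
          lintegral_tsum fun i => (((hm i).const_mul _).pow_const r).aemeasurable]
    _ ≤ A * ∑' i : ℕ, (2 ^ (n * (r / s - 1)) * 4 ^ n * volume (Metric.ball x R) * J) *
        ((2 : ℝ≥0∞) ^ (n * (r / s - 1) - θ * r)) ^ i := by
        gcongr with i
        exact h2 i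
    _ = _ := by rw [ENNReal.tsum_mul_left]; ring

/-- A supremum of damped `L^s` averages of `G` over the balls of radius `4·2⁻ⁱR`. -/
noncomputable def dampedSup (s : ℝ) (G : E n → ℝ≥0∞) (x : E n) (R : ℝ) : ℝ≥0∞ :=
  ⨆ i : ℕ, ((2 : ℝ≥0∞) ^ (-(1 / 2) : ℝ)) ^ i *
    ballAvg (fun y => G y ^ s) x (4 * ((2⁻¹ : ℝ) ^ i * R)) ^ (1 / s)

theorem measurable_dampedSup {G : E n → ℝ≥0∞} (hG : Measurable G) (s : ℝ) :
    Measurable fun z : E n × ℝ => dampedSup s G z.1 z.2 := by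
  refine Measurable.iSup fun i => Measurable.const_mul (Measurable.pow_const ?_ _) _
  exact (measurable_ballAvg (hG.pow_const s)).comp (by fun_prop :
    Measurable fun z : E n × ℝ => (z.1, 4 * ((2⁻¹ : ℝ) ^ i * z.2)))

theorem ballAvg_le_dampedSup (s : ℝ) (G : E n → ℝ≥0∞) (x : E n) (R : ℝ) :
    ballAvg (fun y => G y ^ s) x (4 * R) ^ (1 / s) ≤ dampedSup s G x R := by
  refine le_trans (le_of_eq ?_) (le_iSup _ 0)
  simp

/-- Half of the decay 2⁻ⁱ is spent on summability and half stays inside the supremum. Since 2·2⁻ⁱR =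
4·2^(-(i+1))R, the i-th term of the potential meets the (i+1)-st term of the supremum, which
accounts for the factor 2^(1/2). -/
theorem potential_le_dampedSup {s : ℝ} (hs : 1 ≤ s) {G : E n → ℝ≥0∞} (hG : Measurable G)
    (x : E n) {R : ℝ} (hR : 0 < R) :
    potential G x R ≤ (2 ^ (1 / 2 : ℝ) * ∑' i : ℕ, ((2 : ℝ≥0∞) ^ (-(1 / 2) : ℝ)) ^ i) *
      dampedSup s G x R := by
  rw [← ENNReal.tsum_mul_left, ← ENNReal.tsum_mul_right]
  refine ENNReal.tsum_le_tsum fun i => ?_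
  have h1 : ballAvg G x (2 * ((2⁻¹ : ℝ) ^ i * R)) ≤
      ballAvg (fun y => G y ^ s) x (4 * ((2⁻¹ : ℝ) ^ (i + 1) * R)) ^ (1 / s) := by
    rw [one_div, ENNReal.le_rpow_inv_iff (by linarith)]
    have e : 4 * ((2⁻¹ : ℝ) ^ (i + 1) * R) = 2 * ((2⁻¹ : ℝ) ^ i * R) := by
      rw [pow_succ]; ring
    rw [e]
    exact ballAvg_rpow_le hG hs x (by positivity)
  have h2 : ((2 : ℝ≥0∞) ^ (-(1 / 2) : ℝ)) ^ (i + 1) * ballAvg G x (2 * ((2⁻¹ : ℝ) ^ i * R)) ≤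
      dampedSup s G x R :=
    (mul_le_mul_right h1 _).trans
      (le_iSup (fun i : ℕ => ((2 : ℝ≥0∞) ^ (-(1 / 2) : ℝ)) ^ i *
        ballAvg (fun y => G y ^ s) x (4 * ((2⁻¹ : ℝ) ^ i * R)) ^ (1 / s)) (i + 1))
  refine le_trans (le_of_eq ?_) (mul_le_mul_right h2 _)
  have e : (2⁻¹ : ℝ≥0∞) ^ i = 2 ^ (1 / 2 : ℝ) * ((2 : ℝ≥0∞) ^ (-(1 / 2) : ℝ)) ^ i *
      ((2 : ℝ≥0∞) ^ (-(1 / 2) : ℝ)) ^ (i + 1) := by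
    simp only [← ENNReal.rpow_natCast]
    rw [← ENNReal.rpow_neg_one]
    simp only [← ENNReal.rpow_mul, two_rpow_mul]
    congr 1; push_cast; ring
  rw [e, mul_assoc]

/-- The potential at the centre is bounded pointwise and the one at y in L^r mean. The bound sees
only scales up to 4R, unlike a maximal function; this locality is what later gives smallness as R →
0 and vanishing far from the support of G. -/
theorem exists_lintegral_potential_add_rpow_le (n : ℕ) [NeZero n] {s r : ℝ} (hs : 1 ≤ s)
    (hsr : s ≤ r) (hn : n * (1 / s - 1 / r) < 1) :
    ∃ C : ℝ≥0∞, C ≠ ⊤ ∧ ∀ G : E n → ℝ≥0∞, Measurable G → ∀ (x : E n) (R : ℝ), 0 < R →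
      ∫⁻ y in Metric.ball x R, (potential G x R + potential G y R) ^ r ≤
        C * volume (Metric.ball x R) * dampedSup s G x R ^ r := by
  obtain ⟨C, hC, h⟩ := exists_lintegral_potential_rpow_le n hs hsr hn
  have hr : 0 < r := by linarith
  have hs0 : 0 < s := by linarith
  set K : ℝ≥0∞ := 2 ^ (1 / 2 : ℝ) * ∑' i : ℕ, ((2 : ℝ≥0∞) ^ (-(1 / 2) : ℝ)) ^ i
  have hK : K ≠ ⊤ := ENNReal.mul_ne_top (by finiteness) (tsum_two_rpow_ne_top (by norm_num))
  refine ⟨2 ^ (r - 1) * (K ^ r + C), ENNReal.mul_ne_top (by finiteness)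
    (ENNReal.add_ne_top.2 ⟨ENNReal.rpow_ne_top_of_nonneg hr.le hK, hC⟩), fun G hG x R hR => ?_⟩
  have hm : Measurable fun y => potential G y R ^ r :=
    Measurable.pow_const (Measurable.tsum fun i =>
      (measurable_ballAvg_left hG _).const_mul _) r
  have h1 := potential_le_dampedSup hs hG x hR
  have h2 := ballAvg_le_dampedSup s G x R
  calc ∫⁻ y in Metric.ball x R, (potential G x R + potential G y R) ^ r
      ≤ ∫⁻ y in Metric.ball x R, 2 ^ (r - 1) * (potential G x R ^ r + potential G y R ^ r) :=
        lintegral_mono fun y => ENNReal.rpow_add_le_mul_rpow_add_rpow _ _ (by linarith)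
    _ = 2 ^ (r - 1) * (potential G x R ^ r * volume (Metric.ball x R) +
        ∫⁻ y in Metric.ball x R, potential G y R ^ r) := by
        rw [lintegral_const_mul' _ _ (by finiteness), lintegral_add_right _ hm, setLIntegral_const]
    _ ≤ 2 ^ (r - 1) * ((K * dampedSup s G x R) ^ r * volume (Metric.ball x R) +
        C * volume (Metric.ball x R) * dampedSup s G x R ^ r) := by
        gcongr
        refine (h G hG x R hR).trans ?_
        gcongr
        calc ballAvg (fun y => G y ^ s) x (4 * R) ^ (r / s)
            = (ballAvg (fun y => G y ^ s) x (4 * R) ^ (1 / s)) ^ r := by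
              rw [← ENNReal.rpow_mul]; congr 1; ring
          _ ≤ _ := by gcongr
    _ = _ := by rw [ENNReal.mul_rpow_of_nonneg _ _ hr.le]; ring

end

/-! ### One-dimensional tail integrals -/

theorem lintegral_Ioi_scale (F : ℝ → ℝ≥0∞) {c : ℝ} (hc : 0 < c) :
    ∫⁻ R in Set.Ioi (0 : ℝ), F R = ENNReal.ofReal c * ∫⁻ R in Set.Ioi (0 : ℝ), F (c * R) := by
  have h := lintegral_image_eq_lintegral_abs_deriv_mul (s := Set.Ioi (0 : ℝ)) (f := fun R => c * R)
    (f' := fun _ => c) measurableSet_Ioi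
    (fun x _ => by simpa using ((hasDerivAt_id x).const_mul c).hasDerivWithinAt)
    (fun x _ y _ h => mul_left_cancel₀ hc.ne' h) F
  rw [Set.image_mul_left_Ioi hc, mul_zero] at h
  rw [h, lintegral_const_mul' _ _ ENNReal.ofReal_ne_top, abs_of_pos hc]

/-- The integral `∫₀^∞ R^(γ-1) min(1, (T(R)/(t R^b))^r) dR`. -/
noncomputable def tailInt (γ b r t : ℝ) (T : ℝ → ℝ≥0∞) : ℝ≥0∞ :=
  ∫⁻ R in Set.Ioi (0 : ℝ), ENNReal.ofReal (R ^ (γ - 1)) *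
    min 1 ((T R / ENNReal.ofReal (t * R ^ b)) ^ r)

theorem tailInt_mono {γ b r t : ℝ} (hr : 0 ≤ r) {T S : ℝ → ℝ≥0∞} (h : ∀ R, 0 < R → T R ≤ S R) :
    tailInt γ b r t T ≤ tailInt γ b r t S := by
  refine setLIntegral_mono' measurableSet_Ioi fun R hR => ?_
  gcongr
  exact h R hR

theorem tailInt_scale (γ b r : ℝ) {t ρ : ℝ} (hρ : 0 < ρ) (T : ℝ → ℝ≥0∞) :
    tailInt γ b r t T =
      ENNReal.ofReal (ρ ^ γ) * tailInt γ b r (t * ρ ^ b) (fun R => T (ρ * R)) := by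
  rw [tailInt, lintegral_Ioi_scale _ hρ, tailInt, ← lintegral_const_mul' _ _ ENNReal.ofReal_ne_top,
    ← lintegral_const_mul' _ _ ENNReal.ofReal_ne_top]
  refine setLIntegral_congr_fun measurableSet_Ioi fun R hR => ?_
  have hR' : (0 : ℝ) < R := hR
  rw [Real.mul_rpow hρ.le hR'.le, Real.mul_rpow hρ.le hR'.le, ← mul_assoc, ← mul_assoc, mul_assoc t,
    ← ENNReal.ofReal_mul hρ.le, ← mul_assoc (ENNReal.ofReal (ρ ^ γ)),
    ← ENNReal.ofReal_mul (by positivity)]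
  congr 2
  have := Real.rpow_sub_one hρ.ne' γ
  rw [this]; field_simp

theorem lintegral_Ioi_ne_top_of_le {F : ℝ → ℝ≥0∞} {a a' : ℝ} (ha : -1 < a) (ha' : a' < -1)
    (h0 : ∀ R, 0 < R → R ≤ 1 → F R ≤ ENNReal.ofReal (R ^ a))
    (h1 : ∀ R, 1 < R → F R ≤ ENNReal.ofReal (R ^ a')) :
    ∫⁻ R in Set.Ioi (0 : ℝ), F R ≠ ⊤ := by
  have i0 : ∫⁻ R in Set.Ioc (0 : ℝ) 1, F R < ⊤ := by
    have := ((intervalIntegral.integrableOn_Ioo_rpow_iff zero_lt_one).2 ha)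
    rw [← integrableOn_Ioc_iff_integrableOn_Ioo] at this
    refine (setLIntegral_mono' measurableSet_Ioc fun R hR => h0 R hR.1 hR.2).trans_lt ?_
    exact this.lintegral_lt_top
  have i1 : ∫⁻ R in Set.Ioi (1 : ℝ), F R < ⊤ :=
    (setLIntegral_mono' measurableSet_Ioi fun R hR => h1 R hR).trans_lt
      (integrableOn_Ioi_rpow_of_lt ha' zero_lt_one).lintegral_lt_top
  rw [← Set.Ioc_union_Ioi_eq_Ioi zero_le_one]
  exact ((lintegral_union_le _ _ _).trans_lt (ENNReal.add_lt_top.2 ⟨i0, i1⟩)).ne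

/-- The two entries of the minimum give the exponents γ - 1 and γ(1 - r/q) - 1. As q < r, γ and γ(1
- r/q) have opposite signs, so one entry is integrable near 0 and the other near infinity. -/
theorem tailInt_one_ne_top {γ q r : ℝ} (hγ : γ ≠ 0) (hq : 0 < q) (hqr : q < r) :
    tailInt γ (γ / q) r 1 (fun _ => 1) ≠ ⊤ := by
  have hr : 0 < r := hq.trans hqr
  have b1 : ∀ R : ℝ, 0 < R → ENNReal.ofReal (R ^ (γ - 1)) *
      min 1 ((1 / ENNReal.ofReal (1 * R ^ (γ / q))) ^ r) ≤ ENNReal.ofReal (R ^ (γ - 1)) :=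
    fun R _ => (mul_le_mul_right (min_le_left _ _) _).trans (mul_one _).le
  have b2 : ∀ R : ℝ, 0 < R → ENNReal.ofReal (R ^ (γ - 1)) *
      min 1 ((1 / ENNReal.ofReal (1 * R ^ (γ / q))) ^ r) ≤
        ENNReal.ofReal (R ^ (γ - 1 - γ / q * r)) := by
    intro R hR
    refine (mul_le_mul_right (min_le_right _ _) _).trans (le_of_eq ?_)
    rw [one_mul, one_div, ← ENNReal.ofReal_inv_of_pos (by positivity),
      ENNReal.ofReal_rpow_of_pos (by positivity), ← ENNReal.ofReal_mul (by positivity),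
      Real.rpow_sub hR (γ - 1), Real.rpow_mul hR.le, Real.inv_rpow (by positivity), ← div_eq_mul_inv]
  have e : γ - 1 - γ / q * r = γ * (1 - r / q) - 1 := by ring
  have hrq : 1 - r / q < 0 := by
    rw [sub_neg, lt_div_iff₀ hq]; linarith
  rcases lt_or_gt_of_ne hγ with h | h
  · refine lintegral_Ioi_ne_top_of_le (a := γ - 1 - γ / q * r) (a' := γ - 1) ?_ (by linarith)
      (fun R hR _ => b2 R hR) (fun R hR => b1 R (by linarith))
    rw [e]; nlinarith
  · refine lintegral_Ioi_ne_top_of_le (a := γ - 1) (a' := γ - 1 - γ / q * r) (by linarith) ?_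
      (fun R hR _ => b1 R hR) (fun R hR => b2 R (by linarith))
    rw [e]; nlinarith

/-- Rescaling by ρ = (K/t)^(q/γ) normalises both K and t to 1, and ρ^γ = (K/t)^q. -/
theorem exists_tailInt_const_le {γ q r : ℝ} (hγ : γ ≠ 0) (hq : 0 < q) (hqr : q < r) :
    ∃ C : ℝ≥0∞, C ≠ ⊤ ∧ ∀ (K : ℝ≥0∞) (t : ℝ), 0 < t →
      tailInt γ (γ / q) r t (fun _ => K) ≤ C * (K / ENNReal.ofReal t) ^ q := by
  have hr : 0 < r := hq.trans hqr
  -- Adding 1 keeps the constant nonzero, so that the right-hand side is infinite when K = ⊤.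
  refine ⟨tailInt γ (γ / q) r 1 (fun _ => 1) + 1,
    ENNReal.add_ne_top.2 ⟨tailInt_one_ne_top hγ hq hqr, by simp⟩, fun K t ht => ?_⟩
  have ht' : ENNReal.ofReal t ≠ 0 := by simpa using ht
  rcases eq_or_ne K ⊤ with rfl | hK
  · rw [ENNReal.top_div_of_ne_top ENNReal.ofReal_ne_top, ENNReal.top_rpow_of_pos hq,
      ENNReal.mul_top (by simp)]
    exact le_top
  rcases eq_or_ne K 0 with rfl | hK0
  · simp [tailInt, hr, hq]
  obtain ⟨k, rfl⟩ : ∃ k : ℝ, K = ENNReal.ofReal k := ⟨K.toReal, (ENNReal.ofReal_toReal hK).symm⟩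
  have hk : 0 < k := by
    by_contra h
    exact hK0 (ENNReal.ofReal_of_nonpos (not_lt.1 h))
  have hρ : 0 < (k / t) ^ (q / γ) := by positivity
  rw [tailInt_scale _ _ _ hρ]
  have e1 : ((k / t) ^ (q / γ)) ^ (γ / q) = k / t := by
    rw [← Real.rpow_mul (by positivity)]
    have : q / γ * (γ / q) = 1 := by field_simp
    rw [this, Real.rpow_one]
  have e2 : ((k / t) ^ (q / γ)) ^ γ = (k / t) ^ q := by
    rw [← Real.rpow_mul (by positivity)]
    congr 1; field_simp
  have e3 : tailInt γ (γ / q) r (t * (k / t)) (fun _ => ENNReal.ofReal k) =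
      tailInt γ (γ / q) r 1 (fun _ => 1) := by
    refine setLIntegral_congr_fun measurableSet_Ioi fun R hR => ?_
    have hR' : (0 : ℝ) < R := hR
    simp only
    rw [mul_div_cancel₀ _ ht.ne', ← ENNReal.ofReal_one, ← ENNReal.ofReal_div_of_pos (by positivity),
      ← ENNReal.ofReal_div_of_pos (by positivity)]
    congr 4
    field_simp
  rw [e1, e2, e3, ← ENNReal.ofReal_div_of_pos ht, ENNReal.ofReal_rpow_of_pos (by positivity),
    mul_comm]
  gcongr
  exact le_self_add

/-! ### The level integral and its pointwise bound -/

section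

variable {n : ℕ} {𝕜 : Type*} [RCLike 𝕜]

/-- The inner integral in the level functional. -/
noncomputable def levelInt (γ b : ℝ) (f : E n → 𝕜) (t : ℝ) (x : E n) : ℝ≥0∞ :=
  ∫⁻ y, (levelSet f t b).indicator (fun z => ENNReal.ofReal (‖z.1 - z.2‖ ^ (γ - n))) (x, y)

theorem measurableSet_levelSet {f : E n → 𝕜} (hf : Measurable f) (t b : ℝ) :
    MeasurableSet (levelSet f t b) := by
  have h1 : MeasurableSet {z : E n × E n | z.1 ≠ z.2} :=
    (measurableSet_eq_fun measurable_fst measurable_snd).compl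
  have h2 : Measurable fun z : E n × E n => ‖f z.1 - f z.2‖ / ‖z.1 - z.2‖ ^ (1 + b) :=
    ((hf.comp measurable_fst).sub (hf.comp measurable_snd)).norm.div
      ((measurable_fst.sub measurable_snd).norm.pow_const _)
  exact h1.inter (measurableSet_lt measurable_const h2)

theorem measurable_levelInt {f : E n → 𝕜} (hf : Measurable f) (γ b t : ℝ) :
    Measurable (levelInt γ b f t) := by
  refine Measurable.lintegral_prod_right' (Measurable.indicator ?_ (measurableSet_levelSet hf t b))
  exact ENNReal.measurable_ofReal.comp ((measurable_fst.sub measurable_snd).norm.pow_const _)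

theorem rpow_le_two_rpow_abs_mul {d R e : ℝ} (hd : 0 < d) (h1 : d < R) (h2 : R < 2 * d) :
    d ^ e ≤ 2 ^ |e| * R ^ e := by
  have hR : 0 < R := hd.trans h1
  rcases le_total 0 e with he | he
  · rw [abs_of_nonneg he]
    calc d ^ e ≤ R ^ e := Real.rpow_le_rpow hd.le h1.le he
      _ ≤ 2 ^ e * R ^ e := le_mul_of_one_le_left (by positivity)
        (Real.one_le_rpow (by norm_num) he)
  · rw [abs_of_nonpos he, Real.rpow_neg (by norm_num), ← Real.inv_rpow (by norm_num),
      ← Real.mul_rpow (by norm_num) hR.le]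
    exact Real.rpow_le_rpow_of_nonpos (by positivity) (by linarith) he

/-- Writing a power of the distance d as an integral over radii in (d, 2d) gives a continuous shell
decomposition: Tonelli then turns the level integral into an integral over R of measures of shells.
-/
theorem ofReal_rpow_le_lintegral {d e : ℝ} (hd : 0 < d) :
    ENNReal.ofReal (d ^ e) ≤ ENNReal.ofReal (2 ^ |e - 1|) *
      ∫⁻ R in Set.Ioo d (2 * d), ENNReal.ofReal (R ^ (e - 1)) := by
  rw [← lintegral_const_mul' _ _ ENNReal.ofReal_ne_top]
  calc ENNReal.ofReal (d ^ e) = ∫⁻ R in Set.Ioo d (2 * d), ENNReal.ofReal (d ^ (e - 1)) := by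
        rw [setLIntegral_const, Real.volume_Ioo, ← ENNReal.ofReal_mul (by positivity)]
        congr 1
        rw [Real.rpow_sub_one hd.ne']; field_simp; ring
    _ ≤ _ := by
        refine setLIntegral_mono' measurableSet_Ioo fun R hR => ?_
        rw [← ENNReal.ofReal_mul (by positivity)]
        exact ENNReal.ofReal_le_ofReal (rpow_le_two_rpow_abs_mul hd hR.1 hR.2)

variable [NeZero n]

theorem levelInt_le_lintegral {f : E n → 𝕜} (hf : Measurable f) (γ b t : ℝ) (x : E n) :
    levelInt γ b f t x ≤ ENNReal.ofReal (2 ^ |γ - n - 1|) *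
      ∫⁻ R in Set.Ioi (0 : ℝ), ENNReal.ofReal (R ^ (γ - n - 1)) *
        volume {y | (x, y) ∈ levelSet f t b ∧ dist y x < R ∧ R < 2 * dist y x} := by
  let A : Set (E n × ℝ) := {z | (x, z.1) ∈ levelSet f t b ∧ dist z.1 x < z.2 ∧ z.2 < 2 * dist z.1 x}
  have hA : MeasurableSet A := by
    refine ((measurable_const.prodMk measurable_fst) (measurableSet_levelSet hf t b)).inter
      ((measurableSet_lt (measurable_fst.dist measurable_const) measurable_snd).inter
        (measurableSet_lt measurable_snd ((measurable_fst.dist measurable_const).const_mul 2)))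
  have h1 : ∀ y, (levelSet f t b).indicator (fun z => ENNReal.ofReal (‖z.1 - z.2‖ ^ (γ - n))) (x, y)
      ≤ ENNReal.ofReal (2 ^ |γ - n - 1|) * ∫⁻ R in Set.Ioi (0 : ℝ),
        A.indicator (fun z => ENNReal.ofReal (z.2 ^ (γ - n - 1))) (y, R) := by
    intro y
    by_cases hy : (x, y) ∈ levelSet f t b
    · have hd : 0 < dist y x := dist_pos.2 (Ne.symm hy.1)
      rw [Set.indicator_of_mem hy]
      simp only
      rw [← dist_eq_norm, dist_comm]
      refine (ofReal_rpow_le_lintegral hd).trans (mul_le_mul_right ?_ _)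
      rw [← lintegral_indicator measurableSet_Ioo, ← lintegral_indicator measurableSet_Ioi]
      refine lintegral_mono fun R => ?_
      by_cases hR : R ∈ Set.Ioo (dist y x) (2 * dist y x)
      · rw [Set.indicator_of_mem hR, Set.indicator_of_mem (show R ∈ Set.Ioi (0:ℝ) from hd.trans hR.1),
          Set.indicator_of_mem (show (y, R) ∈ A from ⟨hy, hR.1, hR.2⟩)]
      · rw [Set.indicator_of_notMem hR]; exact zero_le
    · rw [Set.indicator_of_notMem hy]; exact zero_le
  refine (lintegral_mono h1).trans ?_
  rw [lintegral_const_mul' _ _ ENNReal.ofReal_ne_top]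
  refine mul_le_mul_right ?_ _
  have hm : Measurable fun z : E n × ℝ => A.indicator
      (fun z => ENNReal.ofReal (z.2 ^ (γ - n - 1))) z :=
    Measurable.indicator (ENNReal.measurable_ofReal.comp (measurable_snd.pow_const _)) hA
  have hsw := lintegral_lintegral_swap (μ := (volume : Measure (E n)))
    (ν := volume.restrict (Set.Ioi (0:ℝ)))
    (f := fun y R => A.indicator (fun z => ENNReal.ofReal (z.2 ^ (γ - n - 1))) (y, R))
    hm.aemeasurable
  rw [hsw]
  refine lintegral_mono fun R => le_of_eq ?_
  have hB : MeasurableSet {y | (y, R) ∈ A} := measurable_prodMk_right hA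
  have e : ∀ y, A.indicator (fun z => ENNReal.ofReal (z.2 ^ (γ - n - 1))) (y, R) =
      {y | (y, R) ∈ A}.indicator (fun _ => ENNReal.ofReal (R ^ (γ - n - 1))) y := fun y => rfl
  simp only [e]
  rw [lintegral_indicator hB, setLIntegral_const]
  rfl

/-- The master pointwise bound for the level integral. -/
theorem exists_levelInt_le_tailInt (n : ℕ) [NeZero n] (𝕜 : Type*) [RCLike 𝕜] (γ b : ℝ) {s r : ℝ}
    (hs : 1 ≤ s) (hsr : s ≤ r) (hn : n * (1 / s - 1 / r) < 1) :
    ∃ C : ℝ≥0∞, C ≠ ⊤ ∧ ∀ (f : E n → 𝕜) (g : E n → EuclideanSpace 𝕜 (Fin n)), Measurable f →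
      Measurable g → LocallyIntegrable f volume → IsWeakGradient f g → ∀ x, GoodPoint f x →
      ∀ t : ℝ, 0 < t → levelInt γ b f t x ≤
        C * tailInt γ b r t (dampedSup s (fun y => ‖g y‖ₑ) x) := by
  obtain ⟨C₁, hC₁, h1⟩ := exists_lintegral_potential_add_rpow_le n hs hsr hn
  have hr : 0 < r := by linarith
  set K : ℝ≥0∞ := ENNReal.ofReal (2 ^ |1 + b|) * (3 * (n * 8 ^ n)) with hK
  have hKtop : K ≠ ⊤ := by finiteness
  set v : ℝ≥0∞ := volume (Metric.ball (0 : E n) 1) with hv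
  have hvt : v ≠ ⊤ := volume_ball_ne_top _ _
  refine ⟨ENNReal.ofReal (2 ^ |γ - n - 1|) * ((K ^ r * C₁ + 1) * v), ?_, ?_⟩
  · have : K ^ r ≠ ⊤ := ENNReal.rpow_ne_top_of_nonneg hr.le hKtop
    finiteness
  intro f g hfm hgm hf hg x hx t ht
  set G : E n → ℝ≥0∞ := fun y => ‖g y‖ₑ with hG
  have hGm : Measurable G := hgm.enorm
  refine (levelInt_le_lintegral hfm γ b t x).trans ?_
  rw [mul_assoc]
  refine mul_le_mul_right ?_ _
  have hfin : (K ^ r * C₁ + 1) * v ≠ ⊤ := by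
    have : K ^ r ≠ ⊤ := ENNReal.rpow_ne_top_of_nonneg hr.le hKtop
    finiteness
  rw [tailInt, ← lintegral_const_mul' _ _ hfin]
  refine setLIntegral_mono' measurableSet_Ioi fun R hR => ?_
  have hR : (0:ℝ) < R := hR
  set S := {y | (x, y) ∈ levelSet f t b ∧ dist y x < R ∧ R < 2 * dist y x} with hS
  set D : ℝ≥0∞ := ENNReal.ofReal (t * R ^ b) with hD
  have hD0 : D ≠ 0 := by
    have : 0 < t * R ^ b := by positivity
    simpa [hD] using this
  have hDt : D ≠ ⊤ := ENNReal.ofReal_ne_top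
  set P : E n → ℝ≥0∞ := fun y => potential G x R + potential G y R with hP
  have hsub : S ⊆ Metric.ball x R := fun y hy => hy.2.1
  have b1 : volume S ≤ volume (Metric.ball x R) := measure_mono hsub
  have hSm : MeasurableSet S := by
    refine ((measurable_const.prodMk measurable_id) (measurableSet_levelSet hfm t b)).inter
      ((measurableSet_lt (measurable_id.dist measurable_const) measurable_const).inter
        (measurableSet_lt measurable_const ((measurable_id.dist measurable_const).const_mul 2)))
  -- Chebyshev's inequality with exponent r: on the shell the level condition and the difference
  -- estimate force t R^b ≤ K (P(x) + P(y)), where P is the potential at scale R.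
  have b2 : volume S ≤ (K / D) ^ r * (C₁ * volume (Metric.ball x R) * dampedSup s G x R ^ r) := by
    calc volume S = ∫⁻ y in S, 1 := by simp
      _ ≤ ∫⁻ y in S, (K / D) ^ r * P y ^ r := by
          refine lintegral_mono_ae ?_
          filter_upwards [ae_restrict_of_ae (ae_goodPoint hf), ae_restrict_mem hSm] with y hy hyS
          have hd : 0 < dist y x := dist_pos.2 (Ne.symm hyS.1.1)
          have k1 := enorm_sub_le_potential hf hg hR hx hy hyS.2.1.le
          have k2 : ENNReal.ofReal (t * R ^ (1 + b)) ≤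
              ENNReal.ofReal (2 ^ |1 + b|) * ‖f x - f y‖ₑ := by
            rw [← ofReal_norm, ← ENNReal.ofReal_mul (by positivity)]
            apply ENNReal.ofReal_le_ofReal
            have k3 := hyS.1.2
            simp only [gt_iff_lt] at k3
            rw [← dist_eq_norm x y, dist_comm, lt_div_iff₀ (by positivity)] at k3
            have k4 : R ^ (1 + b) ≤ 2 ^ |1 + b| * dist y x ^ (1 + b) := by
              -- The sign of 1 + b is not known; the comparison is applied to the opposite exponent
              -- and inverted, which exchanges the roles of the distance and R.
              have := rpow_le_two_rpow_abs_mul (e := -(1 + b)) hd hyS.2.1 hyS.2.2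
              rw [Real.rpow_neg hd.le, Real.rpow_neg hR.le, abs_neg] at this
              rw [← div_le_iff₀ (by positivity)]
              rw [inv_le_iff_one_le_mul₀ (by positivity)] at this
              rw [div_le_iff₀ (by positivity)]
              calc R ^ (1 + b) = 1 * R ^ (1 + b) := (one_mul _).symm
                _ ≤ (2 ^ |1 + b| * (R ^ (1 + b))⁻¹ * dist y x ^ (1 + b)) * R ^ (1 + b) := by
                  gcongr
                _ = _ := by field_simp
            calc t * R ^ (1 + b) ≤ t * (2 ^ |1 + b| * dist y x ^ (1 + b)) := by gcongr
              _ = 2 ^ |1 + b| * (t * dist y x ^ (1 + b)) := by ring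
              _ ≤ _ := by gcongr
          have k5 : D ≤ K * P y := by
            have k6 : ENNReal.ofReal R * D ≤ ENNReal.ofReal R * (K * P y) := by
              calc ENNReal.ofReal R * D = ENNReal.ofReal (t * R ^ (1 + b)) := by
                    rw [hD, ← ENNReal.ofReal_mul hR.le, Real.rpow_add hR, Real.rpow_one]
                    congr 1; ring
                _ ≤ ENNReal.ofReal (2 ^ |1 + b|) * (3 * (n * 8 ^ n) * (ENNReal.ofReal R * P y)) :=
                    k2.trans (mul_le_mul_right k1 _)
                _ = _ := by rw [hK]; ring
            rwa [ENNReal.mul_le_mul_iff_right (by simpa using hR) ENNReal.ofReal_ne_top] at k6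
          rw [← ENNReal.mul_rpow_of_nonneg _ _ hr.le]
          refine ENNReal.one_le_rpow ?_ hr
          rw [div_eq_mul_inv, mul_assoc, mul_comm D⁻¹, ← mul_assoc, ← div_eq_mul_inv]
          exact (ENNReal.le_div_iff_mul_le (Or.inl hD0) (Or.inl hDt)).2 (by rwa [one_mul])
      _ ≤ ∫⁻ y in Metric.ball x R, (K / D) ^ r * P y ^ r := lintegral_mono_set hsub
      _ = (K / D) ^ r * ∫⁻ y in Metric.ball x R, P y ^ r :=
          lintegral_const_mul' _ _ (ENNReal.rpow_ne_top_of_nonneg hr.le (ENNReal.div_ne_top hKtop hD0))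
      _ ≤ _ := mul_le_mul_right (h1 G hGm x R hR) _
  have b3 : volume S ≤ (K ^ r * C₁ + 1) * volume (Metric.ball x R) *
      min 1 ((dampedSup s G x R / D) ^ r) := by
    rcases le_total 1 ((dampedSup s G x R / D) ^ r) with h | h
    · rw [min_eq_left h, mul_one]
      refine b1.trans ?_
      rw [add_mul, one_mul]; exact le_add_self
    · rw [min_eq_right h]
      refine b2.trans ?_
      rw [div_eq_mul_inv, div_eq_mul_inv, ENNReal.mul_rpow_of_nonneg K D⁻¹ hr.le,
        ENNReal.mul_rpow_of_nonneg (dampedSup s G x R) D⁻¹ hr.le]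
      calc _ = (K ^ r * C₁) * volume (Metric.ball x R) * (dampedSup s G x R ^ r * D⁻¹ ^ r) := by ring
        _ ≤ _ := by gcongr; exact le_self_add
  refine (mul_le_mul_right b3 _).trans (le_of_eq ?_)
  rw [volume_ball_eq x hR.le, ← hv]
  have e : ENNReal.ofReal (R ^ (γ - 1)) =
      ENNReal.ofReal (R ^ (γ - n - 1)) * ENNReal.ofReal (R ^ n) := by
    rw [← ENNReal.ofReal_mul (by positivity), ← Real.rpow_natCast, ← Real.rpow_add hR]
    congr 2; ring
  rw [e]; ring

end

/-! ### Covering estimate and the maximal theorem -/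

section

variable {n : ℕ} [NeZero n]

/-- Vitali covering: every crossing ball meets a selected ball B of at least half its radius, so x
lies in 3B and the supremum is at most the sum of (2 rad B)^β over selected B with x in 3B. The
crossing condition bounds rad(B)^β |B| by τ⁻¹ ∫_B G, and the selected balls are disjoint. For β = 0
this is the weak type (1,1) bound for the maximal function. -/
theorem exists_lintegral_iSup_rpow_le (n : ℕ) [NeZero n] {β : ℝ} (hβ : 0 ≤ β) :
    ∃ C : ℝ≥0∞, C ≠ ⊤ ∧ ∀ (G : E n → ℝ≥0∞) (τ : ℝ), 0 < τ →
      ∫⁻ x, ⨆ R : ℝ, ⨆ _ : 0 < R ∧ ENNReal.ofReal (τ * R ^ β) < ballAvg G x R,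
        ENNReal.ofReal (R ^ β) ≤ C / ENNReal.ofReal τ * ∫⁻ x, G x := by
  have hC : ENNReal.ofReal (2 ^ β) * 3 ^ n ≠ 0 := by
    have : (0:ℝ) < 2 ^ β := by positivity
    simp [this]
  refine ⟨ENNReal.ofReal (2 ^ β) * 3 ^ n, by finiteness, fun G τ hτ => ?_⟩
  have hτ' : ENNReal.ofReal τ ≠ 0 := by simpa using hτ
  rcases eq_or_ne (∫⁻ x, G x) ⊤ with hI | hI
  · rw [hI, ENNReal.mul_top]
    · exact le_top
    · exact (ENNReal.div_pos hC ENNReal.ofReal_ne_top).ne'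
  let t : Set (E n × ℝ) := {a | 0 < a.2 ∧ ENNReal.ofReal (τ * a.2 ^ β) < ballAvg G a.1 a.2}
  have hball : ∀ a ∈ t, ENNReal.ofReal (τ * a.2 ^ β) * volume (Metric.ball a.1 a.2) ≤
      ∫⁻ y in Metric.ball a.1 a.2, G y := fun a ha => by
    rw [lintegral_ball_eq_ballAvg G a.1 ha.1]
    gcongr
    exact ha.2.le
  set v := (volume (Metric.ball (0 : E n) 1)).toReal with hv
  have hvpos : 0 < v := ENNReal.toReal_pos (volume_ball_pos _ one_pos) (volume_ball_ne_top _ _)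
  -- Vitali selection needs bounded radii: the crossing condition gives τ R^β |B(x, R)| ≤ ∫ G, and R
  -- ≤ R^β R^n once R ≥ 1.
  have hbd : ∀ a ∈ t, a.2 ≤ max 1 ((∫⁻ x, G x).toReal / (τ * v)) := by
    intro a ha
    rcases le_total a.2 1 with h | h
    · exact h.trans (le_max_left _ _)
    refine le_trans ?_ (le_max_right _ _)
    rw [le_div_iff₀ (by positivity)]
    have h1 := ENNReal.toReal_mono hI ((hball a ha).trans (setLIntegral_le_lintegral _ _))
    have ha0 : 0 < a.2 := ha.1
    rw [volume_ball_eq _ ha0.le, ENNReal.toReal_mul, ENNReal.toReal_mul,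
      ENNReal.toReal_ofReal (by positivity), ENNReal.toReal_ofReal (by positivity), ← hv] at h1
    refine le_trans ?_ h1
    have h2 : 1 ≤ a.2 ^ β := Real.one_le_rpow h hβ
    have h3 : a.2 ≤ a.2 ^ n := le_self_pow₀ h (NeZero.ne n)
    calc a.2 * (τ * v) = τ * 1 * (a.2 * v) := by ring
      _ ≤ _ := by gcongr
  obtain ⟨u, hut, hdisj, hcov⟩ := Vitali.exists_disjoint_subfamily_covering_enlargement
    (fun a : E n × ℝ => Metric.ball a.1 a.2) t (fun a => a.2) 2 (by norm_num)
    (fun a ha => ha.1.le) _ hbd (fun a ha => Metric.nonempty_ball.2 ha.1)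
  have hcount : u.Countable := hdisj.countable_of_isOpen (fun a _ => Metric.isOpen_ball)
    (fun a ha => Metric.nonempty_ball.2 (hut ha).1)
  have : Countable u := hcount
  have hpt : ∀ x, (⨆ R : ℝ, ⨆ _ : 0 < R ∧ ENNReal.ofReal (τ * R ^ β) < ballAvg G x R,
      ENNReal.ofReal (R ^ β)) ≤ ∑' b : u, (Metric.ball b.1.1 (3 * b.1.2)).indicator
        (fun _ => ENNReal.ofReal ((2 * b.1.2) ^ β)) x := by
    intro x
    refine iSup₂_le fun R hR => ?_
    obtain ⟨b, hb, ⟨z, hz1, hz2⟩, hRb⟩ := hcov (x, R) hR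
    simp only [Metric.mem_ball] at hz1 hz2 hRb
    refine le_trans ?_ (ENNReal.le_tsum ⟨b, hb⟩)
    rw [Set.indicator_of_mem]
    · exact ENNReal.ofReal_le_ofReal (Real.rpow_le_rpow hR.1.le hRb hβ)
    · rw [Metric.mem_ball]
      have := dist_triangle_left x b.1 z
      linarith
  have hone : ∀ b : u, ENNReal.ofReal ((2 * b.1.2) ^ β) * volume (Metric.ball b.1.1 (3 * b.1.2)) ≤
      ENNReal.ofReal (2 ^ β) * 3 ^ n / ENNReal.ofReal τ *
        ∫⁻ y in Metric.ball b.1.1 b.1.2, G y := by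
    intro b
    have hb := hut b.2
    have hb0 : 0 < b.1.2 := hb.1
    rw [volume_ball_scale _ b.1.1 (by norm_num) hb0.le, Real.mul_rpow (by norm_num) hb0.le,
      ENNReal.ofReal_mul (by positivity), ENNReal.ofReal_pow (by norm_num), ENNReal.ofReal_ofNat,
      div_eq_mul_inv]
    have h2 := hball b hb
    rw [ENNReal.ofReal_mul hτ.le] at h2
    calc _ = ENNReal.ofReal (2 ^ β) * 3 ^ n * ((ENNReal.ofReal τ)⁻¹ * ENNReal.ofReal τ) *
          (ENNReal.ofReal (b.1.2 ^ β) * volume (Metric.ball b.1.1 b.1.2)) := by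
          rw [ENNReal.inv_mul_cancel hτ' ENNReal.ofReal_ne_top]; ring
      _ = ENNReal.ofReal (2 ^ β) * 3 ^ n * (ENNReal.ofReal τ)⁻¹ * (ENNReal.ofReal τ *
          ENNReal.ofReal (b.1.2 ^ β) * volume (Metric.ball b.1.1 b.1.2)) := by ring
      _ ≤ _ := by gcongr
  calc _ ≤ ∫⁻ x, ∑' b : u, (Metric.ball b.1.1 (3 * b.1.2)).indicator
        (fun _ => ENNReal.ofReal ((2 * b.1.2) ^ β)) x := lintegral_mono hpt
    _ = ∑' b : u, ENNReal.ofReal ((2 * b.1.2) ^ β) * volume (Metric.ball b.1.1 (3 * b.1.2)) := by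
        rw [lintegral_tsum fun b =>
          (measurable_const.indicator Metric.isOpen_ball.measurableSet).aemeasurable]
        congr 1 with b
        rw [lintegral_indicator Metric.isOpen_ball.measurableSet, setLIntegral_const]
    _ ≤ ∑' b : u, ENNReal.ofReal (2 ^ β) * 3 ^ n / ENNReal.ofReal τ *
        ∫⁻ y in Metric.ball b.1.1 b.1.2, G y := ENNReal.tsum_le_tsum hone
    _ = ENNReal.ofReal (2 ^ β) * 3 ^ n / ENNReal.ofReal τ *
        ∫⁻ y in ⋃ b : u, Metric.ball b.1.1 b.1.2, G y := by
        rw [ENNReal.tsum_mul_left, lintegral_iUnion (fun b => Metric.isOpen_ball.measurableSet)]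
        exact hdisj.subtype _ _
    _ ≤ _ := by
        gcongr
        exact Measure.restrict_le_self

/-- The dyadic Hardy–Littlewood maximal function. -/
noncomputable def maxFun (G : E n → ℝ≥0∞) (x : E n) : ℝ≥0∞ :=
  ⨆ k : ℤ, ballAvg G x ((2 : ℝ) ^ k)

theorem measurable_maxFun {G : E n → ℝ≥0∞} (hG : Measurable G) : Measurable (maxFun G) :=
  Measurable.iSup fun _ => measurable_ballAvg_left hG _

theorem ballAvg_le_maxFun (G : E n → ℝ≥0∞) (x : E n) {R : ℝ} (hR : 0 < R) :
    ballAvg G x R ≤ 2 ^ n * maxFun G x := by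
  obtain ⟨k, hk1, hk2⟩ := exists_mem_Ioc_zpow hR one_lt_two
  have hk : (0:ℝ) < 2 ^ (k + 1) := by positivity
  have h := ballAvg_le_of_subset G (x := x) (y := x) hR (c := 2 ^ (k + 1) / R) (by positivity)
    (by rw [div_mul_cancel₀ _ hR.ne']; exact Metric.ball_subset_ball hk2)
  rw [div_mul_cancel₀ _ hR.ne'] at h
  refine h.trans (mul_le_mul' ?_ (le_iSup (fun k : ℤ => ballAvg G x ((2 : ℝ) ^ k)) (k + 1)))
  rw [ENNReal.ofReal_pow (by positivity)]
  gcongr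
  rw [← ENNReal.ofReal_ofNat]
  apply ENNReal.ofReal_le_ofReal
  rw [div_le_iff₀ hR, zpow_add_one₀ (by norm_num)]
  linarith

theorem dampedSup_le_maxFun {s : ℝ} (hs : 0 < s) (G : E n → ℝ≥0∞) (x : E n) {R : ℝ} (hR : 0 < R) :
    dampedSup s G x R ≤ (2 ^ n * maxFun (fun y => G y ^ s) x) ^ (1 / s) := by
  refine iSup_le fun i => ?_
  have h1 : ((2 : ℝ≥0∞) ^ (-(1 / 2) : ℝ)) ^ i ≤ 1 :=
    pow_le_one₀ zero_le (ENNReal.rpow_lt_one_of_one_lt_of_neg (by norm_num) (by norm_num)).le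
  calc _ ≤ 1 * ballAvg (fun y => G y ^ s) x (4 * ((2⁻¹ : ℝ) ^ i * R)) ^ (1 / s) := by gcongr
    _ ≤ _ := by
      rw [one_mul]
      gcongr
      exact ballAvg_le_maxFun _ _ (by positivity)

theorem exists_measure_maxFun_le (n : ℕ) [NeZero n] :
    ∃ C : ℝ≥0∞, C ≠ ⊤ ∧ ∀ G : E n → ℝ≥0∞, Measurable G → ∀ τ : ℝ, 0 < τ →
      volume {x | ENNReal.ofReal τ < maxFun G x} ≤ C / ENNReal.ofReal τ * ∫⁻ x, G x := by
  obtain ⟨C, hC, h⟩ := exists_lintegral_iSup_rpow_le n le_rfl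
  refine ⟨C, hC, fun G hG τ hτ => le_trans ?_ (h G τ hτ)⟩
  rw [← lintegral_indicator_one (measurableSet_lt measurable_const (measurable_maxFun hG))]
  refine lintegral_mono fun x => ?_
  by_cases hx : x ∈ {x | ENNReal.ofReal τ < maxFun G x}
  · rw [Set.indicator_of_mem hx]
    obtain ⟨k, hk⟩ := lt_iSup_iff.1 (show ENNReal.ofReal τ < ⨆ k : ℤ, ballAvg G x (2 ^ k) from hx)
    refine le_trans ?_ (le_iSup₂ (f := fun (R : ℝ)
      (_ : 0 < R ∧ ENNReal.ofReal (τ * R ^ (0:ℝ)) < ballAvg G x R) => ENNReal.ofReal (R ^ (0:ℝ)))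
      (2 ^ k) ⟨by positivity, by simpa using hk⟩)
    simp
  · rw [Set.indicator_of_notMem hx]; exact zero_le

/-- The layer-cake formula for a power, including the value a = ⊤, which is reached by monotonicity
from arbitrarily large finite values. -/
theorem lintegral_Ioi_lt_rpow {e : ℝ} (he : 0 < e) (a : ℝ≥0∞) :
    ∫⁻ t in Set.Ioi (0 : ℝ), {t : ℝ | ENNReal.ofReal t < a}.indicator
      (fun t => ENNReal.ofReal (t ^ (e - 1))) t = ENNReal.ofReal e⁻¹ * a ^ e := by
  have key : ∀ c : ℝ, 0 ≤ c → ∫⁻ t in Set.Ioi (0 : ℝ),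
      {t : ℝ | ENNReal.ofReal t < ENNReal.ofReal c}.indicator
        (fun t => ENNReal.ofReal (t ^ (e - 1))) t = ENNReal.ofReal e⁻¹ * ENNReal.ofReal c ^ e := by
    intro c hc
    have hset : ∀ t ∈ Set.Ioi (0:ℝ), {t : ℝ | ENNReal.ofReal t < ENNReal.ofReal c}.indicator
        (fun t => ENNReal.ofReal (t ^ (e - 1))) t =
        (Set.Iio c).indicator (fun t => ENNReal.ofReal (t ^ (e - 1))) t := by
      intro t ht
      have : ENNReal.ofReal t < ENNReal.ofReal c ↔ t < c :=
        ENNReal.ofReal_lt_ofReal_iff_of_nonneg (le_of_lt ht)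
      by_cases h : t < c
      · rw [Set.indicator_of_mem
          (show t ∈ {t : ℝ | ENNReal.ofReal t < ENNReal.ofReal c} from this.2 h), Set.indicator_of_mem (show t ∈ Set.Iio c from h)]
      · rw [Set.indicator_of_notMem
          (show t ∉ {t : ℝ | ENNReal.ofReal t < ENNReal.ofReal c} from fun h' => h (this.1 h')),
          Set.indicator_of_notMem (show t ∉ Set.Iio c from h)]
    rw [setLIntegral_congr_fun measurableSet_Ioi hset, lintegral_indicator measurableSet_Iio,
      Measure.restrict_restrict measurableSet_Iio, Set.inter_comm, Set.Ioi_inter_Iio,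
      Measure.restrict_congr_set Ioo_ae_eq_Ioc]
    have hi : IntegrableOn (fun t : ℝ => t ^ (e - 1)) (Set.Ioc 0 c) volume := by
      rw [← intervalIntegrable_iff_integrableOn_Ioc_of_le hc]
      exact intervalIntegral.intervalIntegrable_rpow' (by linarith)
    rw [← ofReal_integral_eq_lintegral_ofReal hi, ← intervalIntegral.integral_of_le hc,
      integral_rpow (Or.inl (by linarith)), sub_add_cancel, Real.zero_rpow he.ne', sub_zero,
      ENNReal.ofReal_rpow_of_nonneg hc he.le, ← ENNReal.ofReal_mul (by positivity)]
    · congr 1; rw [div_eq_inv_mul]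
    · filter_upwards [ae_restrict_mem measurableSet_Ioc] with t ht
      exact Real.rpow_nonneg ht.1.le _
  rcases eq_or_ne a ⊤ with rfl | ha
  · rw [ENNReal.top_rpow_of_pos he, ENNReal.mul_top (by simpa using he)]
    refine ENNReal.eq_top_of_forall_nnreal_le fun N => ?_
    have h := key ((e * N) ^ e⁻¹) (by positivity)
    rw [ENNReal.ofReal_rpow_of_nonneg (by positivity) he.le, ← ENNReal.ofReal_mul (by positivity),
      Real.rpow_inv_rpow (by positivity) he.ne', inv_mul_cancel_left₀ he.ne',
      ENNReal.ofReal_coe_nnreal] at h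
    rw [← h]
    refine lintegral_mono fun t => Set.indicator_le_indicator_of_subset (fun t _ => ?_)
      (fun _ => zero_le) t
    exact ENNReal.ofReal_lt_top
  · have := key a.toReal ENNReal.toReal_nonneg
    rwa [ENNReal.ofReal_toReal ha] at this

theorem maxFun_le_add {G H : E n → ℝ≥0∞} {c : ℝ≥0∞} (h : ∀ y, G y ≤ c + H y) (x : E n) :
    maxFun G x ≤ c + maxFun H x := by
  refine iSup_le fun k => ?_
  have hk : (0:ℝ) < 2 ^ k := by positivity
  refine (ballAvg_mono h x _).trans ?_
  rw [ballAvg_add measurable_const, ballAvg_const x hk]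
  gcongr
  exact le_iSup (fun k : ℤ => ballAvg H x ((2 : ℝ) ^ k)) k

/-- The Hardy–Littlewood maximal theorem in `L^p`, `p > 1`. -/
theorem exists_lintegral_maxFun_rpow_le (n : ℕ) [NeZero n] {p : ℝ} (hp : 1 < p) :
    ∃ C : ℝ≥0∞, C ≠ ⊤ ∧ ∀ G : E n → ℝ≥0∞, Measurable G →
      ∫⁻ x, maxFun G x ^ p ≤ C * ∫⁻ x, G x ^ p := by
  obtain ⟨C, hC, h⟩ := exists_measure_maxFun_le n
  have hp0 : 0 < p := by linarith
  refine ⟨ENNReal.ofReal p * (C * 2 * ENNReal.ofReal (p - 1)⁻¹ * 2 ^ (p - 1)), by finiteness,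
    fun G hG => ?_⟩
  have hM := measurable_maxFun hG
  -- Marcinkiewicz truncation: where G ≤ t/2 it contributes at most t/2 to the maximal function, so
  -- the weak bound at height t/2 is needed only for the part of G above t/2.
  have hlev : ∀ t : ℝ, 0 < t → volume {x | ENNReal.ofReal t < maxFun G x} ≤
      C / ENNReal.ofReal (t / 2) * ∫⁻ x, {x | ENNReal.ofReal t < 2 * G x}.indicator G x := by
    intro t ht
    have hmeas : MeasurableSet {x | ENNReal.ofReal t < 2 * G x} :=
      measurableSet_lt measurable_const (hG.const_mul 2)
    refine le_trans (measure_mono fun x hx => ?_) (h _ (hG.indicator hmeas) (t / 2) (by positivity))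
    have h1 : maxFun G x ≤ ENNReal.ofReal (t / 2) +
        maxFun ({x | ENNReal.ofReal t < 2 * G x}.indicator G) x := by
      refine maxFun_le_add (fun y => ?_) x
      by_cases hy : y ∈ {x | ENNReal.ofReal t < 2 * G x}
      · rw [Set.indicator_of_mem hy]; exact le_add_self
      · refine le_add_right ?_
        have : 2 * G y ≤ ENNReal.ofReal t := not_lt.1 hy
        rw [ENNReal.ofReal_div_of_pos two_pos, ENNReal.ofReal_ofNat]
        rw [ENNReal.le_div_iff_mul_le (by simp) (by simp), mul_comm]
        exact this
    have h2 : ENNReal.ofReal (t / 2) + ENNReal.ofReal (t / 2) < maxFun G x := by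
      rw [← ENNReal.ofReal_add (by positivity) (by positivity), add_halves]; exact hx
    exact lt_of_add_lt_add_left (h2.trans_le h1)
  have e0 : ∀ x, maxFun G x ^ p = ENNReal.ofReal p * ∫⁻ t in Set.Ioi (0 : ℝ),
      {t : ℝ | ENNReal.ofReal t < maxFun G x}.indicator (fun t => ENNReal.ofReal (t ^ (p - 1))) t := by
    intro x
    rw [lintegral_Ioi_lt_rpow hp0, ← mul_assoc, ← ENNReal.ofReal_mul hp0.le,
      mul_inv_cancel₀ hp0.ne', ENNReal.ofReal_one, one_mul]
  simp only [e0]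
  rw [lintegral_const_mul' _ _ ENNReal.ofReal_ne_top, mul_assoc]
  refine mul_le_mul_right ?_ _
  let A : Set (E n × ℝ) := {z | ENNReal.ofReal z.2 < maxFun G z.1}
  have hA : MeasurableSet A := measurableSet_lt (ENNReal.measurable_ofReal.comp measurable_snd)
    (hM.comp measurable_fst)
  have hsw := lintegral_lintegral_swap (μ := (volume : Measure (E n)))
    (ν := volume.restrict (Set.Ioi (0:ℝ)))
    (f := fun x t => A.indicator (fun z => ENNReal.ofReal (z.2 ^ (p - 1))) (x, t))
    (Measurable.indicator (ENNReal.measurable_ofReal.comp (measurable_snd.pow_const _))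
      hA).aemeasurable
  refine (le_of_eq hsw).trans ?_
  let B : Set (ℝ × E n) := {z | ENNReal.ofReal z.1 < 2 * G z.2}
  have hB : MeasurableSet B := measurableSet_lt (ENNReal.measurable_ofReal.comp measurable_fst)
    ((hG.comp measurable_snd).const_mul 2)
  have h3 : ∀ t ∈ Set.Ioi (0:ℝ),
      ∫⁻ x, A.indicator (fun z => ENNReal.ofReal (z.2 ^ (p - 1))) (x, t) ≤
      ∫⁻ x, C * 2 * B.indicator (fun z => G z.2 * ENNReal.ofReal (z.1 ^ (p - 1 - 1))) (t, x) := by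
    intro t ht
    have ht : (0:ℝ) < t := ht
    have e1 : ∫⁻ x, A.indicator (fun z => ENNReal.ofReal (z.2 ^ (p - 1))) (x, t) =
        ENNReal.ofReal (t ^ (p - 1)) * volume {x | ENNReal.ofReal t < maxFun G x} := by
      rw [← setLIntegral_const, ← lintegral_indicator (measurableSet_lt measurable_const hM)]
      rfl
    have e2 : ∀ x, B.indicator (fun z => G z.2 * ENNReal.ofReal (z.1 ^ (p - 1 - 1))) (t, x) =
        {x | ENNReal.ofReal t < 2 * G x}.indicator G x * ENNReal.ofReal (t ^ (p - 1 - 1)) := by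
      intro x
      by_cases hx : ENNReal.ofReal t < 2 * G x
      · rw [Set.indicator_of_mem (show (t, x) ∈ B from hx),
          Set.indicator_of_mem (show x ∈ {x | ENNReal.ofReal t < 2 * G x} from hx)]
      · rw [Set.indicator_of_notMem (show (t, x) ∉ B from hx),
          Set.indicator_of_notMem (show x ∉ {x | ENNReal.ofReal t < 2 * G x} from hx), zero_mul]
    simp only [e2]
    rw [e1, lintegral_const_mul' _ _ (by finiteness), lintegral_mul_const' _ _ ENNReal.ofReal_ne_top]
    refine (mul_le_mul_right (hlev t ht) _).trans (le_of_eq ?_)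
    rw [div_eq_mul_inv, ← ENNReal.ofReal_inv_of_pos (by positivity)]
    have e3 : ENNReal.ofReal (t ^ (p - 1)) * ENNReal.ofReal (t / 2)⁻¹ =
        2 * ENNReal.ofReal (t ^ (p - 1 - 1)) := by
      rw [← ENNReal.ofReal_mul (by positivity), ← ENNReal.ofReal_ofNat 2,
        ← ENNReal.ofReal_mul (by norm_num), Real.rpow_sub_one ht.ne' (p - 1)]
      congr 1; field_simp
    calc _ = C * (ENNReal.ofReal (t ^ (p - 1)) * ENNReal.ofReal (t / 2)⁻¹) *
          ∫⁻ x, {x | ENNReal.ofReal t < 2 * G x}.indicator G x := by ring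
      _ = _ := by rw [e3]; ring
  refine (setLIntegral_mono' measurableSet_Ioi h3).trans ?_
  have hsw2 := lintegral_lintegral_swap (μ := volume.restrict (Set.Ioi (0:ℝ)))
    (ν := (volume : Measure (E n)))
    (f := fun t x => C * 2 * B.indicator
      (fun z => G z.2 * ENNReal.ofReal (z.1 ^ (p - 1 - 1))) (t, x))
    (Measurable.const_mul (Measurable.indicator ((hG.comp measurable_snd).mul
      (ENNReal.measurable_ofReal.comp (measurable_fst.pow_const _))) hB) _).aemeasurable
  rw [hsw2, ← lintegral_const_mul' _ _ (by finiteness)]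
  refine lintegral_mono fun x => le_of_eq ?_
  have e4 : ∀ t, C * 2 * B.indicator (fun z => G z.2 * ENNReal.ofReal (z.1 ^ (p - 1 - 1))) (t, x) =
      C * 2 * G x * {t : ℝ | ENNReal.ofReal t < 2 * G x}.indicator
        (fun t => ENNReal.ofReal (t ^ (p - 1 - 1))) t := by
    intro t
    by_cases hx : ENNReal.ofReal t < 2 * G x
    · rw [Set.indicator_of_mem (show (t, x) ∈ B from hx), Set.indicator_of_mem
        (show t ∈ {t : ℝ | ENNReal.ofReal t < 2 * G x} from hx), ← mul_assoc]
    · rw [Set.indicator_of_notMem (show (t, x) ∉ B from hx), Set.indicator_of_notMem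
        (show t ∉ {t : ℝ | ENNReal.ofReal t < 2 * G x} from hx), mul_zero, mul_zero]
  simp only [e4]
  rw [lintegral_const_mul, lintegral_Ioi_lt_rpow (by linarith),
    ENNReal.mul_rpow_of_nonneg _ _ (by linarith)]
  · have : G x ^ p = G x * G x ^ (p - 1) := by
      conv_rhs => rw [← ENNReal.rpow_one (G x), ← ENNReal.rpow_mul, one_mul,
        ← ENNReal.rpow_add_of_nonneg _ _ zero_le_one (by linarith)]
      congr 1; ring
    rw [this]; ring
  · exact Measurable.indicator (ENNReal.measurable_ofReal.comp (measurable_id.pow_const _))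
      (measurableSet_lt ENNReal.measurable_ofReal measurable_const)

end

/-! ### Linear functions -/

section

variable {n : ℕ} {𝕜 : Type*} [RCLike 𝕜]

/-- The linear function with gradient `a`. -/
noncomputable def linMap (a : EuclideanSpace 𝕜 (Fin n)) : E n →L[ℝ] 𝕜 :=
  ∑ j, (EuclideanSpace.proj (𝕜 := ℝ) j).smulRight (a j)

theorem linMap_apply (a : EuclideanSpace 𝕜 (Fin n)) (y : E n) : linMap a y = ∑ j, y j • a j := by
  simp [linMap]

theorem linMap_single (a : EuclideanSpace 𝕜 (Fin n)) (j : Fin n) :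
    linMap a (EuclideanSpace.single j 1) = a j := by
  rw [linMap_apply, Finset.sum_eq_single j]
  · simp
  · intro i _ hij; simp [hij]
  · simp

theorem isWeakGradient_linMap (a : EuclideanSpace 𝕜 (Fin n)) :
    IsWeakGradient (linMap a) (fun _ => a) := by
  refine ⟨locallyIntegrable_const a, fun j φ hφ hc => ?_⟩
  have hl : Continuous (linMap a) := (linMap a).continuous
  have hd : Continuous fun x => fderiv ℝ φ x (EuclideanSpace.single j 1) :=
    (hφ.continuous_fderiv (by simp)).clm_apply continuous_const
  have hcd : HasCompactSupport fun x => fderiv ℝ φ x (EuclideanSpace.single j 1) :=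
    hc.fderiv_apply ℝ _
  have h := integral_smul_fderiv_eq_neg_fderiv_smul_of_integrable (𝕜 := ℝ) (μ := volume) (f := φ)
    (g := linMap a) (v := EuclideanSpace.single j 1)
    ((hd.smul hl).integrable_of_hasCompactSupport hcd.smul_right)
    (by
      simp only [ContinuousLinearMap.fderiv]
      exact (hφ.continuous.smul continuous_const).integrable_of_hasCompactSupport hc.smul_right)
    ((hφ.continuous.smul hl).integrable_of_hasCompactSupport hc.smul_right)
    (fun x _ => hφ.differentiable (by simp) x) (fun x _ => (linMap a).differentiableAt)
  simp only [ContinuousLinearMap.fderiv, linMap_single] at h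
  rw [h, neg_neg]

theorem IsWeakGradient.sub {f h : E n → 𝕜} {g k : E n → EuclideanSpace 𝕜 (Fin n)}
    (hf : LocallyIntegrable f volume) (hh : LocallyIntegrable h volume)
    (hg : IsWeakGradient f g) (hk : IsWeakGradient h k) :
    IsWeakGradient (fun x => f x - h x) (fun x => g x - k x) := by
  refine ⟨hg.1.sub hk.1, fun j φ hφ hc => ?_⟩
  have hd : Continuous fun x => fderiv ℝ φ x (EuclideanSpace.single j 1) :=
    (hφ.continuous_fderiv (by simp)).clm_apply continuous_const
  have hcd : HasCompactSupport fun x => fderiv ℝ φ x (EuclideanSpace.single j 1) :=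
    hc.fderiv_apply ℝ _
  have loc : ∀ {u : E n → EuclideanSpace 𝕜 (Fin n)}, LocallyIntegrable u volume →
      LocallyIntegrable (fun x => u x j) volume := by
    intro u hu x
    obtain ⟨s, hs, hi⟩ := hu x
    exact ⟨s, hs, (EuclideanSpace.proj (𝕜 := 𝕜) j).integrable_comp hi⟩
  have e1 := hg.2 j φ hφ hc
  have e2 := hk.2 j φ hφ hc
  simp only [PiLp.sub_apply, smul_sub]
  rw [integral_sub, integral_sub, e1, e2]
  · ring
  · exact (loc hg.1).integrable_smul_left_of_hasCompactSupport hφ.continuous hc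
  · exact (loc hk.1).integrable_smul_left_of_hasCompactSupport hφ.continuous hc
  · exact hf.integrable_smul_left_of_hasCompactSupport hd hcd
  · exact hh.integrable_smul_left_of_hasCompactSupport hd hcd

end

/-! ### Polar coordinates -/

section

variable {n : ℕ} [NeZero n]

/-- Lebesgue measure off the origin corresponds to the product of surface measure and R^(n-1) dR;
the origin is a null set. -/
theorem lintegral_polar {F : E n → ℝ≥0∞} (hF : Measurable F) :
    ∫⁻ x, F x = ∫⁻ w : Metric.sphere (0 : E n) 1, (∫⁻ R in Set.Ioi (0 : ℝ),
      ENNReal.ofReal (R ^ (n - 1)) * F (R • (w : E n)))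
        ∂(volume : Measure (E n)).toSphere := by
  have hmp := (volume : Measure (E n)).measurePreserving_homeomorphUnitSphereProd
  have hfr : Module.finrank ℝ (E n) = n := by simp
  rw [hfr] at hmp
  let H : Metric.sphere (0 : E n) 1 × Set.Ioi (0:ℝ) → ℝ≥0∞ := fun z => F ((z.2 : ℝ) • (z.1 : E n))
  have hH : Measurable H := hF.comp (by fun_prop)
  have h1 := hmp.lintegral_comp hH
  have h2 : ∫⁻ x, F x = ∫⁻ x : ({0}ᶜ : Set (E n)), F x ∂(Measure.comap Subtype.val volume) := by
    rw [lintegral_subtype_comap (measurableSet_singleton _).compl, restrict_compl_singleton]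
  have h3 : ∀ x : ({0}ᶜ : Set (E n)), H (homeomorphUnitSphereProd (E n) x) = F x := by
    intro x
    have : (x : E n) ≠ 0 := x.2
    simp only [H, homeomorphUnitSphereProd_apply_snd_coe, homeomorphUnitSphereProd_apply_fst_coe]
    rw [smul_smul, mul_inv_cancel₀ (norm_ne_zero_iff.2 this), one_smul]
  simp only [h3] at h1
  rw [h2, h1, lintegral_prod _ hH.aemeasurable]
  congr 1 with w
  have hd : Measurable fun r : Set.Ioi (0:ℝ) => ENNReal.ofReal ((r:ℝ) ^ (n - 1)) := by fun_prop
  have hHw : Measurable fun r : Set.Ioi (0:ℝ) => H (w, r) := hH.comp measurable_prodMk_left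
  rw [Measure.volumeIoiPow, lintegral_withDensity_eq_lintegral_mul _ hd hHw]
  exact lintegral_subtype_comap measurableSet_Ioi
    (fun R : ℝ => ENNReal.ofReal (R ^ (n - 1)) * F (R • (w : E n)))

theorem lintegral_Ioi_gt_rpow {e ρ : ℝ} (he : e < 0) (hρ : 0 < ρ) :
    ∫⁻ R in Set.Ioi ρ, ENNReal.ofReal (R ^ (e - 1)) = ENNReal.ofReal (ρ ^ e / (-e)) := by
  rw [← ofReal_integral_eq_lintegral_ofReal (integrableOn_Ioi_rpow_of_lt (by linarith) hρ),
    integral_Ioi_rpow_of_lt (by linarith) hρ, sub_add_cancel]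
  · congr 1; field_simp
  · filter_upwards [ae_restrict_mem measurableSet_Ioi] with t ht
    exact Real.rpow_nonneg (hρ.trans ht).le _

/-- With the crossing radius ρ = (A/t)^(q/γ), the admissible radii are R < ρ if γ > 0 and R > ρ if γ
< 0. Both integrals equal ρ^γ / |γ|, so the two signs share one formula. -/
theorem lintegral_radial_level {γ q : ℝ} (hγ : γ ≠ 0) (hq : 0 < q) {A t : ℝ} (hA : 0 ≤ A)
    (ht : 0 < t) :
    ∫⁻ R in Set.Ioi (0 : ℝ), {R : ℝ | t < A / R ^ (γ / q)}.indicator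
      (fun R => ENNReal.ofReal (R ^ (γ - 1))) R =
      ENNReal.ofReal |γ|⁻¹ * (ENNReal.ofReal A / ENNReal.ofReal t) ^ q := by
  rw [← ENNReal.ofReal_div_of_pos ht, ENNReal.ofReal_rpow_of_nonneg (by positivity) hq.le,
    ← ENNReal.ofReal_mul (by positivity)]
  rcases hA.eq_or_lt with rfl | hA
  · have : {R : ℝ | t < 0 / R ^ (γ / q)} = ∅ := by
      ext R; simp [ht.le]
    rw [this]
    simp [hq.ne', Real.zero_rpow]
  set ρ := (A / t) ^ (q / γ) with hρdef
  have hρ : 0 < ρ := by positivity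
  have hργ : ρ ^ γ = (A / t) ^ q := by
    rw [hρdef, ← Real.rpow_mul (by positivity)]
    congr 1; field_simp
  have hρb : ρ ^ (γ / q) = A / t := by
    rw [hρdef, ← Real.rpow_mul (by positivity)]
    have : q / γ * (γ / q) = 1 := by field_simp
    rw [this, Real.rpow_one]
  have hiff : ∀ R : ℝ, 0 < R → (t < A / R ^ (γ / q) ↔ R ^ (γ / q) < ρ ^ (γ / q)) := by
    intro R hR
    rw [hρb, lt_div_iff₀ (by positivity), lt_div_iff₀ ht, mul_comm]
  rcases lt_or_gt_of_ne hγ with h | h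
  · have hb : γ / q < 0 := div_neg_of_neg_of_pos h hq
    have hset : ∀ R ∈ Set.Ioi (0:ℝ), {R : ℝ | t < A / R ^ (γ / q)}.indicator
        (fun R => ENNReal.ofReal (R ^ (γ - 1))) R =
        (Set.Ioi ρ).indicator (fun R => ENNReal.ofReal (R ^ (γ - 1))) R := by
      intro R hR
      have h1 : R ∈ {R : ℝ | t < A / R ^ (γ / q)} ↔ R ∈ Set.Ioi ρ :=
        (hiff R hR).trans (Real.rpow_lt_rpow_iff_of_neg hR hρ hb)
      by_cases h2 : R ∈ Set.Ioi ρ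
      · rw [Set.indicator_of_mem (h1.2 h2), Set.indicator_of_mem h2]
      · rw [Set.indicator_of_notMem (fun h3 => h2 (h1.1 h3)), Set.indicator_of_notMem h2]
    rw [setLIntegral_congr_fun measurableSet_Ioi hset, lintegral_indicator measurableSet_Ioi,
      Measure.restrict_restrict measurableSet_Ioi,
      Set.inter_eq_left.2 (Set.Ioi_subset_Ioi hρ.le), lintegral_Ioi_gt_rpow h hρ, hργ,
      abs_of_neg h, div_eq_inv_mul]
  · have hb : 0 < γ / q := div_pos h hq
    have hset : ∀ R ∈ Set.Ioi (0:ℝ), {R : ℝ | t < A / R ^ (γ / q)}.indicator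
        (fun R => ENNReal.ofReal (R ^ (γ - 1))) R =
        {R : ℝ | ENNReal.ofReal R < ENNReal.ofReal ρ}.indicator
          (fun R => ENNReal.ofReal (R ^ (γ - 1))) R := by
      intro R hR
      have hR0 : (0:ℝ) < R := hR
      have h1 : R ∈ {R : ℝ | t < A / R ^ (γ / q)} ↔
          R ∈ {R : ℝ | ENNReal.ofReal R < ENNReal.ofReal ρ} :=
        (hiff R hR).trans ((Real.rpow_lt_rpow_iff hR0.le hρ.le hb).trans
          (ENNReal.ofReal_lt_ofReal_iff_of_nonneg hR0.le).symm)
      by_cases h2 : R ∈ {R : ℝ | ENNReal.ofReal R < ENNReal.ofReal ρ}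
      · rw [Set.indicator_of_mem (h1.2 h2), Set.indicator_of_mem h2]
      · rw [Set.indicator_of_notMem (fun h3 => h2 (h1.1 h3)), Set.indicator_of_notMem h2]
    rw [setLIntegral_congr_fun measurableSet_Ioi hset, lintegral_Ioi_lt_rpow h,
      ENNReal.ofReal_rpow_of_pos hρ, hργ, abs_of_pos h, ← ENNReal.ofReal_mul (by positivity)]

variable {𝕜 : Type*} [RCLike 𝕜]

/-- `∫_{𝕊ⁿ⁻¹} |a · ω|^q dω`. -/
noncomputable def dirInt (q : ℝ) (a : EuclideanSpace 𝕜 (Fin n)) : ℝ≥0∞ :=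
  ∫⁻ w : Metric.sphere (0 : E n) 1, ‖linMap a (w : E n)‖ₑ ^ q ∂(volume : Measure (E n)).toSphere

/-- The model computation and the source of the limiting constant: by translation invariance the
integral is independent of x, and along each ray it is the radial level integral with A = |a · ω|.
-/
theorem levelInt_linMap {γ q : ℝ} (hγ : γ ≠ 0) (hq : 0 < q) (a : EuclideanSpace 𝕜 (Fin n))
    {t : ℝ} (ht : 0 < t) (x : E n) :
    levelInt γ (γ / q) (linMap a) t x =
      ENNReal.ofReal |γ|⁻¹ * dirInt q a / ENNReal.ofReal t ^ q := by
  let F : E n → ℝ≥0∞ := fun z => {z : E n | z ≠ 0 ∧ t < ‖linMap a z‖ / ‖z‖ ^ (1 + γ / q)}.indicator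
    (fun z => ENNReal.ofReal (‖z‖ ^ (γ - n))) z
  have hF : Measurable F := by
    refine Measurable.indicator (ENNReal.measurable_ofReal.comp (measurable_norm.pow_const _)) ?_
    have h1 : Measurable fun z : E n => ‖linMap a z‖ / ‖z‖ ^ (1 + γ / q) :=
      (linMap a).continuous.measurable.norm.div (measurable_norm.pow_const _)
    exact (measurableSet_singleton (0 : E n)).compl.inter (measurableSet_lt measurable_const h1)
  have e1 : levelInt γ (γ / q) (linMap a) t x = ∫⁻ y, F (x - y) := by
    refine lintegral_congr fun y => ?_
    have : (x, y) ∈ levelSet (linMap a) t (γ / q) ↔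
        x - y ∈ {z : E n | z ≠ 0 ∧ t < ‖linMap a z‖ / ‖z‖ ^ (1 + γ / q)} := by
      simp only [levelSet, Set.mem_ofPred_eq, map_sub, sub_ne_zero, gt_iff_lt]
    by_cases h : (x, y) ∈ levelSet (linMap a) t (γ / q)
    · simp only [F]
      rw [Set.indicator_of_mem h, Set.indicator_of_mem (this.1 h)]
    · simp only [F]
      rw [Set.indicator_of_notMem h, Set.indicator_of_notMem (fun h' => h (this.2 h'))]
  rw [e1, lintegral_sub_left_eq_self F x, lintegral_polar hF]
  have e2 : ∀ w : Metric.sphere (0 : E n) 1, ∫⁻ R in Set.Ioi (0 : ℝ),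
      ENNReal.ofReal (R ^ (n - 1)) * F (R • (w : E n)) =
      (ENNReal.ofReal |γ|⁻¹ * (ENNReal.ofReal t ^ q)⁻¹) * ‖linMap a (w : E n)‖ₑ ^ q := by
    intro w
    have hw : ‖(w : E n)‖ = 1 := by simp
    have h := lintegral_radial_level hγ hq (norm_nonneg (linMap a (w : E n))) ht
    rw [ofReal_norm, ENNReal.div_rpow_of_nonneg _ _ hq.le,
      ENNReal.div_eq_inv_mul, mul_comm _ (‖linMap a (w : E n)‖ₑ ^ q)] at h
    rw [mul_assoc, mul_comm (ENNReal.ofReal t ^ q)⁻¹, ← h]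
    refine setLIntegral_congr_fun measurableSet_Ioi fun R hR => ?_
    have hR : (0:ℝ) < R := hR
    have hw0 : (w : E n) ≠ 0 := by
      intro h0; rw [h0, norm_zero] at hw; exact zero_ne_one hw
    have hnorm : ‖R • (w : E n)‖ = R := by rw [norm_smul, hw, mul_one, Real.norm_of_nonneg hR.le]
    have hlin : ‖linMap a (R • (w : E n))‖ / ‖R • (w : E n)‖ ^ (1 + γ / q) =
        ‖linMap a (w : E n)‖ / R ^ (γ / q) := by
      rw [hnorm, map_smul, norm_smul, Real.norm_of_nonneg hR.le, Real.rpow_add hR, Real.rpow_one]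
      field_simp
    have hmem : R • (w : E n) ∈ {z : E n | z ≠ 0 ∧ t < ‖linMap a z‖ / ‖z‖ ^ (1 + γ / q)} ↔
        R ∈ {R : ℝ | t < ‖linMap a (w : E n)‖ / R ^ (γ / q)} := by
      simp only [Set.mem_ofPred_eq, hlin]
      exact and_iff_right (smul_ne_zero hR.ne' hw0)
    simp only [F]
    by_cases h1 : R ∈ {R : ℝ | t < ‖linMap a (w : E n)‖ / R ^ (γ / q)}
    · rw [Set.indicator_of_mem (hmem.2 h1), Set.indicator_of_mem h1, hnorm,
        ← ENNReal.ofReal_mul (by positivity), ← Real.rpow_natCast, ← Real.rpow_add hR]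
      congr 2
      rw [Nat.cast_sub (NeZero.one_le (n := n))]; push_cast; ring
    · rw [Set.indicator_of_notMem (fun h2 => h1 (hmem.1 h2)), Set.indicator_of_notMem h1, mul_zero]
  simp only [e2]
  have htq : (ENNReal.ofReal t ^ q)⁻¹ ≠ ⊤ := by
    refine ENNReal.inv_ne_top.2 ?_
    rw [ENNReal.ofReal_rpow_of_pos ht]
    simpa using Real.rpow_pos_of_pos ht q
  rw [lintegral_const_mul' _ _ (ENNReal.mul_ne_top ENNReal.ofReal_ne_top htq), dirInt,
    div_eq_mul_inv]
  ring

theorem enorm_linMap_le (a : EuclideanSpace 𝕜 (Fin n)) (y : E n) :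
    ‖linMap a y‖ₑ ≤ n * ‖a‖ₑ * ‖y‖ₑ := by
  rw [linMap_apply]
  refine (enorm_sum_le _ _).trans ?_
  calc ∑ j, ‖y j • a j‖ₑ ≤ ∑ _j : Fin n, ‖a‖ₑ * ‖y‖ₑ := by
        refine Finset.sum_le_sum fun j _ => ?_
        rw [enorm_smul, mul_comm]
        gcongr
        · exact enorm_le_iff_norm_le.2 (PiLp.norm_apply_le _ _)
        · exact enorm_le_iff_norm_le.2 (PiLp.norm_apply_le _ _)
    _ = _ := by simp [mul_assoc]

theorem dirInt_ne_top {q : ℝ} (hq : 0 < q) (a : EuclideanSpace 𝕜 (Fin n)) : dirInt q a ≠ ⊤ := by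
  have h : dirInt q a ≤ ∫⁻ _w : Metric.sphere (0 : E n) 1, (n * ‖a‖ₑ) ^ q
      ∂(volume : Measure (E n)).toSphere := by
    refine lintegral_mono fun w => ?_
    have hw : ‖(w : E n)‖ₑ = 1 := by
      rw [← ofReal_norm]; simp
    gcongr
    simpa [hw] using enorm_linMap_le a (w : E n)
  refine (h.trans_lt ?_).ne
  rw [lintegral_const]
  exact ENNReal.mul_lt_top (ENNReal.rpow_lt_top_of_nonneg hq.le (by finiteness))
    (measure_lt_top _ _)

theorem linMap_real (a y : E n) : linMap (𝕜 := ℝ) a y = inner ℝ a y := by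
  rw [linMap_apply, PiLp.inner_apply]
  simp

theorem ofReal_kappa {q : ℝ} (hq : 0 < q) (e : E n) :
    ENNReal.ofReal (kappa q n e) = dirInt (𝕜 := ℝ) q e := by
  have hc : Continuous fun w : Metric.sphere (0 : E n) 1 => |inner ℝ e (w : E n)| ^ q := by
    refine Continuous.rpow_const (by fun_prop) (fun _ => Or.inr hq.le)
  rw [kappa, ofReal_integral_eq_lintegral_ofReal
    (hc.integrable_of_hasCompactSupport (HasCompactSupport.of_compactSpace _))
    (ae_of_all _ fun w => by positivity)]
  refine lintegral_congr fun w => ?_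
  rw [linMap_real, ← ofReal_norm, ENNReal.ofReal_rpow_of_nonneg (norm_nonneg _) hq.le,
    Real.norm_eq_abs]

theorem dirInt_smul {q : ℝ} (hq : 0 < q) (c : ℝ) (a : E n) :
    dirInt (𝕜 := ℝ) q (c • a) = ‖c‖ₑ ^ q * dirInt (𝕜 := ℝ) q a := by
  rw [dirInt, dirInt, ← lintegral_const_mul' _ _ (ENNReal.rpow_ne_top_of_nonneg hq.le enorm_ne_top)]
  refine lintegral_congr fun w => ?_
  rw [linMap_real, linMap_real, real_inner_smul_left, enorm_mul, ENNReal.mul_rpow_of_nonneg _ _ hq.le]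

/-- Rotation invariance is inherited from Lebesgue measure: the level integral of a linear function,
which equals the spherical integral when γ = t = 1, is invariant under the substitution y ↦ U y. -/
theorem dirInt_isometry {q : ℝ} (hq : 0 < q) (U : E n ≃ₗᵢ[ℝ] E n) (a : E n) :
    dirInt (𝕜 := ℝ) q (U a) = dirInt (𝕜 := ℝ) q a := by
  have h : levelInt 1 (1 / q) (linMap (𝕜 := ℝ) (U a)) 1 0 =
      levelInt 1 (1 / q) (linMap (𝕜 := ℝ) a) 1 0 := by
    have hm : Measurable fun y => (levelSet (linMap (𝕜 := ℝ) (U a)) 1 (1 / q)).indicator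
        (fun z => ENNReal.ofReal (‖z.1 - z.2‖ ^ ((1:ℝ) - n))) ((0 : E n), y) :=
      (Measurable.indicator (ENNReal.measurable_ofReal.comp
        ((measurable_fst.sub measurable_snd).norm.pow_const _))
        (measurableSet_levelSet (linMap (U a)).continuous.measurable _ _)).comp
          measurable_prodMk_left
    rw [levelInt, ← U.measurePreserving.lintegral_comp hm]
    refine lintegral_congr fun y => ?_
    have h1 : linMap (𝕜 := ℝ) (U a) (U y) = linMap (𝕜 := ℝ) a y := by
      rw [linMap_real, linMap_real, U.inner_map_map]
    simp only [Set.indicator, levelSet, Set.mem_ofPred_eq, map_zero, h1, zero_sub, norm_neg,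
      U.norm_map]
    have h2 : (0 : E n) ≠ U y ↔ (0 : E n) ≠ y := by
      rw [ne_comm, ne_comm (a := (0 : E n))]; simp
    simp only [h2]
  rw [levelInt_linMap one_ne_zero hq _ one_pos, levelInt_linMap one_ne_zero hq _ one_pos] at h
  simpa using h

/-- The vectors ‖a‖ e and a have equal length, so the reflection in the hyperplane orthogonal to
their difference carries one to the other. -/
theorem dirInt_real {q : ℝ} (hq : 0 < q) {e : E n} (he : ‖e‖ = 1) (a : E n) :
    dirInt (𝕜 := ℝ) q a = ‖a‖ₑ ^ q * ENNReal.ofReal (kappa q n e) := by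
  rw [ofReal_kappa hq]
  have h1 : ‖‖a‖ • e‖ = ‖a‖ := by rw [norm_smul, he, mul_one, norm_norm]
  have h2 := Submodule.reflection_sub h1
  have h3 := dirInt_isometry hq (Submodule.reflection (ℝ ∙ (‖a‖ • e - a))ᗮ) (‖a‖ • e)
  rw [h2, dirInt_smul hq, enorm_norm] at h3
  exact h3

/-- The integrand is continuous with value 1 at ω = e, and surface measure charges every nonempty
open set. -/
theorem dirInt_unit_ne_zero {q : ℝ} {e : E n} (he : ‖e‖ = 1) :
    dirInt (𝕜 := ℝ) q e ≠ 0 := by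
  intro h
  have hc : Continuous fun w : Metric.sphere (0 : E n) 1 => ‖linMap (𝕜 := ℝ) e (w : E n)‖ₑ ^ q :=
    (ENNReal.continuous_rpow_const).comp
      ((linMap (𝕜 := ℝ) e).continuous.comp continuous_subtype_val).enorm
  rw [dirInt, lintegral_eq_zero_iff hc.measurable] at h
  have h1 := congr_fun ((Continuous.ae_eq_iff_eq _ hc continuous_const).1 h) ⟨e, by simp [he]⟩
  simp only [linMap_real] at h1
  rw [real_inner_self_eq_norm_sq, he] at h1
  simp at h1

theorem dirInt_map_le {q : ℝ} (hq : 0 ≤ q) (L : 𝕜 →L[ℝ] ℝ) (hL : ∀ z, ‖L z‖ ≤ ‖z‖)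
    (a : EuclideanSpace 𝕜 (Fin n)) :
    dirInt (𝕜 := ℝ) q (WithLp.toLp 2 fun j => L (a j) : E n) ≤ dirInt q a := by
  refine lintegral_mono fun w => ?_
  have : linMap (𝕜 := ℝ) (WithLp.toLp 2 fun j => L (a j) : E n) (w : E n) =
      L (linMap a (w : E n)) := by
    rw [linMap_apply, linMap_apply, map_sum]
    simp
  rw [this]
  gcongr
  exact enorm_le_iff_norm_le.2 (hL _)

/-- For complex a the spherical integral depends on more than |a|, so only a comparison is
available. It follows from the exact real formula applied to the real and imaginary parts, since
taking either part decreases |a · ω|. -/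
theorem exists_enorm_rpow_le_dirInt (n : ℕ) [NeZero n] (𝕜 : Type*) [RCLike 𝕜] {q : ℝ} (hq : 0 < q) :
    ∃ C : ℝ≥0∞, C ≠ ⊤ ∧ ∀ a : EuclideanSpace 𝕜 (Fin n), ‖a‖ₑ ^ q ≤ C * dirInt q a := by
  obtain ⟨e, he⟩ := exists_norm_eq (E n) zero_le_one
  set κ := dirInt (𝕜 := ℝ) q e with hκ
  have hκ0 : κ ≠ 0 := dirInt_unit_ne_zero he
  have hκt : κ ≠ ⊤ := dirInt_ne_top hq e
  refine ⟨2 ^ q * 2 * κ⁻¹, ENNReal.mul_ne_top (by finiteness) (ENNReal.inv_ne_top.2 hκ0),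
    fun a => ?_⟩
  let re : E n := WithLp.toLp 2 fun j => RCLike.re (a j)
  let im : E n := WithLp.toLp 2 fun j => RCLike.im (a j)
  have h1 : ‖re‖ₑ ^ q ≤ κ⁻¹ * dirInt q a := by
    have h := dirInt_map_le hq.le (RCLike.reCLM (K := 𝕜)) (fun z => RCLike.norm_re_le_norm z) a
    rw [mul_comm, ← div_eq_mul_inv, ENNReal.le_div_iff_mul_le (Or.inl hκ0) (Or.inl hκt)]
    have h2 := dirInt_real hq he re
    rw [ofReal_kappa hq] at h2
    rw [← hκ] at h2
    rw [← h2]; exact h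
  have h2 : ‖im‖ₑ ^ q ≤ κ⁻¹ * dirInt q a := by
    have h := dirInt_map_le hq.le (RCLike.imCLM (K := 𝕜)) (fun z => RCLike.norm_im_le_norm z) a
    rw [mul_comm, ← div_eq_mul_inv, ENNReal.le_div_iff_mul_le (Or.inl hκ0) (Or.inl hκt)]
    have h2 := dirInt_real hq he im
    rw [ofReal_kappa hq] at h2
    rw [← hκ] at h2
    rw [← h2]; exact h
  have h3 : ‖a‖ₑ ≤ ‖re‖ₑ + ‖im‖ₑ := by
    rw [← ofReal_norm, ← ofReal_norm, ← ofReal_norm, ← ENNReal.ofReal_add (by positivity)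
      (by positivity)]
    apply ENNReal.ofReal_le_ofReal
    have e1 : ‖a‖ ^ 2 = ‖re‖ ^ 2 + ‖im‖ ^ 2 := by
      rw [EuclideanSpace.norm_sq_eq, EuclideanSpace.norm_sq_eq, EuclideanSpace.norm_sq_eq,
        ← Finset.sum_add_distrib]
      refine Finset.sum_congr rfl fun j _ => ?_
      simp only [re, im, Real.norm_eq_abs, sq_abs]
      rw [RCLike.norm_sq_eq_def]; ring
    refine abs_le_of_sq_le_sq' ?_ (by positivity) |>.2
    nlinarith [norm_nonneg re, norm_nonneg im]
  calc ‖a‖ₑ ^ q ≤ (2 * max ‖re‖ₑ ‖im‖ₑ) ^ q := by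
        gcongr
        refine h3.trans ?_
        rw [two_mul]
        exact add_le_add (le_max_left _ _) (le_max_right _ _)
    _ = 2 ^ q * max (‖re‖ₑ ^ q) (‖im‖ₑ ^ q) := by
        rw [ENNReal.mul_rpow_of_nonneg _ _ hq.le, (ENNReal.monotone_rpow_of_nonneg hq.le).map_max]
    _ ≤ 2 ^ q * (κ⁻¹ * dirInt q a + κ⁻¹ * dirInt q a) := by
        gcongr
        exact max_le (h1.trans le_self_add) (h2.trans le_self_add)
    _ = _ := by ring

end

/-! ### Pointwise limit of the level integral -/

section

variable {n : ℕ} [NeZero n] {𝕜 : Type*} [RCLike 𝕜]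

/-- If the quotient of u + v exceeds t₁ + t₂, then that of u exceeds t₁ or that of v exceeds t₂. -/
theorem levelInt_le_add {f u v : E n → 𝕜} (hu : Measurable u) (h : ∀ y, f y = u y + v y)
    (γ b t₁ t₂ : ℝ) (x : E n) :
    levelInt γ b f (t₁ + t₂) x ≤ levelInt γ b u t₁ x + levelInt γ b v t₂ x := by
  have hm : Measurable fun y => (levelSet u t₁ b).indicator
      (fun z => ENNReal.ofReal (‖z.1 - z.2‖ ^ (γ - n))) (x, y) :=
    (Measurable.indicator (ENNReal.measurable_ofReal.comp
      ((measurable_fst.sub measurable_snd).norm.pow_const _))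
      (measurableSet_levelSet hu _ _)).comp measurable_prodMk_left
  rw [levelInt, levelInt, levelInt, ← lintegral_add_left hm]
  refine lintegral_mono fun y => ?_
  by_cases hy : (x, y) ∈ levelSet f (t₁ + t₂) b
  · rw [Set.indicator_of_mem hy]
    have : (x, y) ∈ levelSet u t₁ b ∨ (x, y) ∈ levelSet v t₂ b := by
      by_contra hcon
      rw [not_or] at hcon
      have h1 : ‖u x - u y‖ / ‖x - y‖ ^ (1 + b) ≤ t₁ :=
        not_lt.1 fun h' => hcon.1 ⟨hy.1, h'⟩
      have h2 : ‖v x - v y‖ / ‖x - y‖ ^ (1 + b) ≤ t₂ :=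
        not_lt.1 fun h' => hcon.2 ⟨hy.1, h'⟩
      have h3 : t₁ + t₂ < ‖f x - f y‖ / ‖x - y‖ ^ (1 + b) := hy.2
      have h4 : ‖f x - f y‖ ≤ ‖u x - u y‖ + ‖v x - v y‖ := by
        rw [h, h, show u x + v x - (u y + v y) = (u x - u y) + (v x - v y) by ring]
        exact norm_add_le _ _
      have h5 : ‖f x - f y‖ / ‖x - y‖ ^ (1 + b) ≤
          ‖u x - u y‖ / ‖x - y‖ ^ (1 + b) + ‖v x - v y‖ / ‖x - y‖ ^ (1 + b) := by
        rw [← add_div]; gcongr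
      linarith
    rcases this with h | h
    · rw [Set.indicator_of_mem h]; exact le_self_add
    · rw [Set.indicator_of_mem h]; exact le_add_self
  · rw [Set.indicator_of_notMem hy]; exact zero_le

theorem levelInt_neg (f : E n → 𝕜) (γ b t : ℝ) (x : E n) :
    levelInt γ b (fun y => - f y) t x = levelInt γ b f t x := by
  have : levelSet (fun y => - f y) t b = levelSet f t b := by
    ext z
    simp only [levelSet, Set.mem_ofPred_eq]
    rw [show - f z.1 - - f z.2 = -(f z.1 - f z.2) by ring, norm_neg]
  rw [levelInt, levelInt, this]

/-- Dominated convergence in R: the integrand with T replaced by its bound N is integrable because q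
< r. -/
theorem tendsto_tailInt_zero {γ q r : ℝ} (hγ : γ ≠ 0) (hq : 0 < q) (hqr : q < r) {ε : ℝ}
    (hε : 0 < ε) {T : ℝ → ℝ≥0∞} (hT : Measurable T) {N : ℝ≥0∞} (hN : N ≠ ⊤)
    (hTN : ∀ R, 0 < R → T R ≤ N) (hT0 : Tendsto T (𝓝[>] 0) (𝓝 0)) :
    Tendsto (fun ρ => tailInt γ (γ / q) r ε (fun R => T (ρ * R))) (𝓝[>] 0) (𝓝 0) := by
  have hr : 0 < r := hq.trans hqr
  obtain ⟨C, hC, hCb⟩ := exists_tailInt_const_le hγ hq hqr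
  have hbound : tailInt γ (γ / q) r ε (fun _ => N) ≠ ⊤ := by
    refine ((hCb N ε hε).trans_lt (ENNReal.mul_lt_top hC.lt_top ?_)).ne
    refine ENNReal.rpow_lt_top_of_nonneg hq.le (ENNReal.div_ne_top hN ?_)
    simpa using hε
  have h := tendsto_lintegral_filter_of_dominated_convergence (l := 𝓝[>] (0:ℝ))
    (μ := volume.restrict (Set.Ioi (0:ℝ)))
    (F := fun ρ R => ENNReal.ofReal (R ^ (γ - 1)) *
      min 1 ((T (ρ * R) / ENNReal.ofReal (ε * R ^ (γ / q))) ^ r)) (f := fun _ => 0)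
    (fun R => ENNReal.ofReal (R ^ (γ - 1)) * min 1 ((N / ENNReal.ofReal (ε * R ^ (γ / q))) ^ r))
    (Eventually.of_forall fun ρ => by
      refine Measurable.mul (by fun_prop) (measurable_const.min (Measurable.pow_const ?_ r))
      exact (hT.comp (by fun_prop)).div (by fun_prop))
    (by
      filter_upwards [self_mem_nhdsWithin] with ρ hρ
      filter_upwards [ae_restrict_mem measurableSet_Ioi] with R hR
      gcongr
      exact hTN _ (mul_pos hρ hR))
    hbound
    (by
      filter_upwards [ae_restrict_mem measurableSet_Ioi] with R hR
      have hR : (0:ℝ) < R := hR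
      have h1 : Tendsto (fun ρ : ℝ => ρ * R) (𝓝[>] 0) (𝓝[>] 0) := by
        refine tendsto_nhdsWithin_iff.2 ⟨?_, ?_⟩
        · have : Tendsto (fun ρ : ℝ => ρ * R) (𝓝 0) (𝓝 (0 * R)) :=
            (continuous_id.mul continuous_const).tendsto 0
          rw [zero_mul] at this
          exact this.mono_left nhdsWithin_le_nhds
        · filter_upwards [self_mem_nhdsWithin] with ρ hρ using mul_pos hρ hR
      have h2 : Tendsto (fun ρ => T (ρ * R) / ENNReal.ofReal (ε * R ^ (γ / q))) (𝓝[>] 0) (𝓝 0) := by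
        have := ENNReal.Tendsto.div_const (hT0.comp h1) (b := ENNReal.ofReal (ε * R ^ (γ / q)))
          (Or.inr (by
            have : 0 < ε * R ^ (γ / q) := by positivity
            simpa using this))
        simpa using this
      have h3 : Tendsto (fun ρ => (T (ρ * R) / ENNReal.ofReal (ε * R ^ (γ / q))) ^ r) (𝓝[>] 0)
          (𝓝 0) := by
        have := (ENNReal.continuous_rpow_const (y := r)).tendsto 0 |>.comp h2
        rwa [ENNReal.zero_rpow_of_pos hr] at this
      have h4 : Tendsto (fun ρ => min 1 ((T (ρ * R) / ENNReal.ofReal (ε * R ^ (γ / q))) ^ r))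
          (𝓝[>] 0) (𝓝 0) := by
        have := (tendsto_const_nhds (x := (1:ℝ≥0∞))).min h3
        simpa using this
      have := ENNReal.Tendsto.const_mul (a := ENNReal.ofReal (R ^ (γ - 1))) h4
        (Or.inr ENNReal.ofReal_ne_top)
      simpa using this)
  simpa [tailInt] using h

theorem tendsto_dampedSup_zero {s : ℝ} (hs : 0 < s) {G : E n → ℝ≥0∞} {x : E n}
    (h : Tendsto (fun R => ballAvg (fun y => G y ^ s) x R) (𝓝[>] 0) (𝓝 0)) :
    Tendsto (dampedSup s G x) (𝓝[>] 0) (𝓝 0) := by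
  rw [ENNReal.tendsto_nhds_zero] at h ⊢
  intro ε hε
  have h1 := h (ε ^ s) (ENNReal.rpow_pos_of_nonneg hε hs.le)
  rw [eventually_nhdsWithin_iff, Metric.eventually_nhds_iff] at h1
  obtain ⟨δ, hδ, h1⟩ := h1
  rw [eventually_nhdsWithin_iff, Metric.eventually_nhds_iff]
  refine ⟨δ / 4, by positivity, fun R hR hR0 => iSup_le fun i => ?_⟩
  have hR0 : (0:ℝ) < R := hR0
  have hi : (2⁻¹ : ℝ) ^ i ≤ 1 := pow_le_one₀ (by norm_num) (by norm_num)
  have hc : ((2 : ℝ≥0∞) ^ (-(1 / 2) : ℝ)) ^ i ≤ 1 :=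
    pow_le_one₀ zero_le (ENNReal.rpow_lt_one_of_one_lt_of_neg (by norm_num) (by norm_num)).le
  have h2 : ballAvg (fun y => G y ^ s) x (4 * ((2⁻¹ : ℝ) ^ i * R)) ≤ ε ^ s := by
    refine h1 ?_ (show (0:ℝ) < _ by positivity)
    rw [Real.dist_eq, sub_zero, abs_of_pos hR0] at hR
    rw [Real.dist_eq, sub_zero, abs_of_pos (by positivity)]
    nlinarith
  calc _ ≤ 1 * (ε ^ s) ^ (1 / s) := by gcongr
    _ = ε := by rw [one_mul, one_div, ENNReal.rpow_rpow_inv hs.ne']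

theorem dampedSup_le_of_ballAvg_le {s : ℝ} (hs : 0 < s) {G : E n → ℝ≥0∞} {x : E n} {N : ℝ≥0∞}
    (h : ∀ R, 0 < R → ballAvg (fun y => G y ^ s) x R ≤ N) {R : ℝ} (hR : 0 < R) :
    dampedSup s G x R ≤ N ^ (1 / s) := by
  refine iSup_le fun i => ?_
  have hc : ((2 : ℝ≥0∞) ^ (-(1 / 2) : ℝ)) ^ i ≤ 1 :=
    pow_le_one₀ zero_le (ENNReal.rpow_lt_one_of_one_lt_of_neg (by norm_num) (by norm_num)).le
  calc _ ≤ 1 * N ^ (1 / s) := by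
        gcongr
        exact h _ (by positivity)
    _ = _ := one_mul _

/-- Points at which the level integral of `f` has a limit: mollifications converge to `f`, and
`x` is an `L^s` Lebesgue point of the gradient `g` with finite maximal function. -/
structure RegularPoint (s : ℝ) (f : E n → 𝕜) (g : E n → EuclideanSpace 𝕜 (Fin n)) (x : E n) :
    Prop where
  good : GoodPoint f x
  lebesgue : Tendsto (fun R => ballAvg (fun y => ‖g y - g x‖ₑ ^ s) x R) (𝓝[>] 0) (𝓝 0)
  bounded : ∃ N : ℝ≥0∞, N ≠ ⊤ ∧ ∀ R, 0 < R → ballAvg (fun y => ‖g y - g x‖ₑ ^ s) x R ≤ N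

/-- The remainder has gradient g - g(x). Rescaling by ρ = t^(-q/γ) gives t^q ρ^γ = 1 and t ρ^(γ/q) =
1, so the normalised quantity is bounded by a tail integral at the fixed level ε with T(ρR) in place
of T(R), and ρ → 0. -/
theorem RegularPoint.tendsto_levelInt_sub_linMap {γ q s r : ℝ} (hγ : γ ≠ 0) (hq : 0 < q)
    (hqr : q < r) (hs : 1 ≤ s) (hsr : s ≤ r) (hn : n * (1 / s - 1 / r) < 1)
    {f : E n → 𝕜} {g : E n → EuclideanSpace 𝕜 (Fin n)} (hfm : Measurable f) (hgm : Measurable g)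
    (hf : LocallyIntegrable f volume) (hg : IsWeakGradient f g) {x : E n}
    (hx : RegularPoint s f g x) {l : Filter ℝ} (hl0 : ∀ᶠ t in l, 0 < t)
    (hl : Tendsto (fun t : ℝ => t ^ (-(q / γ))) l (𝓝[>] 0)) {ε : ℝ} (hε : 0 < ε) :
    Tendsto (fun t => ENNReal.ofReal t ^ q *
      levelInt γ (γ / q) (fun y => f y - linMap (g x) y) (ε * t) x) l (𝓝 0) := by
  obtain ⟨C, hC, hb⟩ := exists_levelInt_le_tailInt n 𝕜 γ (γ / q) hs hsr hn
  obtain ⟨N, hN, hbd⟩ := hx.bounded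
  have hlin : Continuous (linMap (g x)) := (linMap (g x)).continuous
  have hT := (measurable_dampedSup (hgm.sub_const (g x)).enorm s).comp
    (measurable_prodMk_left (x := x) : Measurable (Prod.mk x))
  set T := dampedSup s (fun y => ‖g y - g x‖ₑ) x with hTdef
  have hs0 : 0 < s := by linarith
  have h0 := tendsto_tailInt_zero hγ hq hqr hε (T := T) hT
    (ENNReal.rpow_ne_top_of_nonneg (by positivity) hN : N ^ (1 / s) ≠ ⊤)
    (fun R hR => dampedSup_le_of_ballAvg_le hs0 hbd hR) (tendsto_dampedSup_zero hs0 hx.lebesgue)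
  have h1 := ENNReal.Tendsto.const_mul (a := C) (h0.comp hl) (Or.inr hC)
  rw [mul_zero] at h1
  refine tendsto_of_tendsto_of_tendsto_of_le_of_le' tendsto_const_nhds h1
    (Eventually.of_forall fun _ => zero_le) ?_
  filter_upwards [hl0] with t ht
  have h2 := hb (fun y => f y - linMap (g x) y) (fun y => g y - g x)
    (hfm.sub hlin.measurable) (hgm.sub_const _) (hf.sub hlin.locallyIntegrable)
    (hg.sub hf hlin.locallyIntegrable (isWeakGradient_linMap _)) x
    (hx.good.sub hf hlin.locallyIntegrable (goodPoint_of_continuous hlin x)) (ε * t) (by positivity)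
  set ρ := t ^ (-(q / γ)) with hρdef
  have hρ : 0 < ρ := by positivity
  rw [tailInt_scale _ _ _ hρ] at h2
  have e1 : ε * t * ρ ^ (γ / q) = ε := by
    rw [hρdef, ← Real.rpow_mul ht.le]
    have : -(q / γ) * (γ / q) = -1 := by field_simp
    rw [this, Real.rpow_neg_one]; field_simp
  have e2 : ENNReal.ofReal t ^ q * ENNReal.ofReal (ρ ^ γ) = 1 := by
    rw [hρdef, ← Real.rpow_mul ht.le, ENNReal.ofReal_rpow_of_pos ht,
      ← ENNReal.ofReal_mul (by positivity), ← Real.rpow_add ht]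
    have : q + -(q / γ) * γ = 0 := by field_simp; ring
    rw [this, Real.rpow_zero, ENNReal.ofReal_one]
  rw [e1] at h2
  calc _ ≤ ENNReal.ofReal t ^ q * (C * (ENNReal.ofReal (ρ ^ γ) *
        tailInt γ (γ / q) r ε (fun R => T (ρ * R)))) := by gcongr
    _ = (ENNReal.ofReal t ^ q * ENNReal.ofReal (ρ ^ γ)) *
        (C * tailInt γ (γ / q) r ε (fun R => T (ρ * R))) := by ring
    _ = _ := by rw [e2, one_mul]; rfl

/-- The level is shared between the linear part and the remainder: t = (1-ε)t + εt bounds f from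
above, and (1+ε)t = t + εt, with f and the linear part exchanged, bounds it from below. The
remainder vanishes in the limit for each fixed ε; only then ε → 0. -/
theorem RegularPoint.tendsto_levelInt {γ q s r : ℝ} (hγ : γ ≠ 0) (hq : 0 < q)
    (hqr : q < r) (hs : 1 ≤ s) (hsr : s ≤ r) (hn : n * (1 / s - 1 / r) < 1)
    {f : E n → 𝕜} {g : E n → EuclideanSpace 𝕜 (Fin n)} (hfm : Measurable f) (hgm : Measurable g)
    (hf : LocallyIntegrable f volume) (hg : IsWeakGradient f g) {x : E n}
    (hx : RegularPoint s f g x) {l : Filter ℝ} [l.NeBot] (hl0 : ∀ᶠ t in l, 0 < t)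
    (hl : Tendsto (fun t : ℝ => t ^ (-(q / γ))) l (𝓝[>] 0)) :
    Tendsto (fun t => ENNReal.ofReal t ^ q * levelInt γ (γ / q) f t x) l
      (𝓝 (ENNReal.ofReal |γ|⁻¹ * dirInt q (g x))) := by
  set Q := ENNReal.ofReal |γ|⁻¹ * dirInt q (g x) with hQ
  have hQt : Q ≠ ⊤ := ENNReal.mul_ne_top ENNReal.ofReal_ne_top (dirInt_ne_top hq _)
  set ℓ := linMap (g x)
  have hℓ : Measurable ℓ := ℓ.continuous.measurable
  set err : ℝ → ℝ → ℝ≥0∞ := fun ε t => ENNReal.ofReal t ^ q *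
      levelInt γ (γ / q) (fun y => f y - ℓ y) (ε * t) x
  have herr : ∀ ε, 0 < ε → Tendsto (err ε) l (𝓝 0) := fun ε hε =>
    hx.tendsto_levelInt_sub_linMap hγ hq hqr hs hsr hn hfm hgm hf hg hl0 hl hε
  have hlin : ∀ c t : ℝ, 0 < c → 0 < t →
      ENNReal.ofReal t ^ q * levelInt γ (γ / q) ℓ (c * t) x = Q / ENNReal.ofReal c ^ q := by
    intro c t hc ht
    have htq0 : ENNReal.ofReal t ^ q ≠ 0 := by
      rw [ENNReal.ofReal_rpow_of_pos ht]; simpa using Real.rpow_pos_of_pos ht q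
    have htqt : ENNReal.ofReal t ^ q ≠ ⊤ :=
      ENNReal.rpow_ne_top_of_nonneg hq.le ENNReal.ofReal_ne_top
    rw [levelInt_linMap hγ hq _ (mul_pos hc ht), ENNReal.ofReal_mul hc.le,
      ENNReal.mul_rpow_of_nonneg _ _ hq.le, ← hQ, div_eq_mul_inv, div_eq_mul_inv,
      ENNReal.mul_inv (Or.inr htqt) (Or.inr htq0)]
    calc _ = Q * (ENNReal.ofReal c ^ q)⁻¹ * (ENNReal.ofReal t ^ q * (ENNReal.ofReal t ^ q)⁻¹) := by
          ring
      _ = _ := by rw [ENNReal.mul_inv_cancel htq0 htqt, mul_one]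
  have hcont : ∀ c : ℝ → ℝ, Tendsto c (𝓝[>] 0) (𝓝 1) →
      Tendsto (fun ε => Q / ENNReal.ofReal (c ε) ^ q) (𝓝[>] 0) (𝓝 Q) := by
    intro c hc
    have h1 : Tendsto (fun ε => ENNReal.ofReal (c ε) ^ q) (𝓝[>] 0) (𝓝 1) := by
      have := ((ENNReal.continuous_rpow_const (y := q)).comp ENNReal.continuous_ofReal).tendsto 1
      simp only [Function.comp, ENNReal.ofReal_one, ENNReal.one_rpow] at this
      exact this.comp hc
    have := ENNReal.Tendsto.const_div h1 (a := Q) (Or.inr hQt)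
    simpa using this
  have hup : ∀ ε, 0 < ε → ε < 1 → limsup (fun t => ENNReal.ofReal t ^ q *
      levelInt γ (γ / q) f t x) l ≤ Q / ENNReal.ofReal (1 - ε) ^ q := by
    intro ε hε hε1
    have h1 : Tendsto (fun t => Q / ENNReal.ofReal (1 - ε) ^ q + err ε t) l
        (𝓝 (Q / ENNReal.ofReal (1 - ε) ^ q + 0)) := tendsto_const_nhds.add (herr ε hε)
    rw [add_zero] at h1
    rw [← h1.limsup_eq]
    refine limsup_le_limsup ?_
    filter_upwards [hl0] with t ht
    have h2 := levelInt_le_add (f := f) (u := ℓ) (v := fun y => f y - ℓ y) hℓ (fun y => by ring)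
      γ (γ / q) ((1 - ε) * t) (ε * t) x
    rw [show (1 - ε) * t + ε * t = t by ring] at h2
    refine (mul_le_mul_right h2 _).trans (le_of_eq ?_)
    rw [mul_add, hlin _ _ (by linarith) ht]
  have hlow : ∀ ε, 0 < ε → Q / ENNReal.ofReal (1 + ε) ^ q ≤
      liminf (fun t => ENNReal.ofReal t ^ q * levelInt γ (γ / q) f t x) l := by
    intro ε hε
    have hct : Q / ENNReal.ofReal (1 + ε) ^ q ≠ ⊤ := by
      refine ENNReal.div_ne_top hQt ?_
      rw [ENNReal.ofReal_rpow_of_pos (by linarith)]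
      simpa using Real.rpow_pos_of_pos (by linarith : 0 < 1 + ε) q
    have h1 : Tendsto (fun t => Q / ENNReal.ofReal (1 + ε) ^ q - err ε t) l
        (𝓝 (Q / ENNReal.ofReal (1 + ε) ^ q - 0)) :=
      ENNReal.Tendsto.sub tendsto_const_nhds (herr ε hε) (Or.inl hct)
    rw [tsub_zero] at h1
    rw [← h1.liminf_eq]
    refine liminf_le_liminf ?_
    filter_upwards [hl0] with t ht
    have h2 := levelInt_le_add (f := ℓ) (u := f) (v := fun y => -(f y - ℓ y)) hfm (fun y => by ring)
      γ (γ / q) t (ε * t) x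
    rw [levelInt_neg, show t + ε * t = (1 + ε) * t by ring] at h2
    rw [tsub_le_iff_right, ← hlin (1 + ε) t (by linarith) ht]
    refine (mul_le_mul_right h2 _).trans (le_of_eq ?_)
    rw [mul_add]
  have hz : Tendsto (fun ε : ℝ => ε) (𝓝[>] 0) (𝓝 0) := tendsto_id.mono_left nhdsWithin_le_nhds
  refine tendsto_of_le_liminf_of_limsup_le ?_ ?_
  · refine le_of_tendsto (hcont (fun ε => 1 + ε) (by simpa using hz.const_add 1)) ?_
    filter_upwards [self_mem_nhdsWithin] with ε hε using hlow ε hε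
  · refine ge_of_tendsto (hcont (fun ε => 1 - ε) (by simpa using hz.const_sub 1)) ?_
    filter_upwards [Ioo_mem_nhdsGT zero_lt_one] with ε hε using hup ε hε.1 hε.2

/-! ### Regular points have full measure -/

theorem closedBall_avg_eq (G : E n → ℝ≥0∞) (x : E n) (R : ℝ) :
    (∫⁻ y in Metric.closedBall x R, G y) / volume (Metric.closedBall x R) = ballAvg G x R := by
  have h : (Metric.closedBall x R : Set (E n)) =ᵐ[volume] Metric.ball x R := by
    refine (ae_eq_of_subset_of_measure_ge Metric.ball_subset_closedBall ?_
      Metric.isOpen_ball.measurableSet.nullMeasurableSet (measure_closedBall_lt_top).ne).symm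
    rw [Measure.addHaar_closedBall_eq_addHaar_ball]
  rw [ballAvg, setLIntegral_congr h, measure_congr h]

theorem ae_tendsto_ballAvg {u : E n → ℝ} (hu : LocallyIntegrable u volume) :
    ∀ᵐ x, Tendsto (fun R => ballAvg (fun y => ‖u y - u x‖ₑ) x R) (𝓝[>] 0) (𝓝 0) := by
  filter_upwards [(Besicovitch.vitaliFamily (volume : Measure (E n))).ae_tendsto_lintegral_enorm_sub_div
    hu] with x hx
  refine (hx.comp (Besicovitch.tendsto_filterAt volume x)).congr' ?_
  filter_upwards [self_mem_nhdsWithin] with R hR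
  exact closedBall_avg_eq _ x R

theorem locallyIntegrable_norm_sub_rpow {g : E n → EuclideanSpace 𝕜 (Fin n)} (hgm : Measurable g)
    {s p : ℝ} (hs : 1 ≤ s) (hsp : s ≤ p) (hg : ∫⁻ y, ‖g y‖ₑ ^ p ≠ ⊤)
    (c : EuclideanSpace 𝕜 (Fin n)) : LocallyIntegrable (fun y => ‖g y - c‖ ^ s) volume := by
  have hs0 : 0 < s := by linarith
  have hp0 : 0 < p := by linarith
  refine locallyIntegrable_iff.2 fun K hK => ⟨?_, ?_⟩
  · exact ((hgm.sub_const c).norm.pow_const s).aestronglyMeasurable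
  have hb : ∀ y, ‖‖g y - c‖ ^ s‖ₑ ≤ 2 ^ (s - 1) * (‖g y‖ₑ ^ p + (1 + ‖c‖ₑ ^ s)) := by
    intro y
    rw [Real.enorm_rpow_of_nonneg (norm_nonneg _) hs0.le, enorm_norm]
    calc ‖g y - c‖ₑ ^ s ≤ (‖g y‖ₑ + ‖c‖ₑ) ^ s := by gcongr; exact enorm_sub_le
      _ ≤ 2 ^ (s - 1) * (‖g y‖ₑ ^ s + ‖c‖ₑ ^ s) := ENNReal.rpow_add_le_mul_rpow_add_rpow _ _ hs
      _ ≤ 2 ^ (s - 1) * (‖g y‖ₑ ^ p + 1 + ‖c‖ₑ ^ s) := by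
          gcongr
          rcases le_total 1 ‖g y‖ₑ with h | h
          · exact (ENNReal.rpow_le_rpow_of_exponent_le h hsp).trans le_self_add
          · exact (ENNReal.rpow_le_one h hs0.le).trans le_add_self
      _ = _ := by rw [add_assoc]
  refine (lintegral_mono hb).trans_lt ?_
  rw [lintegral_const_mul' _ _ (by finiteness), lintegral_add_right _ measurable_const,
    setLIntegral_const]
  have h1 : ∫⁻ y in K, ‖g y‖ₑ ^ p < ⊤ := (setLIntegral_le_lintegral _ _).trans_lt hg.lt_top
  have h2 : volume K < ⊤ := hK.measure_lt_top
  have h3 : ‖c‖ₑ ^ s < ⊤ := ENNReal.rpow_lt_top_of_nonneg hs0.le enorm_ne_top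
  finiteness

/-- The endpoint s = p follows from the weak type bound at heights k + 1 → ∞, and s < p from the
maximal theorem in L^(p/s). -/
theorem ae_maxFun_lt_top {G : E n → ℝ≥0∞} (hG : Measurable G) {s p : ℝ} (hs : 1 ≤ s) (hsp : s ≤ p)
    (h : ∫⁻ y, G y ^ p ≠ ⊤) : ∀ᵐ x, maxFun (fun y => G y ^ s) x < ⊤ := by
  have hs0 : 0 < s := by linarith
  have hJ : Measurable fun y => G y ^ s := hG.pow_const s
  rcases hsp.eq_or_lt with rfl | hsp
  · obtain ⟨C, hC, hb⟩ := exists_measure_maxFun_le n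
    rw [ae_iff]
    have h1 : ∀ k : ℕ, volume {x | ¬ maxFun (fun y => G y ^ s) x < ⊤} ≤
        C / ENNReal.ofReal (k + 1) * ∫⁻ x, G x ^ s := by
      intro k
      refine (measure_mono fun x hx => ?_).trans (hb _ hJ (k + 1) (by positivity))
      have hx' : maxFun (fun y => G y ^ s) x = ⊤ := not_lt_top_iff.1 hx
      change ENNReal.ofReal (k + 1) < _
      rw [hx']; exact ENNReal.ofReal_lt_top
    have h2 : Tendsto (fun k : ℕ => C / ENNReal.ofReal (k + 1) * ∫⁻ x, G x ^ s) atTop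
        (𝓝 (0 * ∫⁻ x, G x ^ s)) := by
      refine ENNReal.Tendsto.mul_const ?_ (Or.inr h)
      have h3 : Tendsto (fun k : ℕ => ENNReal.ofReal ((k:ℝ) + 1)) atTop (𝓝 ⊤) :=
        ENNReal.tendsto_ofReal_atTop.comp
          (tendsto_atTop_add_const_right _ _ tendsto_natCast_atTop_atTop)
      have := ENNReal.Tendsto.const_div h3 (a := C) (Or.inr hC)
      simpa using this
    rw [zero_mul] at h2
    exact le_antisymm (ge_of_tendsto' h2 h1) zero_le
  · have hps : 1 < p / s := by rwa [lt_div_iff₀ hs0, one_mul]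
    obtain ⟨C, hC, hb⟩ := exists_lintegral_maxFun_rpow_le n hps
    have h1 := hb _ hJ
    have h2 : ∀ y, (G y ^ s) ^ (p / s) = G y ^ p := fun y => by
      rw [← ENNReal.rpow_mul]; congr 1; field_simp
    simp only [h2] at h1
    have h3 := ae_lt_top ((measurable_maxFun hJ).pow_const (p / s))
      (h1.trans_lt (ENNReal.mul_lt_top hC.lt_top h.lt_top)).ne
    filter_upwards [h3] with x hx
    by_contra hcon
    rw [not_lt_top_iff.1 hcon, ENNReal.top_rpow_of_pos (by linarith)] at hx
    exact lt_irrefl _ hx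

/-- For the L^s Lebesgue points, scalar differentiation is applied to |g - c|^s for all c in a
countable dense set at once, and g(x) is then approximated by such a c. Boundedness of the averages
comes from finiteness of the maximal function. -/
theorem ae_regularPoint {f : E n → 𝕜} {g : E n → EuclideanSpace 𝕜 (Fin n)} (hgm : Measurable g)
    (hf : LocallyIntegrable f volume) {s p : ℝ} (hs : 1 ≤ s) (hsp : s ≤ p)
    (hg : ∫⁻ y, ‖g y‖ₑ ^ p ≠ ⊤) : ∀ᵐ x, RegularPoint s f g x := by
  have hs0 : 0 < s := by linarith
  obtain ⟨D, hDc, hDd⟩ := TopologicalSpace.exists_countable_dense (EuclideanSpace 𝕜 (Fin n))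
  have hL : ∀ᵐ x, ∀ c ∈ D, Tendsto (fun R => ballAvg
      (fun y => ‖‖g y - c‖ ^ s - ‖g x - c‖ ^ s‖ₑ) x R) (𝓝[>] 0) (𝓝 0) :=
    (ae_ball_iff hDc).2 fun c _ =>
      ae_tendsto_ballAvg (locallyIntegrable_norm_sub_rpow hgm hs hsp hg c)
  filter_upwards [ae_goodPoint hf, hL, ae_maxFun_lt_top hgm.enorm hs hsp hg] with x h1 h2 h3
  have hadd : ∀ u v : ℝ≥0∞, (u + v) ^ s ≤ 2 ^ (s - 1) * (u ^ s + v ^ s) := fun u v =>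
    ENNReal.rpow_add_le_mul_rpow_add_rpow _ _ hs
  refine ⟨h1, ?_, ?_⟩
  · rw [ENNReal.tendsto_nhds_zero]
    intro ε hε
    set K : ℝ≥0∞ := 2 ^ (s - 1) with hK
    obtain ⟨δ, hδ, hδε⟩ : ∃ δ : ℝ≥0∞, 0 < δ ∧ K * (3 * δ) ≤ ε := by
      have ht : Tendsto (fun δ : ℝ≥0∞ => K * (3 * δ)) (𝓝[>] 0) (𝓝 0) := by
        have : Tendsto (fun δ : ℝ≥0∞ => K * (3 * δ)) (𝓝 0) (𝓝 (K * (3 * 0))) :=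
          ENNReal.Tendsto.const_mul (ENNReal.Tendsto.const_mul tendsto_id (Or.inr (by simp)))
            (Or.inr (by simp [hK]))
        rw [mul_zero, mul_zero] at this
        exact this.mono_left nhdsWithin_le_nhds
      obtain ⟨δ, hδ1, hδ2⟩ := ((ENNReal.tendsto_nhds_zero.1 ht ε hε).and self_mem_nhdsWithin).exists
      exact ⟨δ, hδ2, hδ1⟩
    obtain ⟨c, hcD, hc⟩ : ∃ c ∈ D, ‖g x - c‖ₑ ^ s < δ := by
      have hcont : Continuous fun c : EuclideanSpace 𝕜 (Fin n) => ‖g x - c‖ₑ ^ s :=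
        ENNReal.continuous_rpow_const.comp (by fun_prop)
      have hopen : IsOpen {c : EuclideanSpace 𝕜 (Fin n) | ‖g x - c‖ₑ ^ s < δ} :=
        isOpen_lt hcont continuous_const
      obtain ⟨c, hc1, hc2⟩ := hDd.inter_open_nonempty _ hopen ⟨g x, by simpa [hs0] using hδ⟩
      exact ⟨c, hc2, hc1⟩
    filter_upwards [ENNReal.tendsto_nhds_zero.1 (h2 c hcD) δ hδ, self_mem_nhdsWithin] with R hR hR0
    have hR0 : (0:ℝ) < R := hR0
    have hpt : ∀ y, ‖g y - g x‖ₑ ^ s ≤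
        K * ((δ + δ) + ‖‖g y - c‖ ^ s - ‖g x - c‖ ^ s‖ₑ) := by
      intro y
      have e1 : ‖g y - c‖ₑ ^ s ≤ ‖‖g y - c‖ ^ s - ‖g x - c‖ ^ s‖ₑ + ‖g x - c‖ₑ ^ s := by
        have e2 : ∀ z : EuclideanSpace 𝕜 (Fin n), ‖z‖ₑ ^ s = ‖‖z‖ ^ s‖ₑ := fun z => by
          rw [Real.enorm_rpow_of_nonneg (norm_nonneg _) hs0.le, enorm_norm]
        rw [e2, e2]
        refine le_trans (le_of_eq ?_) (enorm_add_le _ _)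
        congr 1; ring
      calc ‖g y - g x‖ₑ ^ s ≤ (‖g y - c‖ₑ + ‖g x - c‖ₑ) ^ s := by
            gcongr
            rw [show g y - g x = (g y - c) - (g x - c) by abel]
            exact enorm_sub_le
        _ ≤ K * (‖g y - c‖ₑ ^ s + ‖g x - c‖ₑ ^ s) := hadd _ _
        _ ≤ K * ((‖‖g y - c‖ ^ s - ‖g x - c‖ ^ s‖ₑ + δ) + δ) := by
            gcongr
            exact e1.trans (by gcongr)
        _ = _ := by ring
    have hmul : ∀ H : E n → ℝ≥0∞, ballAvg (fun y => K * H y) x R = K * ballAvg H x R := fun H => by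
      rw [ballAvg, lintegral_const_mul' _ _ (by simp [hK]), ballAvg, mul_div_assoc]
    calc ballAvg (fun y => ‖g y - g x‖ₑ ^ s) x R
        ≤ ballAvg (fun y => K * ((δ + δ) + ‖‖g y - c‖ ^ s - ‖g x - c‖ ^ s‖ₑ)) x R :=
          ballAvg_mono hpt x R
      _ = K * ((δ + δ) + ballAvg (fun y => ‖‖g y - c‖ ^ s - ‖g x - c‖ ^ s‖ₑ) x R) := by
          rw [hmul, ballAvg_add measurable_const, ballAvg_const x hR0]
      _ ≤ K * ((δ + δ) + δ) := by gcongr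
      _ = K * (3 * δ) := by ring
      _ ≤ ε := hδε
  · have hmul : ∀ (K : ℝ≥0∞) (H : E n → ℝ≥0∞) (R : ℝ), K ≠ ⊤ →
        ballAvg (fun y => K * H y) x R = K * ballAvg H x R := fun K H R hK => by
      rw [ballAvg, lintegral_const_mul' _ _ hK, ballAvg, mul_div_assoc]
    refine ⟨2 ^ (s - 1) * (‖g x‖ₑ ^ s + 2 ^ n * maxFun (fun y => ‖g y‖ₑ ^ s) x), ?_, fun R hR => ?_⟩
    · have : ‖g x‖ₑ ^ s < ⊤ := ENNReal.rpow_lt_top_of_nonneg hs0.le enorm_ne_top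
      finiteness
    · calc ballAvg (fun y => ‖g y - g x‖ₑ ^ s) x R
          ≤ ballAvg (fun y => 2 ^ (s - 1) * (‖g x‖ₑ ^ s + ‖g y‖ₑ ^ s)) x R := by
            refine ballAvg_mono (fun y => ?_) x R
            rw [add_comm]
            exact (ENNReal.rpow_le_rpow enorm_sub_le hs0.le).trans (hadd _ _)
        _ = 2 ^ (s - 1) * (‖g x‖ₑ ^ s + ballAvg (fun y => ‖g y‖ₑ ^ s) x R) := by
            rw [hmul _ _ _ (by finiteness), ballAvg_add measurable_const, ballAvg_const x hR]
        _ ≤ _ := by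
            gcongr
            exact ballAvg_le_maxFun _ x hR

end

/-! ### Domination of the level functional -/

/-- If `u t → v` almost everywhere and `u t ≤ D + w t` with `D` integrable and `∫ w t`
arbitrarily small, then `∫ u t → ∫ v`. -/
theorem tendsto_lintegral_of_dominated_add {α ι : Type*} [MeasurableSpace α] {μ : Measure α}
    {l : Filter ι} [l.IsCountablyGenerated] [l.NeBot] {u : ι → α → ℝ≥0∞} {v : α → ℝ≥0∞}
    (hu : ∀ t, Measurable (u t))
    (hlim : ∀ᵐ x ∂μ, Tendsto (fun t => u t x) l (𝓝 (v x)))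
    (hdom : ∀ ε : ℝ≥0∞, ε ≠ 0 → ∃ D : α → ℝ≥0∞, Measurable D ∧ ∫⁻ x, D x ∂μ ≠ ⊤ ∧
      ∀ᶠ t in l, ∃ w : α → ℝ≥0∞, (∀ᵐ x ∂μ, u t x ≤ D x + w x) ∧ ∫⁻ x, w x ∂μ ≤ ε) :
    Tendsto (fun t => ∫⁻ x, u t x ∂μ) l (𝓝 (∫⁻ x, v x ∂μ)) := by
  refine tendsto_of_le_liminf_of_limsup_le ?_ ?_
  -- Fatou's lemma alone gives the lower bound; domination matters only for the upper one.
  · calc ∫⁻ x, v x ∂μ = ∫⁻ x, liminf (fun t => u t x) l ∂μ :=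
          lintegral_congr_ae (by filter_upwards [hlim] with x hx using hx.liminf_eq.symm)
      _ ≤ _ := lintegral_liminf_le' fun t => (hu t).aemeasurable
  · refine ENNReal.le_of_forall_pos_le_add fun ε hε _ => ?_
    obtain ⟨D, hDm, hD, hw⟩ := hdom ε (by simpa using hε.ne')
    -- The truncation min(u, D) is dominated by D, and the excess of u over it is at most w.
    have hmin : Tendsto (fun t => ∫⁻ x, min (u t x) (D x) ∂μ) l
        (𝓝 (∫⁻ x, min (v x) (D x) ∂μ)) :=
      tendsto_lintegral_filter_of_dominated_convergence D
        (Eventually.of_forall fun t => (hu t).min hDm)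
        (Eventually.of_forall fun t => ae_of_all _ fun x => min_le_right _ _) hD
        (by filter_upwards [hlim] with x hx using hx.min tendsto_const_nhds)
    calc limsup (fun t => ∫⁻ x, u t x ∂μ) l
        ≤ limsup (fun t => ∫⁻ x, min (u t x) (D x) ∂μ + ε) l := by
          refine limsup_le_limsup ?_
          filter_upwards [hw] with t ⟨w, hw1, hw2⟩
          calc ∫⁻ x, u t x ∂μ ≤ ∫⁻ x, min (u t x) (D x) + w x ∂μ := by
                refine lintegral_mono_ae ?_
                filter_upwards [hw1] with x hx
                rcases le_total (u t x) (D x) with h | h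
                · rw [min_eq_left h]; exact le_self_add
                · rwa [min_eq_right h]
            _ = ∫⁻ x, min (u t x) (D x) ∂μ + ∫⁻ x, w x ∂μ :=
                lintegral_add_left ((hu t).min hDm) _
            _ ≤ _ := by gcongr
      _ = ∫⁻ x, min (v x) (D x) ∂μ + ε := (hmin.add tendsto_const_nhds).limsup_eq
      _ ≤ _ := by gcongr with x; exact min_le_left _ _

theorem exists_exponents {n : ℕ} {p q : ℝ} (hp : 1 < p)
    (h : n * (1 / p - 1 / q) < 1) :
    ∃ s r : ℝ, 1 ≤ s ∧ s < p ∧ q < r ∧ s ≤ r ∧ n * (1 / s - 1 / r) < 1 := by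
  have hp0 : 0 < p := by linarith
  -- The strict condition is open, so it survives the perturbation s = p - e, r = max(p, q) + e for
  -- small e > 0; the maximum secures both q < r and s ≤ r.
  have hm : n * (1 / p - 1 / max p q) < 1 := by
    rcases le_total p q with h' | h'
    · rwa [max_eq_right h']
    · rw [max_eq_left h', sub_self, mul_zero]; exact one_pos
  have hm0 : 0 < max p q := lt_max_of_lt_left hp0
  have hc : Tendsto (fun e : ℝ => n * (1 / (p - e) - 1 / (max p q + e))) (𝓝[>] 0)
      (𝓝 (n * (1 / (p - 0) - 1 / (max p q + 0)))) := by
    refine Tendsto.mono_left (ContinuousAt.tendsto ?_) nhdsWithin_le_nhds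
    have h1 : p - 0 ≠ 0 := by simpa using hp0.ne'
    have h2 : max p q + 0 ≠ 0 := by simpa using hm0.ne'
    fun_prop (disch := assumption)
  have h1 := hc.eventually_lt_const (by simpa using hm)
  have h2 : ∀ᶠ e : ℝ in 𝓝[>] 0, e < p - 1 :=
    (eventually_lt_nhds (by linarith)).filter_mono nhdsWithin_le_nhds
  obtain ⟨e, he1, he2, he3⟩ := (h1.and (h2.and self_mem_nhdsWithin)).exists
  have he3 : 0 < e := he3
  refine ⟨p - e, max p q + e, by linarith, by linarith, ?_, ?_, he1⟩
  · linarith [le_max_right p q]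
  · linarith [le_max_left p q]

/-! ### Bounds by the maximal function when p > 1. -/

section

variable {n : ℕ} [NeZero n] {𝕜 : Type*} [RCLike 𝕜]

/-- The normalised level integral `t^q ∫ 1_{E_t}(x, y) |x - y|^{γ - n} dy`. -/
noncomputable def levelFun (γ q : ℝ) (f : E n → 𝕜) (t : ℝ) (x : E n) : ℝ≥0∞ :=
  ENNReal.ofReal t ^ q * levelInt γ (γ / q) f t x

theorem measurable_levelFun {f : E n → 𝕜} (hf : Measurable f) (γ q t : ℝ) :
    Measurable (levelFun γ q f t) :=
  (measurable_levelInt hf _ _ _).const_mul _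

theorem exists_levelFun_le_maxFun (n : ℕ) [NeZero n] (𝕜 : Type*) [RCLike 𝕜] {γ q s r : ℝ}
    (hγ : γ ≠ 0) (hq : 0 < q) (hqr : q < r) (hs : 1 ≤ s) (hsr : s ≤ r)
    (hn : n * (1 / s - 1 / r) < 1) :
    ∃ C : ℝ≥0∞, C ≠ ⊤ ∧ ∀ (f : E n → 𝕜) (g : E n → EuclideanSpace 𝕜 (Fin n)), Measurable f →
      Measurable g → LocallyIntegrable f volume → IsWeakGradient f g → ∀ x, GoodPoint f x →
      ∀ t : ℝ, 0 < t → levelFun γ q f t x ≤ C * maxFun (fun y => ‖g y‖ₑ ^ s) x ^ (q / s) := by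
  obtain ⟨C₁, hC₁, h1⟩ := exists_levelInt_le_tailInt n 𝕜 γ (γ / q) hs hsr hn
  obtain ⟨C₂, hC₂, h2⟩ := exists_tailInt_const_le hγ hq hqr
  have hs0 : 0 < s := by linarith
  refine ⟨C₁ * C₂ * ((2 : ℝ≥0∞) ^ n) ^ (q / s), by finiteness, ?_⟩
  intro f g hfm hgm hf hg x hx t ht
  set K := (2 ^ n * maxFun (fun y => ‖g y‖ₑ ^ s) x) ^ (1 / s) with hK
  have ht0 : ENNReal.ofReal t ^ q ≠ 0 := by
    rw [Ne, ENNReal.rpow_eq_zero_iff]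
    simp [ht]
  have htt : ENNReal.ofReal t ^ q ≠ ⊤ := by finiteness
  calc levelFun γ q f t x
      ≤ ENNReal.ofReal t ^ q * (C₁ * tailInt γ (γ / q) r t (dampedSup s (fun y => ‖g y‖ₑ) x)) := by
        rw [levelFun]
        gcongr
        exact h1 f g hfm hgm hf hg x hx t ht
    _ ≤ ENNReal.ofReal t ^ q * (C₁ * (C₂ * (K / ENNReal.ofReal t) ^ q)) := by
        gcongr
        refine (tailInt_mono (hq.trans hqr).le fun R hR => ?_).trans (h2 K t ht)
        exact dampedSup_le_maxFun hs0 _ x hR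
    _ = C₁ * C₂ * K ^ q := by
        rw [ENNReal.div_rpow_of_nonneg _ _ hq.le]
        calc _ = C₁ * C₂ * (ENNReal.ofReal t ^ q * (K ^ q / ENNReal.ofReal t ^ q)) := by ring
          _ = _ := by rw [ENNReal.mul_div_cancel ht0 htt]
    _ = _ := by
        rw [hK, ← ENNReal.rpow_mul, one_div_mul_eq_div,
          ENNReal.mul_rpow_of_nonneg _ _ (by positivity)]
        ring

/-- The majorant D is independent of t, so it provides the uniform bound and the dominating function
at the same time. Its integrability uses s < p strictly. -/
theorem exists_levelFun_rpow_le_maxFun (n : ℕ) [NeZero n] (𝕜 : Type*) [RCLike 𝕜] {p γ q : ℝ}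
    (hp : 1 < p) (hγ : γ ≠ 0) (hq : 0 < q) (hn : n * (1 / p - 1 / q) < 1) :
    ∃ C : ℝ≥0∞, C ≠ ⊤ ∧ ∀ (f : E n → 𝕜) (g : E n → EuclideanSpace 𝕜 (Fin n)), Measurable f →
      Measurable g → LocallyIntegrable f volume → IsWeakGradient f g →
      ∃ D : E n → ℝ≥0∞, Measurable D ∧ ∫⁻ x, D x ≤ C * ∫⁻ x, ‖g x‖ₑ ^ p ∧
        ∀ t : ℝ, 0 < t → ∀ᵐ x, levelFun γ q f t x ^ (p / q) ≤ D x := by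
  obtain ⟨s, r, hs, hsp, hqr, hsr, hsr'⟩ := exists_exponents hp hn
  have hs0 : 0 < s := by linarith
  have hpq : 0 ≤ p / q := by positivity
  obtain ⟨C₁, hC₁, h1⟩ := exists_levelFun_le_maxFun n 𝕜 hγ hq hqr hs hsr hsr'
  obtain ⟨C₂, hC₂, h2⟩ := exists_lintegral_maxFun_rpow_le n (p := p / s) ((one_lt_div hs0).2 hsp)
  refine ⟨C₁ ^ (p / q) * C₂, by finiteness, fun f g hfm hgm hf hg => ?_⟩
  have hG : Measurable fun y => ‖g y‖ₑ ^ s := hgm.enorm.pow_const _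
  have hM : Measurable fun x => maxFun (fun y => ‖g y‖ₑ ^ s) x ^ (p / s) :=
    (measurable_maxFun hG).pow_const _
  refine ⟨fun x => C₁ ^ (p / q) * maxFun (fun y => ‖g y‖ₑ ^ s) x ^ (p / s), hM.const_mul _, ?_, ?_⟩
  · rw [lintegral_const_mul _ hM, mul_assoc]
    gcongr
    refine (h2 _ hG).trans (le_of_eq ?_)
    simp_rw [← ENNReal.rpow_mul, mul_div_cancel₀ p hs0.ne']
  · intro t ht
    filter_upwards [ae_goodPoint hf] with x hx
    calc _ ≤ (C₁ * maxFun (fun y => ‖g y‖ₑ ^ s) x ^ (q / s)) ^ (p / q) := by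
          gcongr
          exact h1 f g hfm hgm hf hg x hx t ht
      _ = _ := by
          rw [ENNReal.mul_rpow_of_nonneg _ _ hpq, ← ENNReal.rpow_mul]
          congr 2
          field_simp

end

/-! ### Weak-type bounds for tail integrals, positive exponent -/

/-- A substitute for the triangle inequality in L^e, for e on either side of 1: half of the
geometric decay is spent on making the weights summable, the other half on summing the integrals. -/
theorem exists_lintegral_tsum_rpow_le {a e : ℝ} (ha : a < 0) (he : 0 < e) :
    ∃ C : ℝ≥0∞, C ≠ ⊤ ∧ ∀ {α : Type} [MeasurableSpace α] (μ : Measure α) (F : ℕ → α → ℝ≥0∞)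
      (M : ℝ≥0∞), (∀ i, Measurable (F i)) →
      (∀ i, ∫⁻ x, F i x ^ e ∂μ ≤ ((2 : ℝ≥0∞) ^ a) ^ i * M) →
      ∫⁻ x, (∑' i, F i x) ^ e ∂μ ≤ C * M := by
  have h1 := tsum_two_rpow_ne_top (a := a / (2 * e)) (div_neg_of_neg_of_pos ha (by positivity))
  have h2 := tsum_two_rpow_ne_top (a := a / 2) (by linarith)
  refine ⟨(∑' i : ℕ, ((2 : ℝ≥0∞) ^ (a / (2 * e))) ^ i) ^ e * ∑' i : ℕ, ((2 : ℝ≥0∞) ^ (a / 2)) ^ i,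
    ENNReal.mul_ne_top (ENNReal.rpow_ne_top_of_nonneg he.le h1) h2, ?_⟩
  intro α _ μ F M hF hM
  have hw : ∀ i : ℕ, ((2 : ℝ≥0∞) ^ (a / (2 * e))) ^ i * ((2 : ℝ≥0∞) ^ (-(a / (2 * e)))) ^ i = 1 := by
    intro i
    rw [← mul_pow, two_rpow_mul, add_neg_cancel, ENNReal.rpow_zero, one_pow]
  have hm : ∀ i, Measurable fun x => (((2 : ℝ≥0∞) ^ (-(a / (2 * e)))) ^ i * F i x) ^ e :=
    fun i => ((hF i).const_mul _).pow_const _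
  calc ∫⁻ x, (∑' i, F i x) ^ e ∂μ
      = ∫⁻ x, (∑' i : ℕ, ((2 : ℝ≥0∞) ^ (a / (2 * e))) ^ i *
          (((2 : ℝ≥0∞) ^ (-(a / (2 * e)))) ^ i * F i x)) ^ e ∂μ := by
        simp_rw [← mul_assoc, hw, one_mul]
    _ ≤ ∫⁻ x, (∑' i : ℕ, ((2 : ℝ≥0∞) ^ (a / (2 * e))) ^ i) ^ e *
          ∑' i, (((2 : ℝ≥0∞) ^ (-(a / (2 * e)))) ^ i * F i x) ^ e ∂μ :=
        lintegral_mono fun x => tsum_mul_rpow_le _ _ he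
    _ = (∑' i : ℕ, ((2 : ℝ≥0∞) ^ (a / (2 * e))) ^ i) ^ e *
          ∑' i, ∫⁻ x, (((2 : ℝ≥0∞) ^ (-(a / (2 * e)))) ^ i * F i x) ^ e ∂μ := by
        rw [lintegral_const_mul _ (Measurable.tsum hm), lintegral_tsum fun i => (hm i).aemeasurable]
    _ ≤ (∑' i : ℕ, ((2 : ℝ≥0∞) ^ (a / (2 * e))) ^ i) ^ e *
          ∑' i : ℕ, ((2 : ℝ≥0∞) ^ (a / 2)) ^ i * M := by
        gcongr with i
        simp_rw [ENNReal.mul_rpow_of_nonneg _ _ he.le]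
        rw [lintegral_const_mul _ ((hF i).pow_const _)]
        refine (mul_le_mul_right (hM i) _).trans (le_of_eq ?_)
        rw [← mul_assoc]
        congr 1
        simp_rw [← ENNReal.rpow_natCast, ← ENNReal.rpow_mul]
        rw [two_rpow_mul]
        congr 1
        field_simp
        ring
    _ = _ := by rw [ENNReal.tsum_mul_right, mul_assoc]

/-- Dyadic layers: when 2^(-(m+1)) < a ≤ 2^(-m), the m-th summand alone suffices. This reduces the
tail integral to sets of radii on which an average exceeds a level. -/
theorem min_one_rpow_le_tsum {r : ℝ} (hr : 0 < r) (a : ℝ≥0∞) :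
    min 1 (a ^ r) ≤ ∑' m : ℕ, {c : ℝ≥0∞ | ENNReal.ofReal ((2⁻¹ : ℝ) ^ (m + 1)) < c}.indicator
      (fun _ => ((2 : ℝ≥0∞) ^ (-r)) ^ m) a := by
  rcases eq_or_ne a 0 with rfl | h0
  · simp [hr]
  rcases le_or_gt 1 a with h1 | h1
  · refine (min_le_left _ _).trans ?_
    refine le_trans ?_ (ENNReal.le_tsum 0)
    rw [Set.indicator_of_mem (show a ∈ {c : ℝ≥0∞ | ENNReal.ofReal ((2⁻¹ : ℝ) ^ (0 + 1)) < c} from ?_),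
      pow_zero]
    refine lt_of_lt_of_le ?_ h1
    rw [ENNReal.ofReal_lt_one]; norm_num
  · have hat : a ≠ ⊤ := h1.ne_top
    obtain ⟨m, hm1, hm2⟩ := exists_nat_pow_near_of_lt_one (ENNReal.toReal_pos h0 hat)
      (ENNReal.toReal_le_of_le_ofReal zero_le_one (by simpa using h1.le))
      (by norm_num : (0 : ℝ) < 2⁻¹) (by norm_num)
    refine (min_le_right _ _).trans ?_
    refine le_trans ?_ (ENNReal.le_tsum m)
    rw [Set.indicator_of_mem (show a ∈ {c : ℝ≥0∞ | ENNReal.ofReal ((2⁻¹ : ℝ) ^ (m + 1)) < c} from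
      (ENNReal.ofReal_lt_iff_lt_toReal (by positivity) hat).2 hm1)]
    have h2 : a ≤ ((2 : ℝ≥0∞) ^ (-1 : ℝ)) ^ m := by
      rw [← ENNReal.ofReal_toReal hat]
      refine (ENNReal.ofReal_le_ofReal hm2).trans (le_of_eq ?_)
      rw [ENNReal.ofReal_pow (by norm_num), ENNReal.ofReal_inv_of_pos (by norm_num),
        ENNReal.rpow_neg_one]
      simp
    calc a ^ r ≤ (((2 : ℝ≥0∞) ^ (-1 : ℝ)) ^ m) ^ r := by gcongr
      _ = _ := by
        simp_rw [← ENNReal.rpow_natCast, ← ENNReal.rpow_mul]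
        congr 1; ring

section

variable {n : ℕ} [NeZero n]

theorem measurable_tailInt {γ b r t : ℝ} {T : E n → ℝ → ℝ≥0∞}
    (hT : Measurable fun z : E n × ℝ => T z.1 z.2) :
    Measurable fun x => tailInt γ b r t (T x) := by
  have h : Measurable fun z : E n × ℝ => ENNReal.ofReal (z.2 ^ (γ - 1)) *
      min 1 ((T z.1 z.2 / ENNReal.ofReal (t * z.2 ^ b)) ^ r) := by
    refine Measurable.mul (by fun_prop) (measurable_const.min (Measurable.pow_const (hT.div ?_) _))
    fun_prop
  exact Measurable.lintegral_prod_right' h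

/-- The integral of `R^(γ-1)` over the radii `R` with average of `G` exceeding `τ R^b`. -/
noncomputable def crossInt (γ b : ℝ) (G : E n → ℝ≥0∞) (τ : ℝ) (x : E n) : ℝ≥0∞ :=
  ∫⁻ R in Set.Ioi (0 : ℝ), {R : ℝ | ENNReal.ofReal (τ * R ^ b) < ballAvg G x R}.indicator
    (fun R => ENNReal.ofReal (R ^ (γ - 1))) R

theorem measurable_crossInt {G : E n → ℝ≥0∞} (hG : Measurable G) (γ b τ : ℝ) :
    Measurable (crossInt γ b G τ) := by
  have hs : MeasurableSet {z : E n × ℝ | ENNReal.ofReal (τ * z.2 ^ b) < ballAvg G z.1 z.2} :=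
    measurableSet_lt (ENNReal.measurable_ofReal.comp ((measurable_snd.pow_const _).const_mul _))
      (measurable_ballAvg hG)
  exact Measurable.lintegral_prod_right' (Measurable.indicator
    (ENNReal.measurable_ofReal.comp (measurable_snd.pow_const (γ - 1))) hs)

/-- For γ > 0 the integral of R^(γ-1) over the crossing radii is at most a multiple of the γ-th
power of the largest one; its 1/q-th power is the supremum of R^(γ/q) from the covering estimate
with β = γ/q. -/
theorem exists_lintegral_crossInt_le (n : ℕ) [NeZero n] {γ q : ℝ} (hγ : 0 < γ) (hq : 0 < q) :
    ∃ C : ℝ≥0∞, C ≠ ⊤ ∧ ∀ (G : E n → ℝ≥0∞) (τ : ℝ), 0 < τ →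
      ∫⁻ x, crossInt γ (γ / q) G τ x ^ (1 / q) ≤ C / ENNReal.ofReal τ * ∫⁻ x, G x := by
  have hb : 0 < γ / q := by positivity
  obtain ⟨C, hC, h⟩ := exists_lintegral_iSup_rpow_le n hb.le
  set K := (ENNReal.ofReal γ⁻¹ * 2 ^ γ) ^ (1 / q) with hK
  have hKt : K ≠ ⊤ := by finiteness
  refine ⟨K * C, by finiteness, fun G τ hτ => ?_⟩
  set V : E n → ℝ≥0∞ := fun x => ⨆ R : ℝ, ⨆ _ : 0 < R ∧
    ENNReal.ofReal (τ * R ^ (γ / q)) < ballAvg G x R, ENNReal.ofReal (R ^ (γ / q)) with hV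
  calc _ ≤ ∫⁻ x, K * V x := by
        refine lintegral_mono fun x => ?_
        have h1 : crossInt γ (γ / q) G τ x ≤ ENNReal.ofReal γ⁻¹ * (2 * V x ^ (q / γ)) ^ γ := by
          rw [← lintegral_Ioi_lt_rpow hγ]
          refine setLIntegral_mono' measurableSet_Ioi fun R hR => ?_
          have hR : 0 < R := hR
          by_cases hmem : R ∈ {R : ℝ | ENNReal.ofReal (τ * R ^ (γ / q)) < ballAvg G x R}
          · have h2 : ENNReal.ofReal (R ^ (γ / q)) ≤ V x :=
              le_iSup₂_of_le (f := fun (R : ℝ) (_ : 0 < R ∧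
                ENNReal.ofReal (τ * R ^ (γ / q)) < ballAvg G x R) => ENNReal.ofReal (R ^ (γ / q)))
                R ⟨hR, hmem⟩ le_rfl
            have h3 : ENNReal.ofReal R ≤ V x ^ (q / γ) := by
              calc ENNReal.ofReal R = ENNReal.ofReal (R ^ (γ / q)) ^ (q / γ) := by
                    rw [ENNReal.ofReal_rpow_of_pos (by positivity), ← Real.rpow_mul hR.le,
                      div_mul_div_cancel₀ hq.ne', div_self hγ.ne', Real.rpow_one]
                _ ≤ _ := by gcongr
            -- The factor 2 produces the strict inequality required by the layer-cake formula.
            have h4 : ENNReal.ofReal R < 2 * V x ^ (q / γ) := by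
              refine lt_of_lt_of_le ?_ (mul_le_mul_right h3 2)
              rw [← ENNReal.ofReal_ofNat, ← ENNReal.ofReal_mul (by norm_num)]
              exact (ENNReal.ofReal_lt_ofReal_iff (by positivity)).2 (by linarith)
            rw [Set.indicator_of_mem hmem, Set.indicator_of_mem
              (show R ∈ {t : ℝ | ENNReal.ofReal t < 2 * V x ^ (q / γ)} from h4)]
          · rw [Set.indicator_of_notMem hmem]; exact zero_le
        calc _ ≤ (ENNReal.ofReal γ⁻¹ * (2 * V x ^ (q / γ)) ^ γ) ^ (1 / q) := by gcongr
          _ = _ := by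
            rw [ENNReal.mul_rpow_of_nonneg _ _ hγ.le, ← ENNReal.rpow_mul, div_mul_cancel₀ _ hγ.ne',
              ← mul_assoc, ENNReal.mul_rpow_of_nonneg _ _ (by positivity : 0 ≤ 1 / q),
              ← ENNReal.rpow_mul, mul_one_div_cancel hq.ne', ENNReal.rpow_one]
    _ = K * ∫⁻ x, V x := lintegral_const_mul' _ _ hKt
    _ ≤ K * (C / ENNReal.ofReal τ * ∫⁻ x, G x) := by gcongr; exact h G τ hτ
    _ = _ := by rw [mul_div_assoc, mul_assoc]

theorem tailInt_ballAvg_le_tsum {γ b r t : ℝ} (hr : 0 < r) (ht : 0 < t) {G : E n → ℝ≥0∞}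
    (hG : Measurable G) (x : E n) :
    tailInt γ b r t (ballAvg G x) ≤
      ∑' m : ℕ, ((2 : ℝ≥0∞) ^ (-r)) ^ m * crossInt γ b G (t * (2⁻¹ : ℝ) ^ (m + 1)) x := by
  have hA : Measurable (ballAvg G x) :=
    Measurable.of_uncurry_left (f := ballAvg G) (measurable_ballAvg hG)
  have hm : ∀ m : ℕ, Measurable fun R : ℝ => ((2 : ℝ≥0∞) ^ (-r)) ^ m *
      {R : ℝ | ENNReal.ofReal (t * (2⁻¹ : ℝ) ^ (m + 1) * R ^ b) < ballAvg G x R}.indicator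
        (fun R => ENNReal.ofReal (R ^ (γ - 1))) R := by
    intro m
    have h1 : MeasurableSet {R : ℝ |
        ENNReal.ofReal (t * (2⁻¹ : ℝ) ^ (m + 1) * R ^ b) < ballAvg G x R} :=
      measurableSet_lt (ENNReal.measurable_ofReal.comp ((measurable_id.pow_const b).const_mul _)) hA
    have h2 : Measurable fun R : ℝ => ENNReal.ofReal (R ^ (γ - 1)) := by fun_prop
    have h3 := (h2.indicator h1).const_mul (((2 : ℝ≥0∞) ^ (-r)) ^ m)
    exact h3
  have hc : ∀ m : ℕ, ((2 : ℝ≥0∞) ^ (-r)) ^ m ≠ ⊤ := fun m => by finiteness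
  simp_rw [crossInt, ← lintegral_const_mul' _ _ (hc _)]
  rw [← lintegral_tsum fun m => (hm m).aemeasurable, tailInt]
  refine setLIntegral_mono' measurableSet_Ioi fun R hR => ?_
  have hR : 0 < R := hR
  refine (mul_le_mul_right (min_one_rpow_le_tsum hr _) _).trans ?_
  rw [← ENNReal.tsum_mul_left]
  refine ENNReal.tsum_le_tsum fun m => ?_
  have h0 : 0 < t * R ^ b := by positivity
  by_cases h : ballAvg G x R / ENNReal.ofReal (t * R ^ b) ∈
      {c : ℝ≥0∞ | ENNReal.ofReal ((2⁻¹ : ℝ) ^ (m + 1)) < c}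
  · have h' : R ∈ {R : ℝ | ENNReal.ofReal (t * (2⁻¹ : ℝ) ^ (m + 1) * R ^ b) < ballAvg G x R} := by
      have h2 : ENNReal.ofReal ((2⁻¹ : ℝ) ^ (m + 1)) <
        ballAvg G x R / ENNReal.ofReal (t * R ^ b) := h
      rw [ENNReal.lt_div_iff_mul_lt (by simp [h0]) (by simp),
        ← ENNReal.ofReal_mul (by positivity)] at h2
      rw [Set.mem_ofPred_eq]
      convert h2 using 2
      ring
    rw [Set.indicator_of_mem h, Set.indicator_of_mem h', mul_comm]
  · rw [Set.indicator_of_notMem h, mul_zero]; exact zero_le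

/-- Lowering the level to t 2^(-(m+1)) costs a factor of order 2^m in the weak bound, while the m-th
layer carries the weight 2^(-rm/q) after taking the power 1/q; the product decays since r > q. -/
theorem exists_lintegral_tailInt_ballAvg_le (n : ℕ) [NeZero n] {γ q r : ℝ} (hγ : 0 < γ)
    (hq : 0 < q) (hqr : q < r) :
    ∃ C : ℝ≥0∞, C ≠ ⊤ ∧ ∀ (G : E n → ℝ≥0∞) (t : ℝ), Measurable G → 0 < t →
      ∫⁻ x, tailInt γ (γ / q) r t (ballAvg G x) ^ (1 / q) ≤ C / ENNReal.ofReal t * ∫⁻ x, G x := by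
  obtain ⟨C₁, hC₁, h1⟩ := exists_lintegral_crossInt_le n hγ hq
  have ha : 1 - r / q < 0 := by rw [sub_neg, one_lt_div hq]; exact hqr
  obtain ⟨C₂, hC₂, h2⟩ := exists_lintegral_tsum_rpow_le (e := 1 / q) ha (by positivity)
  refine ⟨C₂ * (2 * C₁), by finiteness, fun G t hG ht => ?_⟩
  calc _ ≤ ∫⁻ x, (∑' m : ℕ, ((2 : ℝ≥0∞) ^ (-r)) ^ m *
          crossInt γ (γ / q) G (t * (2⁻¹ : ℝ) ^ (m + 1)) x) ^ (1 / q) := by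
        gcongr with x
        exact tailInt_ballAvg_le_tsum (hq.trans hqr) ht hG x
    _ ≤ C₂ * (2 * C₁ / ENNReal.ofReal t * ∫⁻ x, G x) := by
        refine h2 volume _ _ (fun m => (measurable_crossInt hG _ _ _).const_mul _) fun m => ?_
        simp_rw [ENNReal.mul_rpow_of_nonneg _ _ (by positivity : 0 ≤ 1 / q)]
        rw [lintegral_const_mul _ ((measurable_crossInt hG _ _ _).pow_const _)]
        refine (mul_le_mul_right (h1 G _ (by positivity)) _).trans (le_of_eq ?_)
        have e1 : C₁ / ENNReal.ofReal (t * (2⁻¹ : ℝ) ^ (m + 1)) =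
            2 ^ m * (2 * C₁ / ENNReal.ofReal t) := by
          rw [ENNReal.ofReal_mul ht.le, ENNReal.ofReal_pow (by norm_num),
            ENNReal.ofReal_inv_of_pos (by norm_num), ENNReal.ofReal_ofNat, ENNReal.div_eq_inv_mul,
            ENNReal.mul_inv (by simp) (by simp), ENNReal.inv_pow, inv_inv, ENNReal.div_eq_inv_mul]
          ring
        have e2 : (((2 : ℝ≥0∞) ^ (-r)) ^ m) ^ (1 / q) * 2 ^ m = ((2 : ℝ≥0∞) ^ (1 - r / q)) ^ m := by
          simp_rw [← ENNReal.rpow_natCast, ← ENNReal.rpow_mul]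
          rw [two_rpow_mul]
          congr 1; ring
        rw [e1, ← e2]; ring
    _ = _ := by rw [mul_div_assoc, mul_div_assoc, mul_div_assoc]; ring

theorem tailInt_iSup_le {γ b r t : ℝ} (hr : 0 < r) {T : ℕ → ℝ → ℝ≥0∞}
    (hT : ∀ i, Measurable (T i)) :
    tailInt γ b r t (fun R => ⨆ i, T i R) ≤ ∑' i, tailInt γ b r t (T i) := by
  have hm : ∀ i, Measurable fun R : ℝ => ENNReal.ofReal (R ^ (γ - 1)) *
      min 1 ((T i R / ENNReal.ofReal (t * R ^ b)) ^ r) := fun i =>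
    Measurable.mul (by fun_prop) (measurable_const.min
      (Measurable.pow_const ((hT i).div (by fun_prop)) _))
  simp_rw [tailInt]
  rw [← lintegral_tsum fun i => (hm i).aemeasurable]
  refine lintegral_mono fun R => ?_
  rw [ENNReal.tsum_mul_left]
  gcongr
  rw [ENNReal.iSup_div, ← ENNReal.orderIsoRpow_apply r hr, OrderIso.map_iSup, inf_iSup_eq]
  exact iSup_le fun i => ENNReal.le_tsum (f := fun i =>
    min 1 ((T i R / ENNReal.ofReal (t * R ^ b)) ^ r)) i

theorem tailInt_ofReal_mul {γ b r t c : ℝ} (hc : 0 < c) (T : ℝ → ℝ≥0∞) :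
    tailInt γ b r t (fun R => ENNReal.ofReal c * T R) = tailInt γ b r (t / c) T := by
  rw [tailInt, tailInt]
  refine lintegral_congr fun R => ?_
  rw [div_mul_eq_mul_div, ENNReal.ofReal_div_of_pos hc]
  congr 3
  rw [ENNReal.div_eq_inv_mul, ENNReal.div_eq_inv_mul, ENNReal.div_eq_inv_mul,
    ENNReal.mul_inv (by simp) (by simp [hc]), inv_inv]
  ring

theorem ofReal_two_rpow (i : ℕ) :
    ENNReal.ofReal ((2 : ℝ) ^ (-(1 / 2) * i : ℝ)) = ((2 : ℝ≥0∞) ^ (-(1 / 2) : ℝ)) ^ i := by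
  rw [← ENNReal.ofReal_rpow_of_pos (by norm_num), ← ENNReal.rpow_natCast, ← ENNReal.rpow_mul,
    ENNReal.ofReal_ofNat]

theorem dampedSup_one (G : E n → ℝ≥0∞) (x : E n) :
    dampedSup 1 G x = fun R => ⨆ i : ℕ, ENNReal.ofReal ((2 : ℝ) ^ (-(1 / 2) * i : ℝ)) *
      ballAvg G x (4 * ((2⁻¹ : ℝ) ^ i * R)) := by
  funext R
  rw [dampedSup]
  simp only [ENNReal.rpow_one, one_div_one, ofReal_two_rpow]

theorem tailInt_damped_ballAvg (γ b r t : ℝ) (G : E n → ℝ≥0∞) (i : ℕ) (x : E n) :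
    tailInt γ b r t (fun R =>
      ENNReal.ofReal ((2 : ℝ) ^ (-(1 / 2) * i : ℝ)) * ballAvg G x (4 * ((2⁻¹ : ℝ) ^ i * R))) =
    ENNReal.ofReal ((2 ^ i / 4 : ℝ) ^ γ) * tailInt γ b r
      (t * (2 ^ i / 4 : ℝ) ^ b / (2 : ℝ) ^ (-(1 / 2) * i : ℝ)) (ballAvg G x) := by
  rw [tailInt_scale _ _ _ (by positivity : (0 : ℝ) < 2 ^ i / 4)]
  have : ∀ R : ℝ, 4 * ((2⁻¹ : ℝ) ^ i * (2 ^ i / 4 * R)) = R := fun R => by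
    rw [inv_pow]; field_simp
  simp_rw [this]
  rw [tailInt_ofReal_mul (by positivity)]

theorem ofReal_mul_div_ofReal {C : ℝ≥0∞} {t w κ : ℝ} (ht : 0 < t) (hw : 0 < w) (hk : 0 < κ) :
    ENNReal.ofReal w * (C / ENNReal.ofReal (t * w / κ)) =
      ENNReal.ofReal κ * (C / ENNReal.ofReal t) := by
  rw [ENNReal.div_eq_inv_mul, ENNReal.div_eq_inv_mul,
    ← ENNReal.ofReal_inv_of_pos (by positivity), ← ENNReal.ofReal_inv_of_pos ht,
    ← mul_assoc, ← mul_assoc, ← ENNReal.ofReal_mul hw.le, ← ENNReal.ofReal_mul hk.le]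
  congr 2
  field_simp

/-- The supremum over scales is bounded by a sum. Rescaling the i-th term to the radius R produces
the factor (2ⁱ/4)^(γ/q), which cancels against the change of level, so exactly the damping 2^(-i/2)
is left to sum. -/
theorem exists_lintegral_tailInt_dampedSup_le (n : ℕ) [NeZero n] {γ q r : ℝ} (hγ : 0 < γ)
    (hq : 0 < q) (hqr : q < r) :
    ∃ C : ℝ≥0∞, C ≠ ⊤ ∧ ∀ (G : E n → ℝ≥0∞) (t : ℝ), Measurable G → 0 < t →
      ∫⁻ x, tailInt γ (γ / q) r t (dampedSup 1 G x) ^ (1 / q) ≤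
        C / ENNReal.ofReal t * ∫⁻ x, G x := by
  obtain ⟨C₁, hC₁, h1⟩ := exists_lintegral_tailInt_ballAvg_le n hγ hq hqr
  obtain ⟨C₂, hC₂, h2⟩ := exists_lintegral_tsum_rpow_le (a := -(1 / 2)) (e := 1 / q)
    (by norm_num) (by positivity)
  refine ⟨C₂ * C₁, by finiteness, fun G t hG ht => ?_⟩
  have hm : ∀ i : ℕ, Measurable fun z : E n × ℝ => ENNReal.ofReal ((2 : ℝ) ^ (-(1 / 2) * i : ℝ)) *
      ballAvg G z.1 (4 * ((2⁻¹ : ℝ) ^ i * z.2)) := fun i =>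
    ((measurable_ballAvg hG).comp (by fun_prop :
      Measurable fun z : E n × ℝ => (z.1, 4 * ((2⁻¹ : ℝ) ^ i * z.2)))).const_mul _
  calc _ ≤ ∫⁻ x, (∑' i : ℕ, tailInt γ (γ / q) r t (fun R =>
          ENNReal.ofReal ((2 : ℝ) ^ (-(1 / 2) * i : ℝ)) *
            ballAvg G x (4 * ((2⁻¹ : ℝ) ^ i * R)))) ^ (1 / q) := by
        gcongr with x
        rw [dampedSup_one]
        exact tailInt_iSup_le (hq.trans hqr) fun i =>
          Measurable.of_uncurry_left (f := fun x R =>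
            ENNReal.ofReal ((2 : ℝ) ^ (-(1 / 2) * i : ℝ)) *
              ballAvg G x (4 * ((2⁻¹ : ℝ) ^ i * R))) (hm i)
    _ ≤ C₂ * (C₁ / ENNReal.ofReal t * ∫⁻ x, G x) := by
        refine h2 volume _ _ (fun i => measurable_tailInt (hm i)) fun i => ?_
        have h4 : (0 : ℝ) < 2 ^ i / 4 := by positivity
        have hw : (0 : ℝ) < (2 ^ i / 4 : ℝ) ^ (γ / q) := Real.rpow_pos_of_pos h4 _
        have hk : (0 : ℝ) < (2 : ℝ) ^ (-(1 / 2) * i : ℝ) := Real.rpow_pos_of_pos two_pos _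
        have e1 : ENNReal.ofReal ((2 ^ i / 4 : ℝ) ^ γ) ^ (1 / q) =
            ENNReal.ofReal ((2 ^ i / 4 : ℝ) ^ (γ / q)) := by
          rw [ENNReal.ofReal_rpow_of_pos (Real.rpow_pos_of_pos h4 _), ← Real.rpow_mul h4.le,
            mul_one_div]
        simp_rw [tailInt_damped_ballAvg, ENNReal.mul_rpow_of_nonneg _ _ (one_div_nonneg.2 hq.le)]
        rw [lintegral_const_mul' _ _ (by rw [e1]; exact ENNReal.ofReal_ne_top), e1]
        refine (mul_le_mul_right (h1 G _ hG (div_pos (mul_pos ht hw) hk)) _).trans (le_of_eq ?_)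
        rw [← mul_assoc, ofReal_mul_div_ofReal ht hw hk, ofReal_two_rpow, mul_assoc]
    _ = _ := by rw [mul_div_assoc, mul_assoc]

end

/-! ### Domination for integrable gradients, positive exponent -/

theorem add_rpow_le_two_rpow_mul {e : ℝ} (he : 0 ≤ e) (a b : ℝ≥0∞) :
    (a + b) ^ e ≤ 2 ^ e * (a ^ e + b ^ e) := by
  have key : ∀ a b : ℝ≥0∞, a ≤ b → (a + b) ^ e ≤ 2 ^ e * b ^ e := fun a b h => by
    rw [← ENNReal.mul_rpow_of_nonneg _ _ he, two_mul]
    gcongr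
  rcases le_total a b with h | h
  · exact (key a b h).trans (mul_le_mul_right le_add_self _)
  · rw [add_comm a b]
    exact (key b a h).trans (mul_le_mul_right le_self_add _)

theorem exists_exponent_gt {n : ℕ} {p q : ℝ} (hp : 1 ≤ p) (h : n * (1 / p - 1 / q) < 1) :
    ∃ r : ℝ, q < r ∧ p ≤ r ∧ n * (1 / p - 1 / r) < 1 := by
  have hp0 : 0 < p := by linarith
  have hm : n * (1 / p - 1 / max p q) < 1 := by
    rcases le_total p q with h' | h'
    · rwa [max_eq_right h']
    · rw [max_eq_left h', sub_self, mul_zero]; exact one_pos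
  have hm0 : 0 < max p q := lt_max_of_lt_left hp0
  have hc : Tendsto (fun e : ℝ => n * (1 / p - 1 / (max p q + e))) (𝓝[>] 0)
      (𝓝 (n * (1 / p - 1 / (max p q + 0)))) := by
    refine Tendsto.mono_left (ContinuousAt.tendsto ?_) nhdsWithin_le_nhds
    have h2 : max p q + 0 ≠ 0 := by simpa using hm0.ne'
    fun_prop (disch := assumption)
  obtain ⟨e, he1, he2⟩ := ((hc.eventually_lt_const (by simpa using hm)).and
    self_mem_nhdsWithin).exists
  have he2 : 0 < e := he2
  exact ⟨max p q + e, by linarith [le_max_right p q], by linarith [le_max_left p q], he1⟩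

theorem min_one_rpow_add_div_le {r : ℝ} (hr : 0 ≤ r) (a b c : ℝ≥0∞) :
    min 1 (((a + b) / c) ^ r) ≤ 2 ^ r * (min 1 ((a / c) ^ r) + min 1 ((b / c) ^ r)) := by
  have h2 : (1 : ℝ≥0∞) ≤ 2 ^ r := by
    simpa using ENNReal.rpow_le_rpow_of_exponent_le (x := 2) (by norm_num) hr
  rw [ENNReal.add_div]
  generalize a / c = a
  generalize b / c = b
  rcases le_total 1 (a ^ r) with h | h
  · rw [min_eq_left h]
    calc _ ≤ (1 : ℝ≥0∞) * (1 + 0) := by rw [add_zero, one_mul]; exact min_le_left _ _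
      _ ≤ _ := by gcongr; exact zero_le
  rcases le_total 1 (b ^ r) with h' | h'
  · rw [min_eq_left h']
    calc _ ≤ (1 : ℝ≥0∞) * (0 + 1) := by rw [zero_add, one_mul]; exact min_le_left _ _
      _ ≤ _ := by gcongr; exact zero_le
  · rw [min_eq_right h, min_eq_right h']
    exact (min_le_right _ _).trans (add_rpow_le_two_rpow_mul hr a b)

theorem tailInt_add_le {γ b r t : ℝ} (hr : 0 ≤ r) {T S : ℝ → ℝ≥0∞} (hT : Measurable T) :
    tailInt γ b r t (fun R => T R + S R) ≤ 2 ^ r * (tailInt γ b r t T + tailInt γ b r t S) := by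
  have hm : Measurable fun R : ℝ => ENNReal.ofReal (R ^ (γ - 1)) *
      min 1 ((T R / ENNReal.ofReal (t * R ^ b)) ^ r) :=
    Measurable.mul (by fun_prop) (measurable_const.min
      (Measurable.pow_const (hT.div (by fun_prop)) _))
  rw [tailInt, tailInt, tailInt, ← lintegral_add_left hm,
    ← lintegral_const_mul' _ _ (by finiteness)]
  refine lintegral_mono fun R => ?_
  rw [← mul_add, mul_left_comm]
  gcongr
  exact min_one_rpow_add_div_le hr _ _ _

/-- When T(R) ≤ R^b, the minimum at level 1 is always attained by the power, and powers scale
exactly like t^(-r). -/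
theorem tailInt_le_of_le_rpow {γ b r t : ℝ} (hr : 0 ≤ r) (ht : 0 < t) {T : ℝ → ℝ≥0∞}
    (hT : ∀ R, 0 < R → T R ≤ ENNReal.ofReal (R ^ b)) :
    tailInt γ b r t T ≤ ENNReal.ofReal (t ^ (-r)) * tailInt γ b r 1 T := by
  rw [tailInt, tailInt, ← lintegral_const_mul' _ _ ENNReal.ofReal_ne_top]
  refine setLIntegral_mono' measurableSet_Ioi fun R hR => ?_
  have hR : 0 < R := hR
  have hRb : 0 < R ^ b := by positivity
  rw [one_mul, min_eq_right (a := 1) (b := (T R / ENNReal.ofReal (R ^ b)) ^ r)]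
  · rw [mul_left_comm]
    gcongr
    refine (min_le_right _ _).trans (le_of_eq ?_)
    rw [ENNReal.ofReal_mul ht.le, Real.rpow_neg ht.le, ENNReal.ofReal_inv_of_pos (by positivity),
      ← ENNReal.ofReal_rpow_of_pos ht, ← ENNReal.inv_rpow, ← ENNReal.mul_rpow_of_nonneg _ _ hr,
      ENNReal.div_eq_inv_mul, ENNReal.div_eq_inv_mul, ENNReal.mul_inv (by simp) (by simp), mul_assoc]
  · calc _ ≤ (1 : ℝ≥0∞) ^ r := by
          gcongr
          exact ENNReal.div_le_of_le_mul (by rw [one_mul]; exact hT R hR)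
      _ = 1 := ENNReal.one_rpow _

section

variable {n : ℕ} [NeZero n] {𝕜 : Type*} [RCLike 𝕜]

/-- The set on which `G ≤ K` and `‖x‖ ≤ K`. -/
def coreSet (G : E n → ℝ≥0∞) (K : ℝ) : Set (E n) :=
  {x | G x ≤ ENNReal.ofReal K ∧ ‖x‖ ≤ K}

theorem measurableSet_coreSet {G : E n → ℝ≥0∞} (hG : Measurable G) (K : ℝ) :
    MeasurableSet (coreSet G K) :=
  (measurableSet_le hG measurable_const).inter (measurableSet_le measurable_norm measurable_const)

theorem exists_lintegral_coreSet_compl_le {G : E n → ℝ≥0∞} (hG : Measurable G)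
    (hfin : ∫⁻ x, G x ≠ ⊤) {ε : ℝ≥0∞} (hε : ε ≠ 0) :
    ∃ K : ℝ, 0 < K ∧ ∫⁻ x, (coreSet G K)ᶜ.indicator G x ≤ ε := by
  have h : Tendsto (fun k : ℕ => ∫⁻ x, (coreSet G k)ᶜ.indicator G x) atTop
      (𝓝 (∫⁻ _ : E n, 0)) := by
    refine tendsto_lintegral_of_dominated_convergence G
      (fun k => hG.indicator (measurableSet_coreSet hG _).compl)
      (fun k => ae_of_all _ fun x => Set.indicator_le_self _ _ _) hfin ?_
    filter_upwards [ae_lt_top hG hfin] with x hx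
    refine tendsto_const_nhds.congr' ?_
    filter_upwards [eventually_ge_atTop ⌈max (G x).toReal ‖x‖⌉₊] with k hk
    have hk' : max (G x).toReal ‖x‖ ≤ k := Nat.ceil_le.1 hk
    rw [Set.indicator_of_notMem]
    rw [Set.notMem_compl_iff]
    refine ⟨?_, (le_max_right _ _).trans hk'⟩
    rw [← ENNReal.ofReal_toReal hx.ne]
    exact ENNReal.ofReal_le_ofReal ((le_max_left _ _).trans hk')
  rw [lintegral_zero] at h
  obtain ⟨k, hk1, hk2⟩ := ((h.eventually_le_const (pos_iff_ne_zero.2 hε)).and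
    (eventually_gt_atTop 0)).exists
  exact ⟨k, by exact_mod_cast hk2, hk1⟩

theorem dampedSup_one_add_le {G H : E n → ℝ≥0∞} (hG : Measurable G) (x : E n) (R : ℝ) :
    dampedSup 1 (fun y => G y + H y) x R ≤ dampedSup 1 G x R + dampedSup 1 H x R := by
  simp only [dampedSup, ENNReal.rpow_one, one_div_one]
  refine iSup_le fun i => ?_
  rw [ballAvg_add hG, mul_add]
  gcongr
  · exact le_iSup (fun i : ℕ => ((2 : ℝ≥0∞) ^ (-(1 / 2) : ℝ)) ^ i *
      ballAvg G x (4 * ((2⁻¹ : ℝ) ^ i * R))) i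
  · exact le_iSup (fun i : ℕ => ((2 : ℝ≥0∞) ^ (-(1 / 2) : ℝ)) ^ i *
      ballAvg H x (4 * ((2⁻¹ : ℝ) ^ i * R))) i

theorem ballAvg_core_le (G : E n → ℝ≥0∞) (K : ℝ) (x : E n) {R : ℝ} (hR : 0 < R) :
    ballAvg ((coreSet G K).indicator G) x R ≤ ENNReal.ofReal K := by
  rw [← ballAvg_const (c := ENNReal.ofReal K) x hR]
  refine ballAvg_mono (fun y => ?_) _ _
  by_cases hy : y ∈ coreSet G K
  · rw [Set.indicator_of_mem hy]; exact hy.1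
  · rw [Set.indicator_of_notMem hy]; exact zero_le

theorem ballAvg_core_eq_zero {G : E n → ℝ≥0∞} {K : ℝ} {x : E n} {R : ℝ}
    (hx : K + R ≤ ‖x‖) : ballAvg ((coreSet G K).indicator G) x R = 0 := by
  rw [ballAvg, setLIntegral_congr_fun (g := fun _ => 0) measurableSet_ball]
  · simp
  · intro y hy
    refine Set.indicator_of_notMem (fun hc => ?_) _
    have h1 : ‖y‖ ≤ K := hc.2
    have h2 : ‖x - y‖ < R := by rw [← dist_eq_norm, dist_comm]; exact hy
    linarith [norm_sub_norm_le x y]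

theorem dampedSup_core_le (G : E n → ℝ≥0∞) (K : ℝ) (x : E n) {R : ℝ} (hR : 0 < R) :
    dampedSup 1 ((coreSet G K).indicator G) x R ≤ ENNReal.ofReal K := by
  have h := dampedSup_le_of_ballAvg_le (s := 1) one_pos (G := (coreSet G K).indicator G) (x := x)
    (N := ENNReal.ofReal K) (fun R hR => by
      simp only [ENNReal.rpow_one]
      exact ballAvg_core_le G K x hR) hR
  simpa using h

/-- Only balls of radius at most 4R about x are involved, and these miss the core. -/
theorem dampedSup_core_eq_zero {G : E n → ℝ≥0∞} {K : ℝ} {x : E n} {R : ℝ} (hR : 0 < R)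
    (hx : K + 4 * R ≤ ‖x‖) : dampedSup 1 ((coreSet G K).indicator G) x R = 0 := by
  simp only [dampedSup, ENNReal.rpow_one]
  rw [ENNReal.iSup_eq_zero]
  intro i
  rw [ballAvg_core_eq_zero]
  · simp
  · have : (2⁻¹ : ℝ) ^ i ≤ 1 := pow_le_one₀ (by norm_num) (by norm_num)
    nlinarith

theorem exists_levelFun_le_tailInt (n : ℕ) [NeZero n] (𝕜 : Type*) [RCLike 𝕜] {γ q r : ℝ}
    (hq : 0 < q) (hr : 1 ≤ r) (hn : n * (1 / 1 - 1 / r) < 1) :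
    ∃ C : ℝ≥0∞, C ≠ ⊤ ∧ ∀ (f : E n → 𝕜) (g : E n → EuclideanSpace 𝕜 (Fin n)), Measurable f →
      Measurable g → LocallyIntegrable f volume → IsWeakGradient f g → ∀ t : ℝ, 0 < t →
      ∀ᵐ x, levelFun γ q f t x ^ (1 / q) ≤ C * (ENNReal.ofReal t *
        tailInt γ (γ / q) r t (dampedSup 1 (fun y => ‖g y‖ₑ) x) ^ (1 / q)) := by
  obtain ⟨C, hC, h⟩ := exists_levelInt_le_tailInt n 𝕜 γ (γ / q) le_rfl hr hn
  have hq' : 0 ≤ 1 / q := by positivity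
  refine ⟨C ^ (1 / q), by finiteness, fun f g hfm hgm hf hg t ht => ?_⟩
  filter_upwards [ae_goodPoint hf] with x hx
  calc levelFun γ q f t x ^ (1 / q) ≤ (ENNReal.ofReal t ^ q *
        (C * tailInt γ (γ / q) r t (dampedSup 1 (fun y => ‖g y‖ₑ) x))) ^ (1 / q) := by
        rw [levelFun]
        gcongr
        exact h f g hfm hgm hf hg x hx t ht
    _ = _ := by
        rw [ENNReal.mul_rpow_of_nonneg _ _ hq', ENNReal.mul_rpow_of_nonneg _ _ hq',
          ← ENNReal.rpow_mul, mul_one_div_cancel hq.ne', ENNReal.rpow_one]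
        ring

theorem exists_lintegral_levelFun_le_of_pos (n : ℕ) [NeZero n] (𝕜 : Type*) [RCLike 𝕜] {γ q : ℝ}
    (hγ : 0 < γ) (hq : 0 < q) (hn : n * (1 / 1 - 1 / q) < 1) :
    ∃ C : ℝ≥0∞, C ≠ ⊤ ∧ ∀ (f : E n → 𝕜) (g : E n → EuclideanSpace 𝕜 (Fin n)), Measurable f →
      Measurable g → LocallyIntegrable f volume → IsWeakGradient f g → ∀ t : ℝ, 0 < t →
      ∫⁻ x, levelFun γ q f t x ^ (1 / q) ≤ C * ∫⁻ x, ‖g x‖ₑ := by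
  obtain ⟨r, hqr, hr, hnr⟩ := exists_exponent_gt le_rfl hn
  obtain ⟨C₀, hC₀, h0⟩ := exists_levelFun_le_tailInt n 𝕜 (γ := γ) hq hr hnr
  obtain ⟨C₂, hC₂, h2⟩ := exists_lintegral_tailInt_dampedSup_le n hγ hq hqr
  refine ⟨C₀ * C₂, by finiteness, fun f g hfm hgm hf hg t ht => ?_⟩
  calc _ ≤ ∫⁻ x, C₀ * (ENNReal.ofReal t *
        tailInt γ (γ / q) r t (dampedSup 1 (fun y => ‖g y‖ₑ) x) ^ (1 / q)) :=
        lintegral_mono_ae (h0 f g hfm hgm hf hg t ht)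
    _ = C₀ * (ENNReal.ofReal t *
        ∫⁻ x, tailInt γ (γ / q) r t (dampedSup 1 (fun y => ‖g y‖ₑ) x) ^ (1 / q)) := by
        rw [lintegral_const_mul' _ _ hC₀, lintegral_const_mul' _ _ ENNReal.ofReal_ne_top]
    _ ≤ C₀ * (ENNReal.ofReal t * (C₂ / ENNReal.ofReal t * ∫⁻ x, ‖g x‖ₑ)) := by
        gcongr
        exact h2 _ t hgm.enorm ht
    _ = C₀ * (ENNReal.ofReal t * (C₂ / ENNReal.ofReal t)) * ∫⁻ x, ‖g x‖ₑ := by ring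
    _ = _ := by rw [ENNReal.mul_div_cancel (by simpa using ht) ENNReal.ofReal_ne_top]

theorem exists_mul_le_half {M ε : ℝ≥0∞} (hM : M ≠ ⊤) (hε : ε ≠ 0) :
    ∃ δ : ℝ≥0∞, δ ≠ 0 ∧ M * δ ≤ ε / 2 := by
  refine ⟨ε / 2 / (M + 1), ?_, ?_⟩
  · rw [Ne, ENNReal.div_eq_zero_iff, not_or]
    exact ⟨by simpa using hε, by finiteness⟩
  · calc M * (ε / 2 / (M + 1)) ≤ (M + 1) * (ε / 2 / (M + 1)) := by gcongr; exact le_self_add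
      _ = ε / 2 := ENNReal.mul_div_cancel (by simp) (by finiteness)

/-- The gradient is split into a bounded core of bounded support and a remainder of small L¹ norm.
The remainder is handled by the weak-type bound uniformly in t. The core contributes a constant on a
fixed ball; outside that ball its contribution is at most t^(1-r/q) times a fixed integrable
function, which tends to 0 as t → ∞ because r > q. -/
theorem exists_levelFun_le_add_of_pos {γ q : ℝ} (hγ : 0 < γ) (hq : 0 < q)
    (hn : n * (1 / 1 - 1 / q) < 1) {f : E n → 𝕜} {g : E n → EuclideanSpace 𝕜 (Fin n)}
    (hfm : Measurable f) (hgm : Measurable g) (hf : LocallyIntegrable f volume)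
    (hg : IsWeakGradient f g) (hfin : ∫⁻ x, ‖g x‖ₑ ≠ ⊤) {ε : ℝ≥0∞} (hε : ε ≠ 0) :
    ∃ D : E n → ℝ≥0∞, Measurable D ∧ ∫⁻ x, D x ≠ ⊤ ∧ ∀ᶠ t in atTop, ∃ w : E n → ℝ≥0∞,
      (∀ᵐ x, levelFun γ q f t x ^ (1 / q) ≤ D x + w x) ∧ ∫⁻ x, w x ≤ ε := by
  obtain ⟨r, hqr, hr, hnr⟩ := exists_exponent_gt le_rfl hn
  have hr0 : 0 < r := by linarith
  have hq' : 0 ≤ 1 / q := by positivity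
  have hb : 0 < γ / q := by positivity
  obtain ⟨C₀, hC₀, h0⟩ := exists_levelFun_le_tailInt n 𝕜 (γ := γ) hq hr hnr
  obtain ⟨C₁, hC₁, h1⟩ := exists_tailInt_const_le hγ.ne' hq hqr
  obtain ⟨C₂, hC₂, h2⟩ := exists_lintegral_tailInt_dampedSup_le n hγ hq hqr
  set C₃ : ℝ≥0∞ := C₀ * (2 ^ (1 / q) * (2 ^ r) ^ (1 / q)) with hC₃
  have hC₃t : C₃ ≠ ⊤ := by finiteness
  obtain ⟨δ, hδ, hδε⟩ := exists_mul_le_half (M := C₃ * C₂) (by finiteness) hε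
  set G : E n → ℝ≥0∞ := fun y => ‖g y‖ₑ with hG
  have hGm : Measurable G := hgm.enorm
  obtain ⟨K, hK, hKδ⟩ := exists_lintegral_coreSet_compl_le hGm hfin hδ
  set G₁ := (coreSet G K).indicator G with hG₁
  set G₂ := (coreSet G K)ᶜ.indicator G with hG₂
  have hG₁m : Measurable G₁ := hGm.indicator (measurableSet_coreSet hGm K)
  have hG₂m : Measurable G₂ := hGm.indicator (measurableSet_coreSet hGm K).compl
  have hsum : G = fun y => G₁ y + G₂ y := (Set.indicator_self_add_compl (coreSet G K) G).symm
  have hG₁t : ∫⁻ x, G₁ x ≠ ⊤ :=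
    ne_top_of_le_ne_top hfin (lintegral_mono fun x => Set.indicator_le_self _ _ _)
  set W : (E n → ℝ≥0∞) → ℝ → E n → ℝ≥0∞ :=
    fun G t x => tailInt γ (γ / q) r t (dampedSup 1 G x) ^ (1 / q) with hW
  have hWm : ∀ G, Measurable G → ∀ t, Measurable (W G t) := fun G hG t =>
    (measurable_tailInt (measurable_dampedSup hG 1)).pow_const _
  -- At R₀ the threshold R^(γ/q) equals the bound K of the core. Beyond norm K + 4R₀, only radii R ≥
  -- R₀ can reach the core, and there K ≤ R^(γ/q).
  set R₀ := K ^ (q / γ) with hR₀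
  have hR₀0 : 0 < R₀ := by positivity
  have hR₀K : R₀ ^ (γ / q) = K := by
    rw [hR₀, ← Real.rpow_mul hK.le, div_mul_div_cancel₀ hγ.ne', div_self hq.ne', Real.rpow_one]
  set ρ := K + 4 * R₀ with hρ
  have hsplit : ∀ t x, W G t x ≤ 2 ^ (1 / q) * (2 ^ r) ^ (1 / q) * (W G₁ t x + W G₂ t x) := by
    intro t x
    have hT : Measurable (dampedSup 1 G₁ x) :=
      Measurable.of_uncurry_left (f := dampedSup 1 G₁) (measurable_dampedSup hG₁m 1)
    have h3 : tailInt γ (γ / q) r t (dampedSup 1 G x) ≤ 2 ^ r *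
        (tailInt γ (γ / q) r t (dampedSup 1 G₁ x) + tailInt γ (γ / q) r t (dampedSup 1 G₂ x)) := by
      refine le_trans (tailInt_mono hr0.le fun R _ => ?_) (tailInt_add_le hr0.le hT)
      rw [hsum]
      exact dampedSup_one_add_le hG₁m x R
    calc W G t x ≤ _ := ENNReal.rpow_le_rpow h3 hq'
      _ ≤ _ := by
        rw [ENNReal.mul_rpow_of_nonneg _ _ hq', mul_comm (2 ^ (1 / q) : ℝ≥0∞), mul_assoc]
        gcongr
        exact add_rpow_le_two_rpow_mul hq' _ _
  have hball : ∀ t, 0 < t → ∀ x, ENNReal.ofReal t * W G₁ t x ≤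
      C₁ ^ (1 / q) * ENNReal.ofReal K := by
    intro t ht x
    have h4 : tailInt γ (γ / q) r t (dampedSup 1 G₁ x) ≤
        C₁ * (ENNReal.ofReal K / ENNReal.ofReal t) ^ q :=
      (tailInt_mono hr0.le fun R hR => dampedSup_core_le G K x hR).trans (h1 _ t ht)
    calc _ ≤ ENNReal.ofReal t * (C₁ * (ENNReal.ofReal K / ENNReal.ofReal t) ^ q) ^ (1 / q) := by
          gcongr
          exact ENNReal.rpow_le_rpow h4 hq'
      _ = C₁ ^ (1 / q) * (ENNReal.ofReal t * (ENNReal.ofReal K / ENNReal.ofReal t)) := by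
          rw [ENNReal.mul_rpow_of_nonneg _ _ hq', ← ENNReal.rpow_mul, mul_one_div_cancel hq.ne',
            ENNReal.rpow_one]
          ring
      _ = _ := by rw [ENNReal.mul_div_cancel (by simpa using ht) ENNReal.ofReal_ne_top]
  have htail : ∀ t, 0 < t → ∀ x, x ∉ Metric.ball (0 : E n) ρ → ENNReal.ofReal t * W G₁ t x ≤
      ENNReal.ofReal (t ^ (1 - r / q)) * W G₁ 1 x := by
    intro t ht x hx
    have hx : ρ ≤ ‖x‖ := by simpa using hx
    have h5 : ∀ R, 0 < R → dampedSup 1 G₁ x R ≤ ENNReal.ofReal (R ^ (γ / q)) := by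
      intro R hR
      rcases lt_or_ge R R₀ with h | h
      · rw [dampedSup_core_eq_zero hR (by linarith)]; exact zero_le
      · refine (dampedSup_core_le G K x hR).trans (ENNReal.ofReal_le_ofReal ?_)
        rw [← hR₀K]
        gcongr
    calc _ ≤ ENNReal.ofReal t * (ENNReal.ofReal (t ^ (-r)) *
          tailInt γ (γ / q) r 1 (dampedSup 1 G₁ x)) ^ (1 / q) := by
          gcongr
          exact ENNReal.rpow_le_rpow (tailInt_le_of_le_rpow hr0.le ht h5) hq'
      _ = _ := by
          rw [ENNReal.mul_rpow_of_nonneg _ _ hq', ← mul_assoc,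
            ENNReal.ofReal_rpow_of_pos (by positivity), ← ENNReal.ofReal_mul ht.le,
            ← Real.rpow_mul ht.le]
          congr 2
          rw [sub_eq_add_neg, Real.rpow_add ht, Real.rpow_one]
          congr 2
          ring
  refine ⟨(Metric.ball (0 : E n) ρ).indicator fun _ => C₃ * (C₁ ^ (1 / q) * ENNReal.ofReal K),
    measurable_const.indicator measurableSet_ball, ?_, ?_⟩
  · rw [lintegral_indicator_const measurableSet_ball]
    have := volume_ball_ne_top (0 : E n) ρ
    finiteness
  have hlim : Tendsto (fun t : ℝ => C₃ * (ENNReal.ofReal (t ^ (1 - r / q)) * (C₂ * ∫⁻ x, G₁ x)))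
      atTop (𝓝 (C₃ * (ENNReal.ofReal 0 * (C₂ * ∫⁻ x, G₁ x)))) := by
    refine ENNReal.Tendsto.const_mul (ENNReal.Tendsto.mul_const ?_ (Or.inr (by finiteness)))
      (Or.inr hC₃t)
    refine ENNReal.tendsto_ofReal ?_
    have h6 : 0 < r / q - 1 := by rw [sub_pos, one_lt_div hq]; exact hqr
    simpa using tendsto_rpow_neg_atTop h6
  rw [ENNReal.ofReal_zero, zero_mul, mul_zero] at hlim
  filter_upwards [hlim.eventually_le_const (ENNReal.half_pos hε), eventually_gt_atTop 0]
    with t ht1 ht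
  refine ⟨fun x => C₃ * (ENNReal.ofReal (t ^ (1 - r / q)) * W G₁ 1 x +
    ENNReal.ofReal t * W G₂ t x), ?_, ?_⟩
  · filter_upwards [h0 f g hfm hgm hf hg t ht] with x hx
    have h7 : levelFun γ q f t x ^ (1 / q) ≤
        C₃ * (ENNReal.ofReal t * W G₁ t x) + C₃ * (ENNReal.ofReal t * W G₂ t x) := by
      refine hx.trans ((mul_le_mul_right (mul_le_mul_right (hsplit t x) _) _).trans (le_of_eq ?_))
      rw [hC₃]; ring
    by_cases hxb : x ∈ Metric.ball (0 : E n) ρ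
    · rw [Set.indicator_of_mem hxb]
      exact h7.trans (add_le_add (mul_le_mul_right (hball t ht x) _)
        (mul_le_mul_right le_add_self _))
    · rw [Set.indicator_of_notMem hxb, zero_add, mul_add]
      exact h7.trans (add_le_add (mul_le_mul_right (htail t ht x hxb) _) le_rfl)
  · rw [lintegral_const_mul' _ _ hC₃t,
      lintegral_add_left ((hWm G₁ hG₁m 1).const_mul _), lintegral_const_mul' _ _ ENNReal.ofReal_ne_top,
      lintegral_const_mul' _ _ ENNReal.ofReal_ne_top, mul_add, ← ENNReal.add_halves ε]
    gcongr
    · refine le_trans ?_ ht1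
      gcongr
      have h8 := h2 G₁ 1 hG₁m one_pos
      rwa [ENNReal.ofReal_one, div_one] at h8
    · refine le_trans ?_ hδε
      calc _ ≤ C₃ * (ENNReal.ofReal t * (C₂ / ENNReal.ofReal t * δ)) := by
            gcongr
            exact (h2 G₂ t hG₂m ht).trans (by gcongr)
        _ = C₃ * (ENNReal.ofReal t * (C₂ / ENNReal.ofReal t)) * δ := by ring
        _ = _ := by rw [ENNReal.mul_div_cancel (by simpa using ht) ENNReal.ofReal_ne_top]

end

/-! ### The one-dimensional difference estimate -/

section

variable {𝕜 : Type*} [RCLike 𝕜]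

theorem lintegral_enorm_bump {n : ℕ} [NeZero n] (r : Set.Ioi (0 : ℝ)) :
    ∫⁻ z, ‖(bump n r).normed volume z‖ₑ = 1 := by
  have h0 := (bump n r).nonneg_normed (μ := volume)
  simp_rw [Real.enorm_eq_ofReal (h0 _)]
  rw [← ofReal_integral_eq_lintegral_ofReal (bump n r).integrable_normed (ae_of_all _ h0),
    (bump n r).integral_normed, ENNReal.ofReal_one]

theorem bump_normed_eq_zero {n : ℕ} [NeZero n] (r : Set.Ioi (0 : ℝ)) {z : E n} (hz : (r : ℝ) ≤ ‖z‖) :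
    (bump n r).normed volume z = 0 := by
  by_contra h
  have h' : z ∈ Function.support ((bump n r).normed volume) := h
  rw [ContDiffBump.support_normed_eq, mem_ball_zero_iff] at h'
  exact absurd h' (not_lt.2 hz)

/-- The fundamental theorem of calculus for the mollification, followed by Tonelli: the bump has
total mass 1, and it vanishes unless t lies within r of the segment joining the points. -/
theorem enorm_mollify_sub_le_lintegral_ball (r : Set.Ioi (0 : ℝ)) {f : E 1 → 𝕜}
    {g : E 1 → EuclideanSpace 𝕜 (Fin 1)} (hgm : Measurable g) (hf : LocallyIntegrable f volume)
    (hg : IsWeakGradient f g) (x y : E 1) :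
    ‖mollify r f x - mollify r f y‖ₑ ≤ ∫⁻ t in Metric.ball x (‖x - y‖ + r), ‖g t‖ₑ := by
  let ι : ℝ ≃ₗᵢ[ℝ] E 1 := (OrthonormalBasis.singleton (Fin 1) ℝ).repr
  have hι : MeasurePreserving ι := (OrthonormalBasis.singleton (Fin 1) ℝ).measurePreserving_repr
  obtain ⟨a, rfl⟩ := ι.surjective x
  obtain ⟨b, rfl⟩ := ι.surjective y
  have hsm : ContDiff ℝ 1 (mollify r f) := by
    have h := (bump 1 r).hasCompactSupport_normed (μ := volume)
    exact h.contDiff_convolution_left (n := 1) _ (bump 1 r).contDiff_normed hf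
  set F' : ℝ → 𝕜 := fun s => fderiv ℝ (mollify r f) (ι s) (ι 1) with hF'
  have hder : ∀ s, HasDerivAt (fun s => mollify r f (ι s)) (F' s) s := by
    intro s
    have h1 : HasDerivAt (fun s : ℝ => ι s) (ι 1) s := by
      simpa using (ι.toContinuousLinearEquiv : ℝ →L[ℝ] E 1).hasDerivAt (x := s)
    exact ((hsm.differentiable one_ne_zero (ι s)).hasFDerivAt).comp_hasDerivAt s h1
  have hcont : Continuous F' :=
    ((hsm.continuous_fderiv one_ne_zero).comp ι.continuous).clm_apply continuous_const
  have hftc := intervalIntegral.integral_eq_sub_of_hasDerivAt (a := b) (b := a)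
    (fun s _ => hder s) (hcont.intervalIntegrable _ _)
  have hF'le : ∀ s, ‖F' s‖ₑ ≤ ∫⁻ t, ‖(bump 1 r).normed volume (ι s - t)‖ₑ * ‖g t‖ₑ := by
    intro s
    obtain ⟨D, hD, hDv⟩ := enorm_mollify_fderiv_le r hf hg (ι s)
    have h2 := hDv (ι 1)
    rw [← hD.fderiv] at h2
    have h3 : ‖ι 1‖ₑ = 1 := by
      rw [← ofReal_norm, ι.norm_map]; simp
    simpa [h3] using h2
  have hKm : Measurable fun z : ℝ × E 1 =>
      ‖(bump 1 r).normed volume (ι z.1 - z.2)‖ₑ * ‖g z.2‖ₑ := by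
    refine Measurable.mul ?_ (hgm.enorm.comp measurable_snd)
    exact ((bump 1 r).continuous_normed.measurable.comp
      ((ι.continuous.measurable.comp measurable_fst).sub measurable_snd)).enorm
  have hsw : ∫⁻ s in Set.uIoc b a, ∫⁻ t, ‖(bump 1 r).normed volume (ι s - t)‖ₑ * ‖g t‖ₑ =
      ∫⁻ t, ∫⁻ s in Set.uIoc b a, ‖(bump 1 r).normed volume (ι s - t)‖ₑ * ‖g t‖ₑ :=
    lintegral_lintegral_swap (μ := volume.restrict (Set.uIoc b a)) (ν := volume)
      (f := fun s t => ‖(bump 1 r).normed volume (ι s - t)‖ₑ * ‖g t‖ₑ) hKm.aemeasurable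
  have hone : ∀ t : E 1, ∫⁻ s, ‖(bump 1 r).normed volume (ι s - t)‖ₑ = 1 := by
    intro t
    have hm : Measurable fun z : E 1 => ‖(bump 1 r).normed volume (z - t)‖ₑ :=
      ((bump 1 r).continuous_normed.measurable.comp (measurable_id.sub_const t)).enorm
    rw [hι.lintegral_comp hm,
      lintegral_sub_right_eq_self (fun z : E 1 => ‖(bump 1 r).normed volume z‖ₑ) t]
    exact lintegral_enorm_bump r
  calc ‖mollify r f (ι a) - mollify r f (ι b)‖ₑ = ‖∫ s in Set.uIoc b a, F' s‖ₑ := by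
        rw [← hftc, ← ofReal_norm, ← ofReal_norm,
          intervalIntegral.norm_integral_eq_norm_integral_uIoc]
    _ ≤ ∫⁻ s in Set.uIoc b a, ‖F' s‖ₑ := enorm_integral_le_lintegral_enorm _
    _ ≤ ∫⁻ s in Set.uIoc b a, ∫⁻ t, ‖(bump 1 r).normed volume (ι s - t)‖ₑ * ‖g t‖ₑ :=
        lintegral_mono fun s => hF'le s
    _ = ∫⁻ t, ∫⁻ s in Set.uIoc b a, ‖(bump 1 r).normed volume (ι s - t)‖ₑ * ‖g t‖ₑ := hsw
    _ ≤ ∫⁻ t, (Metric.ball (ι a) (‖ι a - ι b‖ + r)).indicator (fun t => ‖g t‖ₑ) t := by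
        refine lintegral_mono fun t => ?_
        by_cases ht : t ∈ Metric.ball (ι a) (‖ι a - ι b‖ + r)
        · rw [Set.indicator_of_mem ht]
          calc _ ≤ ∫⁻ s, ‖(bump 1 r).normed volume (ι s - t)‖ₑ * ‖g t‖ₑ :=
                setLIntegral_le_lintegral _ _
            _ = _ := by rw [lintegral_mul_const' _ _ enorm_ne_top, hone, one_mul]
        · rw [Set.indicator_of_notMem ht, setLIntegral_congr_fun (g := fun _ => 0)
            measurableSet_uIoc]
          · simp
          · intro s hs
            have h4 : ‖ι s - ι a‖ ≤ ‖ι a - ι b‖ := by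
              rw [← map_sub, ← map_sub, ι.norm_map, ι.norm_map]
              have h5 := Set.abs_sub_right_of_mem_uIcc (Set.uIoc_subset_uIcc hs)
              rwa [Real.norm_eq_abs, Real.norm_eq_abs, abs_sub_comm]
            have h6 : ‖ι a - ι b‖ + r ≤ ‖t - ι a‖ := by
              rw [← dist_eq_norm t]; exact not_lt.1 ht
            have h7 : ‖t - ι a‖ ≤ ‖ι s - t‖ + ‖ι s - ι a‖ := by
              rw [← norm_sub_rev t (ι s)]
              exact norm_sub_le_norm_sub_add_norm_sub t (ι s) (ι a)
            simp only
            rw [bump_normed_eq_zero r (by linarith), enorm_zero, zero_mul]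
    _ = _ := lintegral_indicator measurableSet_ball _

/-- The scale tends to 0 along 2⁻ⁱ |x - y|, which keeps the enlarged radius at most 2|x - y|. -/
theorem enorm_sub_le_lintegral_ball {f : E 1 → 𝕜}
    {g : E 1 → EuclideanSpace 𝕜 (Fin 1)} (hgm : Measurable g) (hf : LocallyIntegrable f volume)
    (hg : IsWeakGradient f g) {x y : E 1} (hx : GoodPoint f x) (hy : GoodPoint f y) (hxy : x ≠ y) :
    ‖f x - f y‖ₑ ≤ ∫⁻ t in Metric.ball x (2 * ‖x - y‖), ‖g t‖ₑ := by
  have hd : 0 < ‖x - y‖ := norm_pos_iff.2 (sub_ne_zero.2 hxy)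
  let ρ : ℕ → Set.Ioi (0:ℝ) := fun i => ⟨(2⁻¹:ℝ) ^ i * ‖x - y‖, Set.mem_Ioi.2 (by positivity)⟩
  have hρ : Tendsto ρ atTop (comap Subtype.val (𝓝 0)) := by
    rw [tendsto_comap_iff]
    have := (tendsto_pow_atTop_nhds_zero_of_lt_one (r := (2⁻¹:ℝ)) (by norm_num)
      (by norm_num)).mul_const ‖x - y‖
    rw [zero_mul] at this
    exact this
  refine le_of_tendsto' (((hx.comp hρ).sub (hy.comp hρ)).enorm) fun i => ?_
  refine (enorm_mollify_sub_le_lintegral_ball (ρ i) hgm hf hg x y).trans ?_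
  refine lintegral_mono_set (Metric.ball_subset_ball ?_)
  have h1 : (2⁻¹ : ℝ) ^ i ≤ 1 := pow_le_one₀ (by norm_num) (by norm_num)
  have h2 : ((ρ i : ℝ)) = (2⁻¹ : ℝ) ^ i * ‖x - y‖ := rfl
  rw [h2]
  nlinarith

end

/-! ### Crossing radii for negative exponents in dimension one -/

theorem lintegral_comp_smul {n : ℕ} [NeZero n] {F : E n → ℝ≥0∞} (hF : Measurable F) {ρ : ℝ}
    (hρ : 0 < ρ) :
    ∫⁻ x, F x = ENNReal.ofReal (ρ ^ n) * ∫⁻ x, F (ρ • x) := by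
  have h := Measure.map_addHaar_smul (volume : Measure (E n)) hρ.ne'
  have h1 : ∫⁻ x, F (ρ • x) = ENNReal.ofReal ((ρ ^ n)⁻¹) * ∫⁻ x, F x := by
    rw [← lintegral_map (f := F) (g := fun x => ρ • x) hF (measurable_const_smul ρ), h,
      lintegral_smul_measure]
    simp [abs_of_pos hρ]
  rw [h1, ← mul_assoc, ← ENNReal.ofReal_mul (by positivity), mul_inv_cancel₀ (by positivity),
    ENNReal.ofReal_one, one_mul]

theorem lintegral_add_norm_rpow {e ρ : ℝ} (hρ : 0 < ρ) (b : E 1) :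
    ∫⁻ x : E 1, ENNReal.ofReal ((ρ + ‖x - b‖) ^ e) =
      ENNReal.ofReal (ρ ^ (1 + e)) * ∫⁻ x : E 1, ENNReal.ofReal ((1 + ‖x‖) ^ e) := by
  rw [lintegral_sub_right_eq_self (fun x : E 1 => ENNReal.ofReal ((ρ + ‖x‖) ^ e)) b,
    lintegral_comp_smul (n := 1) (by fun_prop) hρ, Real.rpow_add hρ, Real.rpow_one, pow_one,
    ENNReal.ofReal_mul hρ.le, mul_assoc]
  congr 1
  rw [← lintegral_const_mul' _ _ ENNReal.ofReal_ne_top]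
  refine lintegral_congr fun x => ?_
  rw [← ENNReal.ofReal_mul (by positivity), ← Real.mul_rpow hρ.le (by positivity), norm_smul,
    Real.norm_of_nonneg hρ.le]
  congr 2
  ring

theorem lintegral_one_add_norm_rpow_ne_top {e : ℝ} (he : e < -1) :
    ∫⁻ x : E 1, ENNReal.ofReal ((1 + ‖x‖) ^ e) ≠ ⊤ := by
  have h := finite_integral_one_add_norm (E := E 1) (μ := volume) (r := -e)
    (by simp; linarith)
  simpa using h.ne

/-- The supremum of `ρ^γ` over the radii `ρ` with `∫_{B(x, 2ρ)} G > t ρ^(1+γ)`. -/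
noncomputable def crossSup (γ : ℝ) (G : E 1 → ℝ≥0∞) (t : ℝ) (x : E 1) : ℝ≥0∞ :=
  ⨆ ρ : ℝ, ⨆ _ : 0 < ρ ∧ ENNReal.ofReal (t * ρ ^ (1 + γ)) < ∫⁻ y in Metric.ball x (2 * ρ), G y,
    ENNReal.ofReal (ρ ^ γ)

theorem le_crossSup {γ : ℝ} {G : E 1 → ℝ≥0∞} {t : ℝ} {x : E 1} {ρ : ℝ} (hρ : 0 < ρ)
    (h : ENNReal.ofReal (t * ρ ^ (1 + γ)) < ∫⁻ y in Metric.ball x (2 * ρ), G y) :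
    ENNReal.ofReal (ρ ^ γ) ≤ crossSup γ G t x :=
  le_iSup₂_of_le (f := fun (ρ : ℝ) (_ : 0 < ρ ∧
    ENNReal.ofReal (t * ρ ^ (1 + γ)) < ∫⁻ y in Metric.ball x (2 * ρ), G y) =>
      ENNReal.ofReal (ρ ^ γ)) ρ ⟨hρ, h⟩ le_rfl

/-- With γ negative the supremum is governed by the smallest crossing radius. Each selected ball
with centre b and parameter ρ is charged the function (ρ + |x - b|)^γ, integrable because γ < -1 and
of mass proportional to ρ^(1+γ); the crossing condition bounds this mass by t⁻¹ times the integral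
of G over the ball. -/
theorem exists_lintegral_crossSup_le {γ : ℝ} (hγ : γ < -1) :
    ∃ C : ℝ≥0∞, C ≠ ⊤ ∧ ∀ (G : E 1 → ℝ≥0∞) (t : ℝ), ∫⁻ x, G x ≠ ⊤ → 0 < t →
      ∫⁻ x, crossSup γ G t x ≤ C / ENNReal.ofReal t * ∫⁻ x, G x := by
  set J := ∫⁻ x : E 1, ENNReal.ofReal ((1 + ‖x‖) ^ γ) with hJ
  have hJt : J ≠ ⊤ := lintegral_one_add_norm_rpow_ne_top hγ
  refine ⟨ENNReal.ofReal (8⁻¹ ^ γ) * J, by finiteness, fun G t hI ht => ?_⟩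
  have ht' : ENNReal.ofReal t ≠ 0 := by simpa using ht
  let S : Set (E 1 × ℝ) := {a | 0 < a.2 ∧
    ENNReal.ofReal (t * a.2 ^ (1 + γ)) < ∫⁻ y in Metric.ball a.1 (2 * a.2), G y}
  -- Since 1 + γ < 0, finiteness of ∫ G bounds crossing radii from below.
  have hbd : ∀ a ∈ S, a.2⁻¹ ≤ ((∫⁻ x, G x).toReal / t) ^ (1 / (-(1 + γ))) := by
    intro a ha
    have ha0 : 0 < a.2 := ha.1
    have h1 := ENNReal.toReal_mono hI (ha.2.le.trans (setLIntegral_le_lintegral _ _))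
    rw [ENNReal.toReal_ofReal (by positivity)] at h1
    have h2 : a.2⁻¹ ^ (-(1 + γ)) ≤ (∫⁻ x, G x).toReal / t := by
      rw [le_div_iff₀ ht, Real.inv_rpow ha0.le, ← Real.rpow_neg ha0.le, neg_neg, mul_comm]
      exact h1
    calc a.2⁻¹ = (a.2⁻¹ ^ (-(1 + γ))) ^ (1 / (-(1 + γ))) := by
          rw [← Real.rpow_mul (by positivity), mul_one_div_cancel (by linarith), Real.rpow_one]
      _ ≤ _ := by
          refine Real.rpow_le_rpow (by positivity) h2 ?_
          exact one_div_nonneg.2 (by linarith)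
  -- The size function is the inverse radius, so small balls are selected first: each crossing
  -- radius R at x meets a selected ball with ρ ≤ 2R, whence ρ + |x - b| ≤ 8R. This is the origin of
  -- the constant 8.
  obtain ⟨u, hut, hdisj, hcov⟩ := Vitali.exists_disjoint_subfamily_covering_enlargement
    (fun a : E 1 × ℝ => Metric.ball a.1 (2 * a.2)) S (fun a => a.2⁻¹) 2 (by norm_num)
    (fun a ha => inv_nonneg.2 ha.1.le) _ hbd
    (fun a ha => Metric.nonempty_ball.2 (mul_pos two_pos ha.1))
  have hcount : u.Countable := hdisj.countable_of_isOpen (fun a _ => Metric.isOpen_ball)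
    (fun a ha => Metric.nonempty_ball.2 (mul_pos two_pos (hut ha).1))
  have : Countable u := hcount
  have hpt : ∀ x, crossSup γ G t x ≤ ∑' b : u, ENNReal.ofReal (8⁻¹ ^ γ) *
      ENNReal.ofReal ((b.1.2 + ‖x - b.1.1‖) ^ γ) := by
    intro x
    refine iSup₂_le fun R hR => ?_
    obtain ⟨b, hb, ⟨z, hz1, hz2⟩, hRb⟩ := hcov (x, R) hR
    have hb0 : 0 < b.2 := (hut hb).1
    have hR0 : 0 < R := hR.1
    simp only [Metric.mem_ball] at hz1 hz2 hRb
    have h3 : b.2 ≤ 2 * R := by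
      have h4 : R⁻¹ ≤ 2 / b.2 := by rw [div_eq_mul_inv]; exact hRb
      rw [inv_le_comm₀ hR0 (by positivity), inv_div] at h4
      linarith
    refine le_trans ?_ (ENNReal.le_tsum ⟨b, hb⟩)
    rw [← ENNReal.ofReal_mul (by positivity), ← Real.mul_rpow (by norm_num) (by positivity)]
    refine ENNReal.ofReal_le_ofReal (Real.rpow_le_rpow_of_nonpos (by positivity) ?_ (by linarith))
    have := dist_triangle_left x b.1 z
    rw [dist_eq_norm x b.1] at this
    linarith
  have hone : ∀ b : u, ∫⁻ x, ENNReal.ofReal (8⁻¹ ^ γ) *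
      ENNReal.ofReal ((b.1.2 + ‖x - b.1.1‖) ^ γ) ≤
      ENNReal.ofReal (8⁻¹ ^ γ) * J / ENNReal.ofReal t *
        ∫⁻ y in Metric.ball b.1.1 (2 * b.1.2), G y := by
    intro b
    have hb := hut b.2
    have hb0 : 0 < b.1.2 := hb.1
    rw [lintegral_const_mul' _ _ ENNReal.ofReal_ne_top, lintegral_add_norm_rpow hb0, ← hJ]
    have h2 := hb.2.le
    rw [ENNReal.ofReal_mul ht.le] at h2
    calc _ = ENNReal.ofReal (8⁻¹ ^ γ) * J * ((ENNReal.ofReal t)⁻¹ * ENNReal.ofReal t) *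
          ENNReal.ofReal (b.1.2 ^ (1 + γ)) := by
          rw [ENNReal.inv_mul_cancel ht' ENNReal.ofReal_ne_top]; ring
      _ = ENNReal.ofReal (8⁻¹ ^ γ) * J * (ENNReal.ofReal t)⁻¹ * (ENNReal.ofReal t *
          ENNReal.ofReal (b.1.2 ^ (1 + γ))) := by ring
      _ ≤ _ := by rw [div_eq_mul_inv]; gcongr
  calc _ ≤ ∫⁻ x, ∑' b : u, ENNReal.ofReal (8⁻¹ ^ γ) *
        ENNReal.ofReal ((b.1.2 + ‖x - b.1.1‖) ^ γ) := lintegral_mono hpt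
    _ = ∑' b : u, ∫⁻ x, ENNReal.ofReal (8⁻¹ ^ γ) *
        ENNReal.ofReal ((b.1.2 + ‖x - b.1.1‖) ^ γ) :=
        lintegral_tsum fun b => by fun_prop
    _ ≤ ∑' b : u, ENNReal.ofReal (8⁻¹ ^ γ) * J / ENNReal.ofReal t *
        ∫⁻ y in Metric.ball b.1.1 (2 * b.1.2), G y := ENNReal.tsum_le_tsum hone
    _ = ENNReal.ofReal (8⁻¹ ^ γ) * J / ENNReal.ofReal t *
        ∫⁻ y in ⋃ b : u, Metric.ball b.1.1 (2 * b.1.2), G y := by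
        rw [ENNReal.tsum_mul_left, lintegral_iUnion (fun b => Metric.isOpen_ball.measurableSet)]
        exact hdisj.subtype _ _
    _ ≤ _ := by
        gcongr
        exact Measure.restrict_le_self

section

variable {𝕜 : Type*} [RCLike 𝕜]

theorem lintegral_norm_sub_rpow_le {γ v : ℝ} (hγ : γ ≤ 1) (hv : 0 < v) (x : E 1) :
    ∫⁻ y, {y | v ≤ ‖x - y‖}.indicator (fun y => ENNReal.ofReal (‖x - y‖ ^ (γ - 1))) y ≤
      ENNReal.ofReal (2⁻¹ ^ (γ - 1)) * (∫⁻ x : E 1, ENNReal.ofReal ((1 + ‖x‖) ^ (γ - 1))) *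
        ENNReal.ofReal (v ^ γ) := by
  calc _ ≤ ∫⁻ y, ENNReal.ofReal (2⁻¹ ^ (γ - 1)) * ENNReal.ofReal ((v + ‖y - x‖) ^ (γ - 1)) := by
        refine lintegral_mono fun y => ?_
        by_cases hy : y ∈ {y | v ≤ ‖x - y‖}
        · have hy' : v ≤ ‖x - y‖ := hy
          rw [Set.indicator_of_mem hy, ← ENNReal.ofReal_mul (by positivity),
            ← Real.mul_rpow (by norm_num) (by positivity), norm_sub_rev y x]
          exact ENNReal.ofReal_le_ofReal
            (Real.rpow_le_rpow_of_nonpos (by positivity) (by linarith) (by linarith))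
        · rw [Set.indicator_of_notMem hy]; exact zero_le
    _ = _ := by
        rw [lintegral_const_mul' _ _ ENNReal.ofReal_ne_top, lintegral_add_norm_rpow hv,
          add_sub_cancel]
        ring

/-- For almost every y in the level set, |x - y| is a crossing radius, so |x - y|^γ ≤ V, that is |x
- y| ≥ V^(1/γ). Integrating |x - y|^(γ-1) over that region gives a multiple of V. -/
theorem exists_levelInt_le_crossSup (𝕜 : Type*) [RCLike 𝕜] {γ : ℝ} (hγ : γ < -1) :
    ∃ C : ℝ≥0∞, C ≠ ⊤ ∧ ∀ (f : E 1 → 𝕜) (g : E 1 → EuclideanSpace 𝕜 (Fin 1)), Measurable g →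
      LocallyIntegrable f volume → IsWeakGradient f g → ∀ x, GoodPoint f x → ∀ t : ℝ, 0 < t →
      levelInt γ γ f t x ≤ C * crossSup γ (fun y => ‖g y‖ₑ) t x := by
  set J := ENNReal.ofReal (2⁻¹ ^ (γ - 1)) * ∫⁻ x : E 1, ENNReal.ofReal ((1 + ‖x‖) ^ (γ - 1)) with hJ
  have hJt : J ≠ ⊤ := ENNReal.mul_ne_top ENNReal.ofReal_ne_top
    (lintegral_one_add_norm_rpow_ne_top (by linarith))
  refine ⟨J + 1, by finiteness, fun f g hgm hf hg x hx t ht => ?_⟩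
  set V := crossSup γ (fun y => ‖g y‖ₑ) t x with hV
  have hmem : ∀ᵐ y, (x, y) ∈ levelSet f t γ → 0 < ‖x - y‖ ∧ ENNReal.ofReal (‖x - y‖ ^ γ) ≤ V := by
    filter_upwards [ae_goodPoint hf] with y hy hxy
    have hne : x ≠ y := hxy.1
    have hd : 0 < ‖x - y‖ := norm_pos_iff.2 (sub_ne_zero.2 hne)
    refine ⟨hd, le_crossSup hd (lt_of_lt_of_le ?_ (enorm_sub_le_lintegral_ball hgm hf hg hx hy hne))⟩
    have h1 : t < ‖f x - f y‖ / ‖x - y‖ ^ (1 + γ) := hxy.2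
    rw [lt_div_iff₀ (by positivity)] at h1
    rw [← ofReal_norm]
    exact (ENNReal.ofReal_lt_ofReal_iff_of_nonneg (by positivity)).2 h1
  rcases eq_or_ne V ⊤ with hVt | hVt
  · rw [hVt, ENNReal.mul_top (by simp)]; exact le_top
  rcases eq_or_ne V 0 with hV0 | hV0
  · rw [hV0, mul_zero, levelInt, nonpos_iff_eq_zero]
    rw [lintegral_congr_ae (g := fun _ => 0), lintegral_zero]
    filter_upwards [hmem] with y hy
    refine Set.indicator_of_notMem (fun h => ?_) _
    obtain ⟨h1, h2⟩ := hy h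
    rw [hV0, nonpos_iff_eq_zero, ENNReal.ofReal_eq_zero] at h2
    exact absurd h2 (not_le.2 (by positivity))
  have hV1 : 0 < V.toReal := ENNReal.toReal_pos hV0 hVt
  set v := V.toReal ^ (1 / γ) with hv
  have hv0 : 0 < v := by positivity
  have hvγ : ENNReal.ofReal (v ^ γ) = V := by
    rw [hv, ← Real.rpow_mul hV1.le, one_div_mul_cancel (by linarith), Real.rpow_one,
      ENNReal.ofReal_toReal hVt]
  calc levelInt γ γ f t x
      ≤ ∫⁻ y, {y | v ≤ ‖x - y‖}.indicator (fun y => ENNReal.ofReal (‖x - y‖ ^ (γ - 1))) y := by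
        refine lintegral_mono_ae ?_
        filter_upwards [hmem] with y hy
        by_cases h : (x, y) ∈ levelSet f t γ
        · obtain ⟨h1, h2⟩ := hy h
          rw [← hvγ, ENNReal.ofReal_le_ofReal_iff (by positivity),
            Real.rpow_le_rpow_iff_of_neg h1 hv0 (by linarith)] at h2
          rw [Set.indicator_of_mem h, Set.indicator_of_mem (show y ∈ {y | v ≤ ‖x - y‖} from h2)]
          simp
        · rw [Set.indicator_of_notMem h]; exact zero_le
    _ ≤ J * V := by
        rw [← hvγ]
        exact lintegral_norm_sub_rpow_le (by linarith) hv0 x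
    _ ≤ _ := by gcongr; exact le_self_add

theorem levelFun_one (γ : ℝ) (f : E 1 → 𝕜) (t : ℝ) (x : E 1) :
    levelFun γ 1 f t x = ENNReal.ofReal t * levelInt γ γ f t x := by
  rw [levelFun, ENNReal.rpow_one, div_one]

theorem exists_lintegral_levelFun_le_of_lt_neg_one (𝕜 : Type*) [RCLike 𝕜] {γ : ℝ} (hγ : γ < -1) :
    ∃ C : ℝ≥0∞, C ≠ ⊤ ∧ ∀ (f : E 1 → 𝕜) (g : E 1 → EuclideanSpace 𝕜 (Fin 1)), Measurable g →
      LocallyIntegrable f volume → IsWeakGradient f g → ∫⁻ x, ‖g x‖ₑ ≠ ⊤ → ∀ t : ℝ, 0 < t →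
      ∫⁻ x, levelFun γ 1 f t x ≤ C * ∫⁻ x, ‖g x‖ₑ := by
  obtain ⟨C₁, hC₁, h1⟩ := exists_levelInt_le_crossSup 𝕜 hγ
  obtain ⟨C₂, hC₂, h2⟩ := exists_lintegral_crossSup_le hγ
  refine ⟨C₁ * C₂, by finiteness, fun f g hgm hf hg hI t ht => ?_⟩
  calc _ ≤ ∫⁻ x, ENNReal.ofReal t * (C₁ * crossSup γ (fun y => ‖g y‖ₑ) t x) := by
        refine lintegral_mono_ae ?_
        filter_upwards [ae_goodPoint hf] with x hx
        rw [levelFun_one]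
        gcongr
        exact h1 f g hgm hf hg x hx t ht
    _ = ENNReal.ofReal t * (C₁ * ∫⁻ x, crossSup γ (fun y => ‖g y‖ₑ) t x) := by
        rw [lintegral_const_mul' _ _ ENNReal.ofReal_ne_top, lintegral_const_mul' _ _ hC₁]
    _ ≤ ENNReal.ofReal t * (C₁ * (C₂ / ENNReal.ofReal t * ∫⁻ x, ‖g x‖ₑ)) := by
        gcongr
        exact h2 _ t hI ht
    _ = C₁ * (ENNReal.ofReal t * (C₂ / ENNReal.ofReal t)) * ∫⁻ x, ‖g x‖ₑ := by ring
    _ = _ := by rw [ENNReal.mul_div_cancel (by simpa using ht) ENNReal.ofReal_ne_top]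

theorem crossSup_add_le (γ : ℝ) {G H : E 1 → ℝ≥0∞} (hG : Measurable G) {t : ℝ} (ht : 0 < t)
    (x : E 1) : crossSup γ (fun y => G y + H y) t x ≤
      crossSup γ G (t / 2) x + crossSup γ H (t / 2) x := by
  refine iSup₂_le fun R hR => ?_
  have hR0 : 0 < R := hR.1
  by_cases h1 : ENNReal.ofReal (t / 2 * R ^ (1 + γ)) < ∫⁻ y in Metric.ball x (2 * R), G y
  · exact (le_crossSup hR0 h1).trans le_self_add
  by_cases h2 : ENNReal.ofReal (t / 2 * R ^ (1 + γ)) < ∫⁻ y in Metric.ball x (2 * R), H y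
  · exact (le_crossSup hR0 h2).trans le_add_self
  exfalso
  have h3 := hR.2
  rw [lintegral_add_left hG] at h3
  refine absurd h3 (not_lt.2 ((add_le_add (not_lt.1 h1) (not_lt.1 h2)).trans (le_of_eq ?_)))
  rw [← ENNReal.ofReal_add (by positivity) (by positivity)]
  congr 1; ring

theorem lintegral_ball_core_le (G : E 1 → ℝ≥0∞) (K : ℝ) (x : E 1) {R : ℝ} (hR : 0 < R) :
    ∫⁻ y in Metric.ball x R, (coreSet G K).indicator G y ≤
      ENNReal.ofReal K * (ENNReal.ofReal R * volume (Metric.ball (0 : E 1) 1)) := by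
  rw [lintegral_ball_eq_ballAvg _ _ hR, volume_ball_eq x hR.le, pow_one]
  gcongr
  exact ballAvg_core_le G K x hR

/-- Near the core, its bound K turns the crossing condition into t R^γ ≤ 4Km, with m the length of
the unit ball. Far away a crossing ball must reach the core, so R is at least comparable to 1 + ‖x‖.
Both yield the same integrable majorant, uniformly for t ≤ 1. -/
theorem exists_crossSup_core_le {γ : ℝ} (hγ : γ < -1) (G : E 1 → ℝ≥0∞) {K : ℝ} (hK : 0 < K) :
    ∃ C : ℝ≥0∞, C ≠ ⊤ ∧ ∀ t : ℝ, 0 < t → t ≤ 1 → ∀ x,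
      ENNReal.ofReal t * crossSup γ ((coreSet G K).indicator G) (t / 2) x ≤
        C * ENNReal.ofReal ((1 + ‖x‖) ^ γ) := by
  set m := (volume (Metric.ball (0 : E 1) 1)).toReal with hm
  have hmv : volume (Metric.ball (0 : E 1) 1) = ENNReal.ofReal m :=
    (ENNReal.ofReal_toReal (volume_ball_ne_top _ _)).symm
  have hm0 : 0 < m := ENNReal.toReal_pos (volume_ball_pos _ one_pos) (volume_ball_ne_top _ _)
  -- The constant c₁ serves ‖x‖ ≤ 2K and c₂ serves ‖x‖ > 2K.
  set c₁ := 4 * K * m * (1 + 2 * K) ^ (-γ) with hc₁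
  set c₂ := (K / (2 * (1 + 2 * K))) ^ γ with hc₂
  refine ⟨ENNReal.ofReal (max c₁ c₂), ENNReal.ofReal_ne_top, fun t ht ht1 x => ?_⟩
  rw [crossSup, ENNReal.mul_iSup]
  refine iSup_le fun R => ?_
  rw [ENNReal.mul_iSup]
  refine iSup_le fun hR => ?_
  have hR0 : 0 < R := hR.1
  have hx0 := norm_nonneg x
  rw [← ENNReal.ofReal_mul ht.le, ← ENNReal.ofReal_mul (le_max_of_le_right (by positivity))]
  refine ENNReal.ofReal_le_ofReal ?_
  rcases le_or_gt ‖x‖ (2 * K) with hx | hx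
  · have h1 := hR.2.trans_le (lintegral_ball_core_le G K x (by positivity))
    rw [hmv, ← ENNReal.ofReal_mul (by positivity), ← ENNReal.ofReal_mul hK.le] at h1
    have h2 := (ENNReal.ofReal_lt_ofReal_iff_of_nonneg (by positivity)).1 h1
    rw [Real.rpow_add hR0, Real.rpow_one] at h2
    have h3 : t * R ^ γ ≤ 4 * K * m := by
      have : R * (t * R ^ γ) < R * (4 * K * m) := by nlinarith
      exact (lt_of_mul_lt_mul_left this hR0.le).le
    have h4 : 1 ≤ (1 + 2 * K) ^ (-γ) * (1 + ‖x‖) ^ γ := by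
      rw [Real.rpow_neg (by positivity), ← div_eq_inv_mul, one_le_div (by positivity)]
      exact Real.rpow_le_rpow_of_nonpos (by positivity) (by linarith) (by linarith)
    calc t * R ^ γ ≤ 4 * K * m * 1 := by rw [mul_one]; exact h3
      _ ≤ 4 * K * m * ((1 + 2 * K) ^ (-γ) * (1 + ‖x‖) ^ γ) := by gcongr
      _ = c₁ * (1 + ‖x‖) ^ γ := by rw [hc₁]; ring
      _ ≤ _ := by gcongr; exact le_max_left _ _
  · have h1 : ‖x‖ < K + 2 * R := by
      by_contra hcon
      have h2 := hR.2
      rw [lintegral_ball_eq_ballAvg _ _ (by positivity), ballAvg_core_eq_zero (not_lt.1 hcon),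
        zero_mul] at h2
      exact not_lt_zero h2
    have h5 : K / (2 * (1 + 2 * K)) * (1 + ‖x‖) ≤ R := by
      rw [div_mul_eq_mul_div, div_le_iff₀ (by positivity)]
      nlinarith
    calc t * R ^ γ ≤ 1 * (K / (2 * (1 + 2 * K)) * (1 + ‖x‖)) ^ γ := by
          have h6 : 0 < K / (2 * (1 + 2 * K)) * (1 + ‖x‖) := by positivity
          exact mul_le_mul ht1 (Real.rpow_le_rpow_of_nonpos h6 h5 (by linarith)) (by positivity)
            zero_le_one
      _ = c₂ * (1 + ‖x‖) ^ γ := by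
          rw [one_mul, Real.mul_rpow (by positivity) (by positivity)]
      _ ≤ _ := by gcongr; exact le_max_right _ _

/-- The core of the gradient gives a majorant independent of small t, and the remainder of small L¹
norm is absorbed by the covering bound. -/
theorem exists_levelFun_le_add_of_lt_neg_one {γ : ℝ} (hγ : γ < -1) {f : E 1 → 𝕜}
    {g : E 1 → EuclideanSpace 𝕜 (Fin 1)} (hgm : Measurable g) (hf : LocallyIntegrable f volume)
    (hg : IsWeakGradient f g) (hfin : ∫⁻ x, ‖g x‖ₑ ≠ ⊤) {ε : ℝ≥0∞} (hε : ε ≠ 0) :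
    ∃ D : E 1 → ℝ≥0∞, Measurable D ∧ ∫⁻ x, D x ≠ ⊤ ∧ ∀ᶠ t in 𝓝[>] (0 : ℝ), ∃ w : E 1 → ℝ≥0∞,
      (∀ᵐ x, levelFun γ 1 f t x ≤ D x + w x) ∧ ∫⁻ x, w x ≤ ε := by
  obtain ⟨C₁, hC₁, h1⟩ := exists_levelInt_le_crossSup 𝕜 hγ
  obtain ⟨C₂, hC₂, h2⟩ := exists_lintegral_crossSup_le hγ
  obtain ⟨δ, hδ, hδε⟩ := exists_mul_le_half (M := C₁ * (2 * C₂)) (by finiteness) hε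
  set G : E 1 → ℝ≥0∞ := fun y => ‖g y‖ₑ with hG
  have hGm : Measurable G := hgm.enorm
  obtain ⟨K, hK, hKδ⟩ := exists_lintegral_coreSet_compl_le hGm hfin hδ
  set G₁ := (coreSet G K).indicator G with hG₁
  set G₂ := (coreSet G K)ᶜ.indicator G with hG₂
  have hG₁m : Measurable G₁ := hGm.indicator (measurableSet_coreSet hGm K)
  have hsum : G = fun y => G₁ y + G₂ y := (Set.indicator_self_add_compl (coreSet G K) G).symm
  have hG₂t : ∫⁻ x, G₂ x ≠ ⊤ :=
    ne_top_of_le_ne_top hfin (lintegral_mono fun x => Set.indicator_le_self _ _ _)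
  obtain ⟨C₃, hC₃, h3⟩ := exists_crossSup_core_le hγ G hK
  have hJ := lintegral_one_add_norm_rpow_ne_top hγ
  refine ⟨fun x => C₁ * (C₃ * ENNReal.ofReal ((1 + ‖x‖) ^ γ)), by fun_prop, ?_, ?_⟩
  · rw [lintegral_const_mul' _ _ hC₁, lintegral_const_mul' _ _ hC₃]
    finiteness
  filter_upwards [Ioc_mem_nhdsGT one_pos] with t ht
  have ht0 : 0 < t := ht.1
  refine ⟨fun x => C₁ * (ENNReal.ofReal t * crossSup γ G₂ (t / 2) x), ?_, ?_⟩
  · filter_upwards [ae_goodPoint hf] with x hx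
    rw [levelFun_one]
    calc _ ≤ ENNReal.ofReal t * (C₁ * (crossSup γ G₁ (t / 2) x + crossSup γ G₂ (t / 2) x)) := by
          gcongr
          refine (h1 f g hgm hf hg x hx t ht0).trans (mul_le_mul_right ?_ _)
          change crossSup γ G t x ≤ _
          rw [hsum]
          exact crossSup_add_le γ hG₁m ht0 x
      _ = C₁ * (ENNReal.ofReal t * crossSup γ G₁ (t / 2) x) +
          C₁ * (ENNReal.ofReal t * crossSup γ G₂ (t / 2) x) := by ring
      _ ≤ _ := by
          gcongr ?_ + _
          exact mul_le_mul_right (h3 t ht0 ht.2 x) _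
  · rw [lintegral_const_mul' _ _ hC₁, lintegral_const_mul' _ _ ENNReal.ofReal_ne_top]
    calc _ ≤ C₁ * (ENNReal.ofReal t * (C₂ / ENNReal.ofReal (t / 2) * δ)) := by
          gcongr
          exact (h2 G₂ (t / 2) hG₂t (by positivity)).trans (by gcongr)
      _ = C₁ * (ENNReal.ofReal t * (2 * C₂ / ENNReal.ofReal t)) * δ := by
          rw [ENNReal.ofReal_div_of_pos two_pos, ENNReal.ofReal_ofNat, ENNReal.div_eq_inv_mul,
            ENNReal.inv_div (by simp) (by simp), ENNReal.div_eq_inv_mul, ENNReal.div_eq_inv_mul]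
          ring
      _ = C₁ * (2 * C₂) * δ := by
          rw [ENNReal.mul_div_cancel (by simpa using ht0) ENNReal.ofReal_ne_top]
      _ ≤ ε / 2 := hδε
      _ ≤ ε := ENNReal.half_le_self

end

/-! ### Limits and bounds for the level functional -/

/-- The direction of the limit in the level parameter. -/
noncomputable def levelFilter (γ : ℝ) : Filter ℝ := if 0 < γ then atTop else 𝓝[>] 0

instance (γ : ℝ) : (levelFilter γ).NeBot := by
  unfold levelFilter; split_ifs <;> infer_instance

instance (γ : ℝ) : (levelFilter γ).IsCountablyGenerated := by
  unfold levelFilter; split_ifs <;> infer_instance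

theorem eventually_pos_levelFilter (γ : ℝ) : ∀ᶠ t in levelFilter γ, 0 < t := by
  unfold levelFilter
  split_ifs
  · exact eventually_gt_atTop 0
  · exact self_mem_nhdsWithin

/-- The critical length t^(-q/γ) shrinks to 0 in either regime, which allows one blow-up argument
for both signs of γ. -/
theorem tendsto_rpow_levelFilter {γ q : ℝ} (hγ : γ ≠ 0) (hq : 0 < q) :
    Tendsto (fun t : ℝ => t ^ (-(q / γ))) (levelFilter γ) (𝓝[>] 0) := by
  refine tendsto_nhdsWithin_iff.2 ⟨?_, ?_⟩
  · unfold levelFilter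
    split_ifs with h
    · exact tendsto_rpow_neg_atTop (by positivity)
    · have h1 : 0 < -(q / γ) := by
        rw [neg_pos]; exact div_neg_of_pos_of_neg hq (lt_of_le_of_ne (not_lt.1 h) hγ)
      have h2 := (Real.continuousAt_rpow_const 0 (-(q / γ)) (Or.inr h1.le)).tendsto
      rw [Real.zero_rpow h1.ne'] at h2
      exact h2.mono_left nhdsWithin_le_nhds
  · filter_upwards [eventually_pos_levelFilter γ] with t ht
    exact Real.rpow_pos_of_pos ht _

section

variable {n : ℕ} [NeZero n] {𝕜 : Type*} [RCLike 𝕜]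

/-- Exponents and uniform estimates from which the bounds and limits of the level functional
follow. -/
structure LevelEstimate (n : ℕ) [NeZero n] (𝕜 : Type*) [RCLike 𝕜] (p γ q : ℝ) : Prop where
  exponents : ∃ s r : ℝ, 1 ≤ s ∧ s ≤ p ∧ q < r ∧ s ≤ r ∧ n * (1 / s - 1 / r) < 1
  bound : ∃ C : ℝ≥0∞, C ≠ ⊤ ∧ ∀ (f : E n → 𝕜) (g : E n → EuclideanSpace 𝕜 (Fin n)), Measurable f →
    Measurable g → LocallyIntegrable f volume → IsWeakGradient f g → ∫⁻ x, ‖g x‖ₑ ^ p ≠ ⊤ →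
    ∀ t : ℝ, 0 < t → ∫⁻ x, levelFun γ q f t x ^ (p / q) ≤ C * ∫⁻ x, ‖g x‖ₑ ^ p
  domination : ∀ (f : E n → 𝕜) (g : E n → EuclideanSpace 𝕜 (Fin n)), Measurable f →
    Measurable g → LocallyIntegrable f volume → IsWeakGradient f g → ∫⁻ x, ‖g x‖ₑ ^ p ≠ ⊤ →
    ∀ ε : ℝ≥0∞, ε ≠ 0 → ∃ D : E n → ℝ≥0∞, Measurable D ∧ ∫⁻ x, D x ≠ ⊤ ∧
      ∀ᶠ t in levelFilter γ, ∃ w : E n → ℝ≥0∞,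
        (∀ᵐ x, levelFun γ q f t x ^ (p / q) ≤ D x + w x) ∧ ∫⁻ x, w x ≤ ε

theorem levelEstimate_of_one_lt {p γ q : ℝ} (hp : 1 < p) (hγ : γ ≠ 0) (hq : 0 < q)
    (hn : n * (1 / p - 1 / q) < 1) : LevelEstimate n 𝕜 p γ q where
  exponents := by
    obtain ⟨s, r, h1, h2, h3, h4, h5⟩ := exists_exponents hp hn
    exact ⟨s, r, h1, h2.le, h3, h4, h5⟩
  bound := by
    obtain ⟨C, hC, h⟩ := exists_levelFun_rpow_le_maxFun n 𝕜 hp hγ hq hn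
    refine ⟨C, hC, fun f g hfm hgm hf hg _ t ht => ?_⟩
    obtain ⟨D, -, h2, h3⟩ := h f g hfm hgm hf hg
    exact (lintegral_mono_ae (h3 t ht)).trans h2
  domination := by
    obtain ⟨C, hC, h⟩ := exists_levelFun_rpow_le_maxFun n 𝕜 hp hγ hq hn
    intro f g hfm hgm hf hg hfin ε _
    obtain ⟨D, h1, h2, h3⟩ := h f g hfm hgm hf hg
    refine ⟨D, h1, ne_top_of_le_ne_top (ENNReal.mul_ne_top hC hfin) h2, ?_⟩
    filter_upwards [eventually_pos_levelFilter γ] with t ht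
    refine ⟨fun _ => 0, ?_, by simp⟩
    simpa using h3 t ht

theorem levelEstimate_one_of_pos {γ q : ℝ} (hγ : 0 < γ) (hq : 0 < q)
    (hn : n * (1 / 1 - 1 / q) < 1) : LevelEstimate n 𝕜 1 γ q where
  exponents := by
    obtain ⟨r, h1, h2, h3⟩ := exists_exponent_gt le_rfl hn
    exact ⟨1, r, le_rfl, le_rfl, h1, h2, h3⟩
  bound := by
    obtain ⟨C, hC, h⟩ := exists_lintegral_levelFun_le_of_pos n 𝕜 hγ hq hn
    refine ⟨C, hC, fun f g hfm hgm hf hg _ t ht => ?_⟩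
    simpa only [ENNReal.rpow_one] using h f g hfm hgm hf hg t ht
  domination := by
    intro f g hfm hgm hf hg hfin ε hε
    simp only [ENNReal.rpow_one] at hfin
    rw [levelFilter, if_pos hγ]
    exact exists_levelFun_le_add_of_pos hγ hq hn hfm hgm hf hg hfin hε

theorem levelEstimate_one_of_lt_neg_one {γ : ℝ} (hγ : γ < -1) : LevelEstimate 1 𝕜 1 γ 1 where
  exponents := ⟨1, 2, by norm_num, by norm_num, by norm_num, by norm_num, by norm_num⟩
  bound := by
    obtain ⟨C, hC, h⟩ := exists_lintegral_levelFun_le_of_lt_neg_one 𝕜 hγ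
    refine ⟨C, hC, fun f g _ hgm hf hg hfin t ht => ?_⟩
    simp only [ENNReal.rpow_one] at hfin
    simpa only [div_one, ENNReal.rpow_one] using h f g hgm hf hg hfin t ht
  domination := by
    intro f g _ hgm hf hg hfin ε hε
    simp only [ENNReal.rpow_one] at hfin
    rw [levelFilter, if_neg (by linarith)]
    simpa only [div_one, ENNReal.rpow_one] using
      exists_levelFun_le_add_of_lt_neg_one hγ hgm hf hg hfin hε

/-- All cases with p > 1 reduce to n(1/p - 1/q) < 1: it is automatic when n < p because n/p < 1, and
when q ≤ p because the left side is then nonpositive. Only p = 1 needs the covering arguments. -/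
theorem levelEstimate_of_cases {p γ q : ℝ} (hp : 1 ≤ p) (hγ : γ ≠ 0) (hq : 0 < q)
    (hcase : (n : ℝ) < p ∨ (p ≤ n ∧ 0 < γ ∧ (n : ℝ) * (1 / p - 1 / q) < 1) ∨
      (1 < p ∧ p ≤ n ∧ γ < 0 ∧ q ≤ p) ∨ (p = 1 ∧ q = 1 ∧ n = 1 ∧ γ < -1)) :
    LevelEstimate n 𝕜 p γ q := by
  have hn1 : (1 : ℝ) ≤ n := by exact_mod_cast NeZero.one_le (n := n)
  rcases hcase with h | ⟨-, h1, h2⟩ | ⟨h1, -, -, h2⟩ | ⟨rfl, rfl, rfl, h⟩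
  · refine levelEstimate_of_one_lt (by linarith) hγ hq ?_
    have h1 : (n : ℝ) * (1 / p) < 1 := by rw [mul_one_div, div_lt_one (by linarith)]; exact h
    have h2 : 0 < (n : ℝ) * (1 / q) := by positivity
    rw [mul_sub]; linarith
  · rcases hp.eq_or_lt with rfl | hp
    · exact levelEstimate_one_of_pos h1 hq h2
    · exact levelEstimate_of_one_lt hp hγ hq h2
  · refine levelEstimate_of_one_lt h1 hγ hq ?_
    have h3 : 1 / p ≤ 1 / q := one_div_le_one_div_of_le hq h2
    have h4 : (n : ℝ) * (1 / p - 1 / q) ≤ 0 :=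
      mul_nonpos_of_nonneg_of_nonpos (by linarith) (by linarith)
    linarith
  · exact levelEstimate_one_of_lt_neg_one h

theorem LevelEstimate.tendsto_lintegral {p γ q : ℝ} (h : LevelEstimate n 𝕜 p γ q) (hγ : γ ≠ 0)
    (hq : 0 < q) {f : E n → 𝕜} {g : E n → EuclideanSpace 𝕜 (Fin n)}
    (hfm : Measurable f) (hgm : Measurable g) (hf : LocallyIntegrable f volume)
    (hg : IsWeakGradient f g) (hfin : ∫⁻ x, ‖g x‖ₑ ^ p ≠ ⊤) :
    Tendsto (fun t => ∫⁻ x, levelFun γ q f t x ^ (p / q)) (levelFilter γ)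
      (𝓝 (∫⁻ x, (ENNReal.ofReal |γ|⁻¹ * dirInt q (g x)) ^ (p / q))) := by
  obtain ⟨s, r, hs, hsp, hqr, hsr, hn⟩ := h.exponents
  refine tendsto_lintegral_of_dominated_add
    (fun t => (measurable_levelFun hfm _ _ _).pow_const _) ?_ (h.domination f g hfm hgm hf hg hfin)
  filter_upwards [ae_regularPoint hgm hf hs hsp hfin] with x hx
  have h1 := hx.tendsto_levelInt hγ hq hqr hs hsr hn hfm hgm hf hg
    (eventually_pos_levelFilter γ) (tendsto_rpow_levelFilter hγ hq)
  exact ((ENNReal.continuous_rpow_const (y := p / q)).tendsto _).comp h1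

theorem levelInt_congr_ae {f f' : E n → 𝕜} (h : f =ᵐ[volume] f') (γ b t : ℝ) :
    levelInt γ b f t =ᵐ[volume] levelInt γ b f' t := by
  filter_upwards [h] with x hx
  refine lintegral_congr_ae ?_
  filter_upwards [h] with y hy
  have : (x, y) ∈ levelSet f t b ↔ (x, y) ∈ levelSet f' t b := by
    simp only [levelSet, Set.mem_ofPred_eq, hx, hy]
  by_cases h' : (x, y) ∈ levelSet f t b
  · rw [Set.indicator_of_mem h', Set.indicator_of_mem (this.1 h')]
  · rw [Set.indicator_of_notMem h', Set.indicator_of_notMem fun h'' => h' (this.2 h'')]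

theorem levelNorm_eq {p γ q t : ℝ} (hp : 0 < p) (hq : 0 < q) (f : E n → 𝕜) :
    levelNorm p γ q f t = (∫⁻ x, levelFun γ q f t x ^ (p / q)) ^ (1 / p) := by
  have h1 : ENNReal.ofReal p ≠ 0 := by simpa using hp
  have h2 : ∀ x, levelFun γ q f t x ^ (p / q) =
      ENNReal.ofReal t ^ p * (levelInt γ (γ / q) f t x ^ (1 / q)) ^ p := fun x => by
    rw [levelFun, ENNReal.mul_rpow_of_nonneg _ _ (by positivity : 0 ≤ p / q), ← ENNReal.rpow_mul,
      ← ENNReal.rpow_mul, mul_div_cancel₀ _ hq.ne', one_div_mul_eq_div]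
  simp_rw [h2]
  rw [lintegral_const_mul' _ _ (by finiteness),
    ENNReal.mul_rpow_of_nonneg _ _ (by positivity : 0 ≤ 1 / p), ← ENNReal.rpow_mul,
    mul_one_div_cancel hp.ne', ENNReal.rpow_one, levelNorm,
    eLpNorm_eq_lintegral_rpow_enorm_toReal h1 ENNReal.ofReal_ne_top, ENNReal.toReal_ofReal hp.le]
  rfl

theorem IsWeakGradient.congr_ae {f f' : E n → 𝕜} {g g' : E n → EuclideanSpace 𝕜 (Fin n)}
    (h : IsWeakGradient f g) (hf : f =ᵐ[volume] f') (hg : g =ᵐ[volume] g') :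
    IsWeakGradient f' g' := by
  refine ⟨h.1.congr hg, fun j φ hφ hc => ?_⟩
  have h1 : ∫ x, (fderiv ℝ φ x (EuclideanSpace.single j 1)) • f x =
      ∫ x, (fderiv ℝ φ x (EuclideanSpace.single j 1)) • f' x :=
    integral_congr_ae (by filter_upwards [hf] with x hx; rw [hx])
  have h2 : ∫ x, φ x • g x j = ∫ x, φ x • g' x j :=
    integral_congr_ae (by filter_upwards [hg] with x hx; rw [hx])
  rw [← h1, ← h2]
  exact h.2 j φ hφ hc

/-- Everywhere measurable representatives of a Sobolev function and its gradient. -/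
theorem MemHomSobolev.exists_measurable {p : ℝ} (hp : 0 < p) {f : E n → 𝕜}
    (hf : MemHomSobolev p f) : ∃ (f' : E n → 𝕜) (g : E n → EuclideanSpace 𝕜 (Fin n)),
      Measurable f' ∧ Measurable g ∧ LocallyIntegrable f' volume ∧ IsWeakGradient f' g ∧
      ∫⁻ x, ‖g x‖ₑ ^ p ≠ ⊤ ∧ gradNorm p f = (∫⁻ x, ‖g x‖ₑ ^ p) ^ (1 / p) ∧
      ∀ γ q t : ℝ, 0 < q →
        levelNorm p γ q f t = (∫⁻ x, levelFun γ q f' t x ^ (p / q)) ^ (1 / p) := by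
  obtain ⟨hli, hex, hfin⟩ := hf
  have hw : IsWeakGradient f (weakGradient f) := by
    rw [weakGradient, dif_pos hex]; exact hex.choose_spec
  have hfs := hli.aestronglyMeasurable
  have hgs := hw.1.aestronglyMeasurable
  have h1 : ENNReal.ofReal p ≠ 0 := by simpa using hp
  have hnorm : gradNorm p f = (∫⁻ x, ‖hgs.mk _ x‖ₑ ^ p) ^ (1 / p) := by
    rw [gradNorm, eLpNorm_congr_ae hgs.ae_eq_mk,
      eLpNorm_eq_lintegral_rpow_enorm_toReal h1 ENNReal.ofReal_ne_top, ENNReal.toReal_ofReal hp.le]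
  refine ⟨hfs.mk f, hgs.mk _, hfs.stronglyMeasurable_mk.measurable,
    hgs.stronglyMeasurable_mk.measurable, hli.congr hfs.ae_eq_mk,
    hw.congr_ae hfs.ae_eq_mk hgs.ae_eq_mk, ?_, hnorm, fun γ q t hq => ?_⟩
  · rw [hnorm] at hfin
    intro hcon
    rw [hcon, ENNReal.top_rpow_of_pos (by positivity)] at hfin
    exact lt_irrefl _ hfin
  · rw [levelNorm_eq hp hq]
    congr 1
    refine lintegral_congr_ae ?_
    filter_upwards [levelInt_congr_ae hfs.ae_eq_mk γ (γ / q) t] with x hx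
    rw [levelFun, levelFun, hx]

theorem LevelEstimate.tendsto_levelNorm {p γ q : ℝ} (h : LevelEstimate n ℝ p γ q) (hγ : γ ≠ 0)
    (hq : 0 < q) (hp : 0 < p) {e : E n} (he : ‖e‖ = 1) {f : E n → ℝ} (hf : MemHomSobolev p f) :
    Tendsto (fun t => levelNorm p γ q f t) (levelFilter γ)
      (𝓝 (ENNReal.ofReal ((kappa q n e / |γ|) ^ (1 / q)) * gradNorm p f)) := by
  obtain ⟨f', g, hfm, hgm, hf', hg, hfin, hgn, hln⟩ := hf.exists_measurable hp
  rw [hgn, show (fun t => levelNorm p γ q f t) =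
    fun t => (∫⁻ x, levelFun γ q f' t x ^ (p / q)) ^ (1 / p) from funext fun t => hln γ q t hq]
  have hlim := ((ENNReal.continuous_rpow_const (y := 1 / p)).tendsto _).comp
    (h.tendsto_lintegral hγ hq hfm hgm hf' hg hfin)
  have hκ : 0 ≤ kappa q n e := integral_nonneg fun w => by positivity
  have h0 : 0 ≤ kappa q n e / |γ| := by positivity
  suffices h1 : ENNReal.ofReal ((kappa q n e / |γ|) ^ (1 / q)) * (∫⁻ x, ‖g x‖ₑ ^ p) ^ (1 / p) =
      (∫⁻ x, (ENNReal.ofReal |γ|⁻¹ * dirInt q (g x)) ^ (p / q)) ^ (1 / p) by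
    rw [h1]; exact hlim
  have h1 : ∀ x, (ENNReal.ofReal |γ|⁻¹ * dirInt q (g x)) ^ (p / q) =
      ENNReal.ofReal (kappa q n e / |γ|) ^ (p / q) * ‖g x‖ₑ ^ p := fun x => by
    rw [dirInt_real hq he, mul_left_comm, ← ENNReal.ofReal_mul (by positivity), mul_comm,
      ENNReal.mul_rpow_of_nonneg _ _ (by positivity : 0 ≤ p / q), ← ENNReal.rpow_mul,
      mul_div_cancel₀ _ hq.ne', inv_mul_eq_div]
  rw [lintegral_congr h1, lintegral_const_mul' _ _ (by finiteness),
    ENNReal.mul_rpow_of_nonneg _ _ (by positivity : 0 ≤ 1 / p), ← ENNReal.rpow_mul,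
    ← ENNReal.ofReal_rpow_of_nonneg h0 (by positivity)]
  congr 2
  field_simp

/-- The lower bound comes from the limit: the supremum dominates it, and the spherical integral in
it controls |g|^q. -/
theorem LevelEstimate.exists_bounds {p γ q : ℝ} (h : LevelEstimate n 𝕜 p γ q) (hγ : γ ≠ 0)
    (hq : 0 < q) (hp : 0 < p) : ∃ c C : ℝ, 0 < c ∧ 0 < C ∧ ∀ f : E n → 𝕜, MemHomSobolev p f →
      ENNReal.ofReal c * gradNorm p f ≤ (⨆ t ∈ Set.Ioi (0 : ℝ), levelNorm p γ q f t) ∧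
      (⨆ t ∈ Set.Ioi (0 : ℝ), levelNorm p γ q f t) ≤ ENNReal.ofReal C * gradNorm p f := by
  have hp' : 0 ≤ 1 / p := by positivity
  obtain ⟨C, hC, hbd⟩ := h.bound
  obtain ⟨A, hA, hdir⟩ := exists_enorm_rpow_le_dirInt n 𝕜 hq
  set M : ℝ≥0∞ := ((A * ENNReal.ofReal |γ|) ^ (p / q)) ^ (1 / p) with hM
  have hMt : M ≠ ⊤ := by finiteness
  -- The added 1 makes both constants positive even if M or C is zero.
  refine ⟨(M.toReal + 1)⁻¹, (C ^ (1 / p)).toReal + 1, by positivity, by positivity,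
    fun f hf => ?_⟩
  obtain ⟨f', g, hfm, hgm, hf', hg, hfin, hgn, hln⟩ := hf.exists_measurable hp
  constructor
  · have hlim := ((ENNReal.continuous_rpow_const (y := 1 / p)).tendsto _).comp
      (h.tendsto_lintegral hγ hq hfm hgm hf' hg hfin)
    have hsup : (∫⁻ x, (ENNReal.ofReal |γ|⁻¹ * dirInt q (g x)) ^ (p / q)) ^ (1 / p) ≤
        ⨆ t ∈ Set.Ioi (0 : ℝ), levelNorm p γ q f t := by
      refine le_of_tendsto hlim ?_
      filter_upwards [eventually_pos_levelFilter γ] with t ht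
      rw [Function.comp_apply, ← hln γ q t hq]
      exact le_iSup₂ (f := fun (t : ℝ) (_ : t ∈ Set.Ioi (0 : ℝ)) => levelNorm p γ q f t) t ht
    have hgrad : gradNorm p f ≤ M * ⨆ t ∈ Set.Ioi (0 : ℝ), levelNorm p γ q f t := by
      rw [hgn]
      refine le_trans ?_ (mul_le_mul_right hsup _)
      rw [hM, ← ENNReal.mul_rpow_of_nonneg _ _ hp', ← lintegral_const_mul' _ _ (by finiteness)]
      gcongr with x
      rw [← ENNReal.mul_rpow_of_nonneg _ _ (by positivity : 0 ≤ p / q)]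
      calc ‖g x‖ₑ ^ p = (‖g x‖ₑ ^ q) ^ (p / q) := by
            rw [← ENNReal.rpow_mul, mul_div_cancel₀ _ hq.ne']
        _ ≤ (A * dirInt q (g x)) ^ (p / q) := by gcongr; exact hdir _
        _ = _ := by
            rw [mul_assoc, ← mul_assoc (ENNReal.ofReal |γ|), ← ENNReal.ofReal_mul (by positivity),
              mul_inv_cancel₀ (abs_pos.2 hγ).ne', ENNReal.ofReal_one, one_mul]
    rw [ENNReal.ofReal_inv_of_pos (by positivity), mul_comm, ← ENNReal.div_eq_inv_mul.trans
      (mul_comm _ _)]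
    refine ENNReal.div_le_of_le_mul (hgrad.trans ?_)
    rw [mul_comm]
    gcongr
    rw [ENNReal.ofReal_add (by positivity) zero_le_one, ENNReal.ofReal_toReal hMt]
    exact le_self_add
  · refine iSup₂_le fun t ht => ?_
    rw [hln γ q t hq, hgn]
    calc _ ≤ (C * ∫⁻ x, ‖g x‖ₑ ^ p) ^ (1 / p) := by
          gcongr
          exact hbd f' g hfm hgm hf' hg hfin t ht
      _ = C ^ (1 / p) * (∫⁻ x, ‖g x‖ₑ ^ p) ^ (1 / p) := ENNReal.mul_rpow_of_nonneg _ _ hp'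
      _ ≤ _ := by
          gcongr
          rw [ENNReal.ofReal_add (by positivity) zero_le_one,
            ENNReal.ofReal_toReal (by finiteness)]
          exact le_self_add

end

end BVY

/-! ### The main theorem. -/

theorem corollary2120 (n : ℕ) (hn : 1 ≤ n) (p γ q : ℝ) (hp : 1 ≤ p) (hγ : γ ≠ 0) (hq : 0 < q)
    (hcase :
      -- (a)
      (n : ℝ) < p ∨
      -- (b)
      (p ≤ n ∧ 0 < γ ∧ (n : ℝ) * (1 / p - 1 / q) < 1) ∨
      -- (c)
      (1 < p ∧ p ≤ n ∧ γ < 0 ∧ q ≤ p) ∨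
      -- (d)
      (p = 1 ∧ q = 1 ∧ n = 1 ∧ γ < -1)) :
    -- (i), for real-valued and for complex-valued functions
    (∀ (𝕜 : Type) [RCLike 𝕜], ∃ c C : ℝ, 0 < c ∧ 0 < C ∧
      ∀ f : BVY.E n → 𝕜, BVY.MemHomSobolev p f →
        ENNReal.ofReal c * BVY.gradNorm p f ≤ (⨆ t ∈ Set.Ioi (0 : ℝ), BVY.levelNorm p γ q f t) ∧
        (⨆ t ∈ Set.Ioi (0 : ℝ), BVY.levelNorm p γ q f t) ≤ ENNReal.ofReal C * BVY.gradNorm p f) ∧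
    -- (ii)
    (0 < γ → ∀ e : BVY.E n, ‖e‖ = 1 →
      ∀ f : BVY.E n → ℝ, BVY.MemHomSobolev p f →
        Tendsto (fun t : ℝ => BVY.levelNorm p γ q f t) atTop
          (𝓝 (ENNReal.ofReal ((BVY.kappa q n e / γ) ^ (1 / q)) * BVY.gradNorm p f))) ∧
    -- (iii)
    (γ < 0 →
      ((2 ≤ n ∧ q < (n - γ) / n * p) ∨ (n = 1 ∧ q < -p * γ ∧ γ < -1)) →
      ∀ e : BVY.E n, ‖e‖ = 1 →
      ∀ f : BVY.E n → ℝ, BVY.MemHomSobolev p f →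
        Tendsto (fun t : ℝ => BVY.levelNorm p γ q f t) (𝓝[>] 0)
          (𝓝 (ENNReal.ofReal ((-(BVY.kappa q n e) / γ) ^ (1 / q)) * BVY.gradNorm p f))) := by
  have : NeZero n := ⟨by omega⟩
  have hp0 : 0 < p := by linarith
  refine ⟨fun 𝕜 _ => (BVY.levelEstimate_of_cases hp hγ hq hcase).exists_bounds hγ hq hp0, ?_, ?_⟩
  · intro h e he f hf
    have hlim := (BVY.levelEstimate_of_cases hp hγ hq hcase).tendsto_levelNorm hγ hq hp0 he hf
    rwa [BVY.levelFilter, if_pos h, abs_of_pos h] at hlim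
  · intro h _ e he f hf
    have hlim := (BVY.levelEstimate_of_cases hp hγ hq hcase).tendsto_levelNorm hγ hq hp0 he hf
    rwa [BVY.levelFilter, if_neg h.not_gt, abs_of_neg h, div_neg, ← neg_div] at hlim
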